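/- **Setting.** Let $q_0=(\tfrac1{\sqrt3},1)$, $q_1=(0,0)$, $q_2=(\tfrac2{\sqrt3},0)$, $V_0=\{q_0,q_1,q_2\}$, let $F_i(z)=\tfrac13z+\tfrac23q_i$ $(i=0,1,2)$, $F_3(z)=\tfrac13z+\tfrac13(q_1+q_2)$, $F_4(z)=\tfrac13z+\tfrac13(q_0+q_2)$, $F_5(z)=\tfrac13z+\tfrac13(q_0+q_1)$, and let $\mathcal{SG}_3$ be the unique nonempty compact set with $\mathcal{SG}_3=\bigcup_{i=0}^5F_i\mathcal{SG}_3$. Write $F_w=F_{w_1}\circ\cdots\circ F_{w_m}$ for a word $w=w_1\cdots w_m$ of length $|w|=m$, and put $$\mathcal E_m(u,v)=\Big(\frac{15}{7}\Big)^m\sum_{|w|=m}\ \sum_{0\le i<j\le2}\big(u(F_wq_i)-u(F_wq_j)\big)\big(v(F_wq_i)-v(F_wq_j)\big).$$ A continuous function $u$ on $\mathcal{SG}_3$ belongs to $\mathrm{dom}\,\mathcal E$ if $\sup_m\mathcal E_m(u,u)<\infty$. For a relatively open $U\subset\mathcal{SG}_3$, a function $u$ satisfies $\Delta u=0$ in $U$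 if $u\circ F_w\in\mathrm{dom}\,\mathcal E$ for every cell $F_w\mathcal{SG}_3\subset U$, and $\lim_{m\to\infty}\mathcal E_m(u,v)=0$ for every $v\in\mathrm{dom}\,\mathcal E$ with compact support in $U$. For $0<\lambda\le1$ let $\Omega_\lambda=\{(x,y)\in\mathcal{SG}_3\setminus V_0: y>1-\lambda\}$, $X_\lambda=\{(x,y)\in\mathcal{SG}_3: y=1-\lambda\}$, $\partial\Omega_\lambda=\{q_0\}\cup X_\lambda$ and $\bar\Omega_\lambda=\Omega_\lambda\cup\partial\Omega_\lambda$. For $f\in C(\partial\Omega_\lambda)$, a solution of the Dirichlet problem on $\Omega_\lambda$ with data $f$ is a continuous function $u$ on $\bar\Omega_\lambda$ with $\Delta u=0$ in $\Omega_\lambda$ and $u|_{\partial\Omega_\lambda}=f$. Write $\lambda=\sum_{k\ge1}\iota_k3^{-m_k}$ (uniquely) with integers $0<m_1<m_2<\cdots$ and $\iota_k\in\{1,2\}$, and put $R\lambda=\sum_{k\ge2}\iota_k3^{-(m_k-m_1)}\in(0,1]$, $S_1=\{4,5\}$, $S_2=\{1,2,3\}$. For $i\in S_{\iota_1}$ put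 $F_i^\lambda=F_0^{m_1-1}F_i$; for $w=w_1\cdots w_n$ with $w_k\in S_{\iota_k}$ put $F_w^\lambda=F_0^{m_1-1}F_{w_1}F_0^{m_2-m_1-1}F_{w_2}\cdots F_0^{m_n-m_{n-1}-1}F_{w_n}$ and $X_w=F_w^\lambda\mathcal{SG}_3\cap X_\lambda$. Put $p_i=F_0^{m_1-1}F_iq_0$ for $1\le i\le5$. Let $h_0^\lambda$ be the solution of the Dirichlet problem on $\Omega_\lambda$ with value $1$ at $q_0$ and $0$ on $X_\lambda$, and let $\eta(\lambda)$ be its normal derivative at $q_0$, $$\eta(\lambda)=\lim_{m\to\infty}\Big(\frac{15}7\Big)^m\big(2h_0^\lambda(q_0)-h_0^\lambda(F_0^mq_1)-h_0^\lambda(F_0^mq_2)\big).$$ If $\iota_1=1$ put $\mu^\lambda_4=\mu^\lambda_5=\frac12$; if $\iota_1=2$ put $\mu^\lambda_1=\mu^\lambda_2=\frac{6+\eta(R\lambda)}{18+4\eta(R\lambda)}$ and $\mu^\lambda_3=\frac{3+\eta(R\lambda)}{9+2\eta(R\lambda)}$. Let $\mu^\lambda$ be the Borel probability measure on $X_\lambda$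 with $\mu^\lambda(X_w)=\prod_{k=1}^{n}\mu^{R^{k-1}\lambda}_{w_k}$ for all $n\ge 0$ and all $w=w_1\cdots w_n$ with $w_k\in S_{\iota_k}$. **Theorem (Extension Algorithm).** Let $0<\lambda\le1$ and $f\in C(\partial\Omega_\lambda)$. The Dirichlet problem on $\Omega_\lambda$ with data $f$ has a unique solution $u$. The objects $h_0^{R\lambda}$, $\eta(R\lambda)$, $\mu^{R\lambda}$ above are well defined (the solution and the limit exist; the measure exists and is unique), and with $$e=\eta(R\lambda),\qquad I_i=\int_{X_{R\lambda}}f\circ F_i^\lambda\,d\mu^{R\lambda}\quad(i\in S_{\iota_1}),$$ where the functions $f\circ F_i^\lambda$ are $\mu^{R\lambda}$-integrable on $X_{R\lambda}$, the following formulas hold. *Case 1* ($\iota_1=1$): $$u(p_4)=\frac{1}{1+e}f(q_0)+\frac{2e+e^2}{3+4e+e^2}I_4+\frac{e}{3+4e+e^2}I_5,$$ and $u(p_5)$ is given by the same formula with $I_4$ and $I_5$ exchanged. *Case 2* ($\iota_1=2$): with $D=54+165e+102e^2+15e^3$, $$u(p_1)=\frac1D\Big((54+39e+5e^2)f(q_0)+(60e+76e^2+15e^3)I_1+(30e+e^2)I_2+(36e+20e^2)I_3\Big),$$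 $$u(p_3)=\frac{(6+2e)f(q_0)+(5e+3e^2)I_3+4e(I_1+I_2)}{6+15e+3e^2},$$ $$u(p_4)=\frac1D\Big((54+84e+39e^2+5e^3)f(q_0)+(24e+12e^2+e^3)I_1+(30e+27e^2+4e^3)I_2+(27e+24e^2+5e^3)I_3\Big),$$ and $u(p_2)$, $u(p_5)$ are given by the formulas for $u(p_1)$, $u(p_4)$, respectively, with $I_1$ and $I_2$ exchanged. -/

import Mathlib

open Set Filter Topology MeasureTheory

namespace SG3

noncomputable section

/-! Geometry of the level-3 Sierpinski gasket. -/

/-- The points of the plane. -/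
abbrev Plane := ℝ × ℝ

/-- The three boundary vertices `q_0, q_1, q_2`. -/
def q : Fin 3 → Plane :=
  ![(1 / √3, 1), (0, 0), (2 / √3, 0)]

/-- The translation parts (times 3) of the six contractions. -/
def shift : Fin 6 → Plane :=
  ![q 0 + q 0, q 1 + q 1, q 2 + q 2, q 1 + q 2, q 0 + q 2, q 0 + q 1]

/-- The six contractions; `F i` fixes `q i` for `i = 0, 1, 2`. -/
def F (i : Fin 6) (z : Plane) : Plane :=
  (1 / 3 : ℝ) • z + (1 / 3 : ℝ) • shift i

/-- `F_w = F_{w_1} ∘ ⋯ ∘ F_{w_m}` for a finite word `w`. -/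
def Fword : List (Fin 6) → Plane → Plane
  | [] => id
  | i :: w => F i ∘ Fword w

/-- `V_*`: all the vertices `F_w q_i`. -/
def vertices : Set Plane :=
  {z | ∃ (w : List (Fin 6)) (i : Fin 3), z = Fword w (q i)}

/-- The level-3 Sierpinski gasket, as the closure of its vertices; see `gasket_unique` for its
characterization as the attractor of the six contractions. -/
def gasket : Set Plane := closure vertices

theorem F_continuous (i : Fin 6) : Continuous (F i) := by
  unfold F; fun_prop

theorem dist_F (i : Fin 6) (x y : Plane) : dist (F i x) (F i y) = dist x y / 3 := by
  simp only [F, dist_add_right, dist_smul₀]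
  norm_num
  ring

theorem F_q (i : Fin 3) : F (i.castLE (by norm_num)) (q i) = q i := by
  fin_cases i <;> ext <;> simp [F, shift, q] <;> ring

theorem gasket_isClosed : IsClosed gasket := isClosed_closure

theorem q_mem_gasket (i : Fin 3) : q i ∈ gasket :=
  subset_closure ⟨[], i, rfl⟩

theorem F_mem_box (i : Fin 6) {z : Plane} (hz : z ∈ Icc (0 : Plane) (2 / √3, 1)) :
    F i z ∈ Icc (0 : Plane) (2 / √3, 1) := by
  have h3 : (0 : ℝ) < (√3)⁻¹ := by positivity
  obtain ⟨⟨h1, h2⟩, h4, h5⟩ := hz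
  simp only [div_eq_mul_inv, Prod.fst_zero, Prod.snd_zero] at h1 h2 h4 h5
  refine ⟨⟨?_, ?_⟩, ?_, ?_⟩ <;> fin_cases i <;>
    simp [F, shift, q, div_eq_mul_inv] <;> linarith

theorem gasket_subset_box : gasket ⊆ Icc (0 : Plane) (2 / √3, 1) := by
  refine closure_minimal ?_ isClosed_Icc
  rintro z ⟨w, i, rfl⟩
  induction w with
  | nil =>
    refine ⟨⟨?_, ?_⟩, ?_, ?_⟩ <;> fin_cases i <;> simp [Fword, q, div_eq_mul_inv]
  | cons j w ih => exact F_mem_box j ih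

theorem gasket_isCompact : IsCompact gasket :=
  isCompact_Icc.of_isClosed_subset gasket_isClosed gasket_subset_box

theorem F_mem_gasket (i : Fin 6) {z : Plane} (hz : z ∈ gasket) : F i z ∈ gasket := by
  refine map_mem_closure (F_continuous i) hz ?_
  rintro z ⟨w, j, rfl⟩
  exact ⟨i :: w, j, rfl⟩

theorem gasket_eq : gasket = ⋃ i, F i '' gasket := by
  apply Subset.antisymm
  · refine closure_minimal ?_
      (isClosed_iUnion_of_finite fun i => (gasket_isCompact.image (F_continuous i)).isClosed)
    rintro z ⟨w, j, rfl⟩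
    cases w with
    | nil => exact mem_iUnion.2 ⟨_, q j, q_mem_gasket j, F_q j⟩
    | cons i w => exact mem_iUnion.2 ⟨i, _, subset_closure ⟨w, j, rfl⟩, rfl⟩
  · exact iUnion_subset fun i => by rintro _ ⟨z, hz, rfl⟩; exact F_mem_gasket i hz

/-- The gasket is the only nonempty compact set `K` with `K = ⋃ i, F i '' K`. -/
theorem gasket_unique (K : Set Plane) :
    (IsCompact K ∧ K.Nonempty ∧ K = ⋃ i, F i '' K) ↔ K = gasket := by
  constructor
  swap
  · rintro rfl
    exact ⟨gasket_isCompact, ⟨q 0, q_mem_gasket 0⟩, gasket_eq⟩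
  rintro ⟨hc, ⟨x, hx⟩, hK⟩
  have hF : ∀ i, ∀ z ∈ K, F i z ∈ K := fun i z hz => by
    rw [hK]; exact mem_iUnion.2 ⟨i, z, hz, rfl⟩
  apply Subset.antisymm
  · obtain ⟨x₀, hx₀, hmax⟩ := hc.exists_isMaxOn ⟨x, hx⟩
      (Metric.continuous_infDist_pt gasket).continuousOn
    have hne : gasket.Nonempty := ⟨q 0, q_mem_gasket 0⟩
    have h0 : Metric.infDist x₀ gasket ≤ 0 := by
      have hx₀' := hx₀
      rw [hK] at hx₀'
      obtain ⟨i, y, hy, rfl⟩ := mem_iUnion.1 hx₀'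
      obtain ⟨g, hg, hyg⟩ := gasket_isCompact.exists_infDist_eq_dist hne y
      have h1 : Metric.infDist (F i y) gasket ≤ dist (F i y) (F i g) :=
        Metric.infDist_le_dist_of_mem (F_mem_gasket i hg)
      have h2 : Metric.infDist y gasket ≤ Metric.infDist (F i y) gasket := hmax hy
      rw [dist_F, ← hyg] at h1
      linarith
    intro z hz
    have h1 : Metric.infDist z gasket ≤ Metric.infDist x₀ gasket := hmax hz
    exact (gasket_isClosed.mem_iff_infDist_zero hne).2
      (le_antisymm (h1.trans h0) Metric.infDist_nonneg)
  · have hq : ∀ i, q i ∈ K := by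
      intro i
      have hmem : ∀ n : ℕ, (F (i.castLE (by norm_num)))^[n] x ∈ K := by
        intro n
        induction n with
        | zero => exact hx
        | succ n ih => rw [Function.iterate_succ_apply']; exact hF _ _ ih
      have hd : ∀ n : ℕ, dist ((F (i.castLE (by norm_num)))^[n] x) (q i)
          = dist x (q i) * (1 / 3) ^ n := by
        intro n
        induction n with
        | zero => simp
        | succ n ih =>
          rw [Function.iterate_succ_apply']
          conv_lhs => rw [← F_q i]
          rw [dist_F, ih]; ring
      refine hc.isClosed.mem_of_tendsto (b := atTop)
        (f := fun n : ℕ => (F (i.castLE (by norm_num)))^[n] x) ?_ (Eventually.of_forall hmem)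
      rw [tendsto_iff_dist_tendsto_zero]
      simp only [hd]
      simpa using (tendsto_pow_atTop_nhds_zero_of_lt_one (by norm_num : (0 : ℝ) ≤ 1 / 3)
        (by norm_num)).const_mul (dist x (q i))
    refine closure_minimal ?_ hc.isClosed
    rintro z ⟨w, i, rfl⟩
    induction w with
    | nil => exact hq i
    | cons j w ih => exact hF j _ ih

/-! Energy and harmonic functions. -/

/-- `∑ (u x - u y) (v x - v y)` over the three edges of the triangle `q_0 q_1 q_2`. -/
def triangleEnergy (u v : Plane → ℝ) : ℝ :=
  (u (q 0) - u (q 1)) * (v (q 0) - v (q 1)) + (u (q 1) - u (q 2)) * (v (q 1) - v (q 2))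
    + (u (q 2) - u (q 0)) * (v (q 2) - v (q 0))

/-- The graph energy `E_m(u, v) = r^{-m} ∑_{x ∼_m y} (u x - u y) (v x - v y)`, `r = 7/15`.
Every edge of the `m`-th graph is an edge of exactly one `m`-cell, so the sum is organized by
`m`-cells `F_w`, with `w` ranging over the words of length `m`. -/
def graphEnergy (m : ℕ) (u v : Plane → ℝ) : ℝ :=
  (15 / 7 : ℝ) ^ m * ∑ w : Fin m → Fin 6,
    triangleEnergy (u ∘ Fword (List.ofFn w)) (v ∘ Fword (List.ofFn w))

/-- `u` (restricted to the gasket) belongs to the domain of the energy: it is continuous on the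
gasket and the (nondecreasing) sequence of its graph energies is bounded. -/
def InDomEnergy (u : Plane → ℝ) : Prop :=
  ContinuousOn u gasket ∧ BddAbove (range fun m => graphEnergy m u u)

/-- `Δ u = 0` in `U`, a relatively open subset of the gasket, in the weak sense: `u` is locally of
finite energy in `U` (it is of finite energy on every cell contained in `U`), and the energy
`E(u, v) = lim E_m(u, v)` vanishes for each test function `v` of finite energy with compact support
in `U`. Only the values of `u` in `U` matter: for large `m`, the terms of `E_m(u, v)` in which `v`
does not vanish involve points of `U` only. -/
def IsHarmonicOn (U : Set Plane) (u : Plane → ℝ) : Prop :=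
  (∀ w : List (Fin 6), Fword w '' gasket ⊆ U → InDomEnergy (u ∘ Fword w)) ∧
  ∀ v : Plane → ℝ, InDomEnergy v →
    (∃ K : Set Plane, IsCompact K ∧ K ⊆ U ∧ ∀ z ∈ gasket, z ∉ K → v z = 0) →
    Tendsto (fun m => graphEnergy m u v) atTop (𝓝 0)

/-- `u` has normal derivative `d` at `q_0`:
`d = lim r^{-m} (2 u(q_0) - u(F_0^m q_1) - u(F_0^m q_2))`. -/
def HasNormalDerivTop (u : Plane → ℝ) (d : ℝ) : Prop :=
  Tendsto (fun m : ℕ => (15 / 7 : ℝ) ^ m *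
    (2 * u (q 0) - u ((F 0)^[m] (q 1)) - u ((F 0)^[m] (q 2)))) atTop (𝓝 d)

/-! Upper domains and the Dirichlet problem. -/

/-- The upper domain `Ω_lam`. -/
def upperDomain (lam : ℝ) : Set Plane :=
  {z | z ∈ gasket ∧ z ∉ range q ∧ 1 - lam < z.2}

/-- The part `X_lam` of the boundary, on the horizontal cut. -/
def cut (lam : ℝ) : Set Plane :=
  {z | z ∈ gasket ∧ z.2 = 1 - lam}

/-- The boundary `∂Ω_lam = {q_0} ∪ X_lam`. -/
def bdry (lam : ℝ) : Set Plane := {q 0} ∪ cut lam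

/-- The closed domain `Ω_lam ∪ ∂Ω_lam`. -/
def closedDomain (lam : ℝ) : Set Plane := upperDomain lam ∪ bdry lam

/-- `u` solves the Dirichlet problem on `Ω_lam` with boundary data `f`. -/
def IsDirichletSolution (lam : ℝ) (f u : Plane → ℝ) : Prop :=
  ContinuousOn u (closedDomain lam) ∧ IsHarmonicOn (upperDomain lam) u ∧ EqOn u f (bdry lam)

/-! The expansion `lam = ∑_{k ≥ 1} iota_k 3^{-m_k}` of `lam ∈ (0, 1]`, with `0 < m_1 < m_2 < ⋯` and
`iota_k ∈ {1, 2}`. -/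

/-- The first exponent `m_1`: the least `m` with `3^{-m} < lam`. -/
def mOne (lam : ℝ) : ℕ := sInf {m : ℕ | ((3 : ℝ) ^ m)⁻¹ < lam}

/-- The first digit `iota_1`. -/
def iotaOne (lam : ℝ) : ℕ := if (3 : ℝ) ^ mOne lam * lam ≤ 2 then 1 else 2

/-- `R lam = ∑_{k ≥ 2} iota_k 3^{-(m_k - m_1)}`. -/
def R (lam : ℝ) : ℝ := (3 : ℝ) ^ mOne lam * lam - iotaOne lam

/-! The harmonic function `h_0`, its normal derivative `η`, and the boundary measure. -/

/-- `h_0`: the solution of the Dirichlet problem with value `1` at `q_0` and `0` on `X_lam`. -/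
def hZero (lam : ℝ) : Plane → ℝ :=
  Classical.epsilon fun h => IsDirichletSolution lam (indicator {q 0} 1) h

/-- `η(lam)`: the normal derivative of `h_0` at `q_0`. -/
def eta (lam : ℝ) : ℝ :=
  Classical.epsilon fun d => HasNormalDerivTop (hZero lam) d

/-- The letters `S_{iota_1}`. -/
def letters (lam : ℝ) : Finset (Fin 6) :=
  if iotaOne lam = 1 then {4, 5} else {1, 2, 3}

/-- The words `W^lam_* `: the `k`-th letter is in `S_{iota_k}`. -/
def IsAdmissible : ℝ → List (Fin 6) → Prop
  | _, [] => True
  | lam, i :: w => i ∈ letters lam ∧ IsAdmissible (R lam) w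

/-- `F^lam_w = F_0^{m_1-1} F_{w_1} F_0^{m_2-m_1-1} F_{w_2} ⋯ F_0^{m_n-m_{n-1}-1} F_{w_n}`. -/
def Flam : ℝ → List (Fin 6) → Plane → Plane
  | _, [] => id
  | lam, i :: w => (F 0)^[mOne lam - 1] ∘ F i ∘ Flam (R lam) w

/-- `X_w = F^lam_w(gasket) ∩ X_lam`. -/
def cutCell (lam : ℝ) (w : List (Fin 6)) : Set Plane :=
  (Flam lam w '' gasket) ∩ cut lam

/-- The weights `μ^lam_i`, for `i` in `letters lam`. -/
def weight (lam : ℝ) (i : Fin 6) : ℝ :=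
  if iotaOne lam = 1 then 1 / 2
  else if i = 3 then (3 + eta (R lam)) / (9 + 2 * eta (R lam))
  else (6 + eta (R lam)) / (18 + 4 * eta (R lam))

/-- The product `∏_k μ^{lam_{k-1}}_{w_k}`, where `lam_k = R^k lam`. -/
def wordWeight : ℝ → List (Fin 6) → ℝ
  | _, [] => 1
  | lam, i :: w => weight lam i * wordWeight (R lam) w

/-- `ν` is a probability measure on `X_lam` with `ν(X_w) = ∏_k μ^{lam_{k-1}}_{w_k}` for all `w`. -/
def IsCutMeasure (lam : ℝ) (ν : Measure Plane) : Prop :=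
  IsProbabilityMeasure ν ∧ ν (cut lam)ᶜ = 0 ∧
    ∀ w, IsAdmissible lam w → ν (cutCell lam w) = ENNReal.ofReal (wordWeight lam w)

/-- The measure `μ^lam` on `X_lam`. -/
def cutMeasure (lam : ℝ) : Measure Plane :=
  Classical.epsilon fun ν => IsCutMeasure lam ν

/-- The crucial points `p_i = F_0^{m_1-1} F_i q_0`. -/
def p (lam : ℝ) (i : Fin 6) : Plane := (F 0)^[mOne lam - 1] (F i (q 0))

/-- The integral of `f ∘ F^lam_i` over `X_{R lam}` with respect to `μ^{R lam}`. -/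
def cutIntegral (lam : ℝ) (f : Plane → ℝ) (i : Fin 6) : ℝ :=
  ∫ z in cut (R lam), f (Flam lam [i] z) ∂(cutMeasure (R lam))

/-! The recursively defined digits are the expansion stated above. -/

/-- The `k`-th exponent (counting from `0`). -/
def mSeq (lam : ℝ) (k : ℕ) : ℕ := ∑ j ∈ Finset.range (k + 1), mOne (R^[j] lam)

theorem exists_mOne {lam : ℝ} (h0 : 0 < lam) : ∃ m : ℕ, ((3 : ℝ) ^ m)⁻¹ < lam := by
  obtain ⟨n, hn⟩ := exists_pow_lt_of_lt_one h0 (by norm_num : (3 : ℝ)⁻¹ < 1)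
  exact ⟨n, by rwa [← inv_pow]⟩

theorem mOne_pos {lam : ℝ} (h0 : 0 < lam) (h1 : lam ≤ 1) : 0 < mOne lam := by
  rcases Nat.eq_zero_or_pos (mOne lam) with h | h
  · have := Nat.sInf_mem (exists_mOne h0)
    change ((3 : ℝ) ^ mOne lam)⁻¹ < lam at this
    rw [h] at this
    norm_num at this
    linarith
  · exact h

theorem R_mem {lam : ℝ} (h0 : 0 < lam) (h1 : lam ≤ 1) : 0 < R lam ∧ R lam ≤ 1 := by
  have hpos := mOne_pos h0 h1
  have ha : ((3 : ℝ) ^ mOne lam)⁻¹ < lam := Nat.sInf_mem (exists_mOne h0)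
  have hb : lam ≤ ((3 : ℝ) ^ (mOne lam - 1))⁻¹ := by
    have := Nat.notMem_of_lt_sInf (s := {m : ℕ | ((3 : ℝ) ^ m)⁻¹ < lam})
      (show mOne lam - 1 < mOne lam by omega)
    simpa using this
  have hp : (0 : ℝ) < 3 ^ mOne lam := by positivity
  have hA : 1 < (3 : ℝ) ^ mOne lam * lam := by
    have := mul_lt_mul_of_pos_left ha hp
    rwa [mul_inv_cancel₀ hp.ne'] at this
  have hB : (3 : ℝ) ^ mOne lam * lam ≤ 3 := by
    have h := mul_le_mul_of_nonneg_left hb hp.le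
    have e : (3 : ℝ) ^ mOne lam = 3 ^ (mOne lam - 1) * 3 := by
      rw [← pow_succ]; congr 1; omega
    have e2 : (3 : ℝ) ^ mOne lam * ((3 : ℝ) ^ (mOne lam - 1))⁻¹ = 3 := by
      rw [e]; field_simp
    linarith
  unfold R iotaOne
  split_ifs <;> norm_num <;> constructor <;> linarith

theorem R_iterate_mem {lam : ℝ} (h0 : 0 < lam) (h1 : lam ≤ 1) (k : ℕ) :
    0 < R^[k] lam ∧ R^[k] lam ≤ 1 := by
  induction k with
  | zero => exact ⟨h0, h1⟩
  | succ k ih => rw [Function.iterate_succ_apply']; exact R_mem ih.1 ih.2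

theorem mSeq_strictMono {lam : ℝ} (h0 : 0 < lam) (h1 : lam ≤ 1) : StrictMono (mSeq lam) := by
  refine strictMono_nat_of_lt_succ fun k => ?_
  have := mOne_pos (R_iterate_mem h0 h1 (k + 1)).1 (R_iterate_mem h0 h1 (k + 1)).2
  unfold mSeq
  rw [Finset.sum_range_succ _ (k + 1)]
  omega

/-- The expansion `lam = ∑_k iota_k 3^{-m_k}`. -/
theorem hasSum_expansion {lam : ℝ} (h0 : 0 < lam) (h1 : lam ≤ 1) :
    HasSum (fun k => (iotaOne (R^[k] lam) : ℝ) * ((3 : ℝ) ^ mSeq lam k)⁻¹) lam := by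
  have hpart : ∀ n, lam = ∑ k ∈ Finset.range (n + 1),
      (iotaOne (R^[k] lam) : ℝ) * ((3 : ℝ) ^ mSeq lam k)⁻¹
        + ((3 : ℝ) ^ mSeq lam n)⁻¹ * R^[n + 1] lam := by
    intro n
    induction n with
    | zero =>
      simp only [mSeq, R, zero_add, Finset.sum_range_one, Function.iterate_zero, id_eq,
        Function.iterate_one]
      field_simp
      ring
    | succ n ih =>
      rw [Finset.sum_range_succ, Function.iterate_succ_apply' _ (n + 1)]
      conv_lhs => rw [ih]
      have e : mSeq lam (n + 1) = mSeq lam n + mOne (R^[n + 1] lam) := by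
        unfold mSeq; rw [Finset.sum_range_succ _ (n + 1)]
      rw [e, pow_add]
      generalize R^[n + 1] lam = x
      unfold R
      field_simp
      ring
  refine (hasSum_iff_tendsto_nat_of_nonneg (fun k => by positivity) _).2 ?_
  rw [← tendsto_add_atTop_iff_nat 1]
  have hz : Tendsto (fun n => ((3 : ℝ) ^ mSeq lam n)⁻¹ * R^[n + 1] lam) atTop (𝓝 0) := by
    refine squeeze_zero (fun n => mul_nonneg (by positivity) (R_iterate_mem h0 h1 _).1.le)
      (fun n => (mul_le_of_le_one_right (by positivity) (R_iterate_mem h0 h1 _).2).trans ?_)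
      (tendsto_pow_atTop_nhds_zero_of_lt_one (by norm_num : (0 : ℝ) ≤ 3⁻¹) (by norm_num))
    rw [inv_pow]
    exact inv_anti₀ (by positivity)
      (pow_le_pow_right₀ (by norm_num) ((mSeq_strictMono h0 h1).id_le n))
  have := hz.const_sub lam
  rw [sub_zero] at this
  refine this.congr fun n => ?_
  have := hpart n
  linarith

end

end SG3

/-!
The Dirichlet problem on the upper domain `Ω_lam` is solved by an explicit cellwise construction.

*Uniqueness* (`IsDirichletSolution.eqOn`). If `u₁`, `u₂` solve the same problem, the truncation
`v = (u₁ - u₂ - ε)⁺` vanishes near the boundary, and the Markov property of the graph energies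
gives `E_m(v, v) ≤ E_m(u₁ - u₂, v) → 0`. As `E_m(v, v)` is nondecreasing in `m`, it is zero, so
`v` is constant, hence zero.

*Conductance and boundary measures.* Cutting `Ω_lam` along the vertices of its first nontrivial
subdivision reduces it to scaled copies of `Ω_{R lam}`. For constant data on the cut, such a copy
acts as a single resistor between its top and the cut, so the effective conductance satisfies a
one-step recursion in the ternary digits of `lam`. `conductance` is the limit of the monotone
iteration of this recursion. With the weights belonging to `conductance`, self-similar probability
measures `cutFamily` on the cuts are obtained as weak limits; they do not charge corners, so they
have the prescribed masses on the cells `X_w`, and these masses determine them (`eq_cutFamily`).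

*Existence.* The formulas of the theorem prescribe the solution at the vertices of the first
subdivision; on each cell there remains a harmonic function, a part of the data, or a Dirichlet
problem of the same kind. This recursion is encoded by the type `Prescription`. All prescribed
values are convex combinations of the data, in which the value at the top has weight at most
`2 / 3`; hence the oscillations over small cells tend to zero and the recursion converges
uniformly to a function `Prescription.eval`. The prescribed values are exactly those for which the
normal derivatives at each crucial point add up to zero, when every remaining Dirichlet problem,
with top value `c`, has the normal derivative `conductance * (c - mean of the data over the cut)`
at its top. By induction on the level this gives the flux identity `graphEnergy_eval_dir`,
`E_m(u, v) = conductance lam * (c - mean) * v(q_0)` for all `v` vanishing near and below the cut.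
It contains the harmonicity of `u` in `Ω_lam`. The same matching relations show that the normal
derivative of `u` at `q_0` is `conductance lam * (c - mean)`; for `h_0` this says that `eta`
equals `conductance` (`eta_eq_conductance`), so the weights above are those of `μ^lam`, and by
uniqueness the values of any solution are the prescribed ones.
-/

namespace SG3

/-! ### Vertices of the first subdivision and intersections of cells -/

/-- Labels of the ten vertices of the first subdivision: `node i k` is the label of `F i (q k)`.
The labels `0, 1, 2` are the corners of the gasket, `9` is its center. -/
def node : Fin 6 → Fin 3 → Fin 10 :=
  ![![0, 3, 4], ![5, 1, 7], ![6, 8, 2], ![9, 7, 8], ![4, 9, 6], ![3, 5, 9]]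

/-- Horizontal coordinates of the ten vertices, in units of `1 / (3 √3)`. -/
def nodeX : Fin 10 → ℕ := ![3, 0, 6, 2, 4, 1, 5, 2, 4, 3]

/-- Vertical coordinates of the ten vertices, in units of `1 / 3`. -/
def nodeY : Fin 10 → ℕ := ![3, 0, 0, 2, 2, 1, 1, 0, 0, 1]

/-- The ten vertices of the first subdivision. -/
noncomputable def pt (n : Fin 10) : Plane := (nodeX n / (3 * √3), nodeY n / 3)

theorem F_q_eq_pt (i : Fin 6) (k : Fin 3) : F i (q k) = pt (node i k) := by
  have h3 : (√3 : ℝ) ≠ 0 := by positivity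
  fin_cases i <;> fin_cases k <;> ext <;>
    simp [F, shift, q, pt, node, nodeX, nodeY] <;> field_simp <;> norm_num

theorem pt_injective : Function.Injective pt := by
  intro m n h
  have h3 : (√3 : ℝ) ≠ 0 := by positivity
  have h1 : (nodeX m : ℝ) / (3 * √3) = nodeX n / (3 * √3) := congrArg Prod.fst h
  have h2 : (nodeY m : ℝ) / 3 = nodeY n / 3 := congrArg Prod.snd h
  have h1' : nodeX m = nodeX n := by
    have := (div_left_inj' (by positivity)).1 h1
    exact_mod_cast this
  have h2' : nodeY m = nodeY n := by
    have := (div_left_inj' (by positivity)).1 h2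
    exact_mod_cast this
  clear h h1 h2
  revert m n
  decide

theorem pt_corner (k : Fin 3) : pt (k.castLE (by norm_num)) = q k := by
  rw [← F_q k, F_q_eq_pt]
  congr 1
  fin_cases k <;> rfl

theorem F_injective (i : Fin 6) : Function.Injective (F i) := by
  intro x y h
  have := dist_F i x y
  rw [h, dist_self] at this
  exact dist_eq_zero.1 (by linarith)

/-- The height of the translation part of `F i`, times `3`. -/
def height : Fin 6 → ℝ := ![2, 0, 0, 0, 1, 1]

theorem F_snd (i : Fin 6) (z : Plane) : (F i z).2 = (z.2 + height i) / 3 := by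
  fin_cases i <;> simp [F, shift, q, height] <;> ring

theorem q_snd (k : Fin 3) : (q k).2 = if k = 0 then 1 else 0 := by
  fin_cases k <;> simp [q]

/-- Barycentric coordinates with respect to the triangle `q_0 q_1 q_2`. -/
noncomputable def bary (z : Plane) : Fin 3 → ℝ :=
  ![z.2, 1 - (√3 * z.1 + z.2) / 2, (√3 * z.1 - z.2) / 2]

/-- Barycentric coordinates (times `3`) of the translation part of `F i`. -/
def baryShift : Fin 6 → Fin 3 → ℝ :=
  ![![2, 0, 0], ![0, 2, 0], ![0, 0, 2], ![0, 1, 1], ![1, 0, 1], ![1, 1, 0]]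

theorem bary_continuous (k : Fin 3) : Continuous fun z => bary z k := by
  fin_cases k <;> simp [bary] <;> fun_prop

theorem bary_sum (z : Plane) : bary z 0 + bary z 1 + bary z 2 = 1 := by
  simp [bary]; ring

theorem bary_q (k l : Fin 3) : bary (q k) l = if k = l then 1 else 0 := by
  have h3 : (√3 : ℝ) ≠ 0 := by positivity
  fin_cases k <;> fin_cases l <;> simp [bary, q] <;> field_simp <;> norm_num

theorem bary_F (i : Fin 6) (z : Plane) (l : Fin 3) :
    bary (F i z) l = (bary z l + baryShift i l) / 3 := by
  have h3 : (√3 : ℝ) ≠ 0 := by positivity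
  fin_cases i <;> fin_cases l <;> simp [bary, F, shift, q, baryShift] <;> field_simp <;> ring

theorem bary_injective : Function.Injective bary := by
  intro z z' h
  have h3 : (√3 : ℝ) ≠ 0 := by positivity
  have h0 : z.2 = z'.2 := by simpa [bary] using congrFun h 0
  have h2 : (√3 * z.1 - z.2) / 2 = (√3 * z'.1 - z'.2) / 2 := by
    simpa [bary] using congrFun h 2
  refine Prod.ext (mul_left_cancel₀ h3 ?_) h0
  linarith

theorem bary_nonneg {z : Plane} (hz : z ∈ gasket) (l : Fin 3) : 0 ≤ bary z l := by
  have hcl : IsClosed {z : Plane | ∀ l, 0 ≤ bary z l} := by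
    simp only [ofPred_forall]
    exact isClosed_iInter fun l => isClosed_le continuous_const (bary_continuous l)
  refine closure_minimal (s := vertices) (t := {z : Plane | ∀ l, 0 ≤ bary z l}) ?_ hcl hz l
  rintro z ⟨w, k, rfl⟩
  induction w with
  | nil => intro l; simp only [Fword, id, bary_q]; split_ifs <;> norm_num
  | cons i w ih =>
    intro l
    simp only [Fword, Function.comp, bary_F]
    have : 0 ≤ baryShift i l := by fin_cases i <;> fin_cases l <;> simp [baryShift]
    have := ih l
    positivity

theorem eq_q_of_bary {z : Plane} (hz : z ∈ gasket) (k : Fin 3) (h : 1 ≤ bary z k) : z = q k := by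
  apply bary_injective
  have h0 := bary_nonneg hz 0
  have h1 := bary_nonneg hz 1
  have h2 := bary_nonneg hz 2
  have hs := bary_sum z
  ext l
  rw [bary_q]
  fin_cases k <;> fin_cases l <;> simp at h ⊢ <;> linarith

/-- Two distinct cells of the first level meet only in corners of both. -/
theorem corner_of_F_eq {i j : Fin 6} (hij : i ≠ j) {z z' : Plane} (hz : z ∈ gasket)
    (hz' : z' ∈ gasket) (h : F i z = F j z') : (∃ k, z = q k) ∧ ∃ l, z' = q l := by
  have e : ∀ l, bary z l + baryShift i l = bary z' l + baryShift j l := by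
    intro l
    have h1 := bary_F i z l
    rw [h, bary_F] at h1
    linarith
  have key : ∀ (z z' : Plane), z ∈ gasket → z' ∈ gasket → ∀ i j : Fin 6, i ≠ j →
      (∀ l, bary z l + baryShift i l = bary z' l + baryShift j l) → ∃ k, z = q k := by
    intro z z' hz hz' i j hij e
    have hn := bary_nonneg hz
    have hn' := bary_nonneg hz'
    have hs := bary_sum z
    have hs' := bary_sum z'
    suffices h : ∃ k, 1 ≤ bary z k from h.imp fun k hk => eq_q_of_bary hz k hk
    by_contra! hc
    have e0 := e 0
    have e1 := e 1
    have e2 := e 2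
    have hn0 := hn' 0
    have hn1 := hn' 1
    have hn2 := hn' 2
    have hc0 := hc 0
    have hc1 := hc 1
    have hc2 := hc 2
    clear hc e hn hn'
    fin_cases i <;> fin_cases j <;> simp [baryShift] at hij e0 e1 e2 <;>
      linarith
  exact ⟨key z z' hz hz' i j hij e, key z' z hz' hz j i hij.symm fun l => (e l).symm⟩

/-- Corners of cells at the same position have the same label. -/
theorem node_eq_of_F_eq {i j : Fin 6} {k l : Fin 3} (h : F i (q k) = F j (q l)) :
    node i k = node j l := by
  rw [F_q_eq_pt, F_q_eq_pt] at h
  exact pt_injective h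

theorem Fword_append (w w' : List (Fin 6)) (z : Plane) :
    Fword (w ++ w') z = Fword w (Fword w' z) := by
  induction w with
  | nil => rfl
  | cons i w ih => simp only [List.cons_append, Fword, Function.comp, ih]

theorem Fword_continuous (w : List (Fin 6)) : Continuous (Fword w) := by
  induction w with
  | nil => exact continuous_id
  | cons i w ih => exact (F_continuous i).comp ih

theorem Fword_mem_gasket (w : List (Fin 6)) {z : Plane} (hz : z ∈ gasket) :
    Fword w z ∈ gasket := by
  induction w with
  | nil => exact hz
  | cons i w ih => exact F_mem_gasket i ih

theorem dist_Fword (w : List (Fin 6)) (x y : Plane) :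
    dist (Fword w x) (Fword w y) = dist x y / 3 ^ w.length := by
  induction w with
  | nil => simp [Fword]
  | cons i w ih =>
    simp only [Fword, Function.comp, dist_F, ih, List.length_cons, pow_succ]
    rw [div_div]

theorem snd_nonneg {z : Plane} (hz : z ∈ gasket) : 0 ≤ z.2 := (gasket_subset_box hz).1.2

theorem snd_le_one {z : Plane} (hz : z ∈ gasket) : z.2 ≤ 1 := (gasket_subset_box hz).2.2

theorem dist_gasket_le {x y : Plane} (hx : x ∈ gasket) (hy : y ∈ gasket) : dist x y ≤ 2 := by
  have h := gasket_subset_box hx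
  have h' := gasket_subset_box hy
  have h3 : 2 / √3 ≤ 2 := by
    rw [div_le_iff₀ (by positivity)]
    have : (1 : ℝ) ≤ √3 := Real.one_le_sqrt.2 (by norm_num)
    linarith
  obtain ⟨⟨h1, h2⟩, h4, h5⟩ := h
  obtain ⟨⟨h1', h2'⟩, h4', h5'⟩ := h'
  simp only [Prod.fst_zero, Prod.snd_zero] at *
  rw [Prod.dist_eq, Real.dist_eq, Real.dist_eq]
  exact max_le (abs_le.2 ⟨by linarith, by linarith⟩) (abs_le.2 ⟨by linarith, by linarith⟩)

theorem exists_F_of_mem_gasket {z : Plane} (hz : z ∈ gasket) : ∃ i, ∃ y ∈ gasket, F i y = z := by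
  rw [gasket_eq] at hz
  obtain ⟨i, y, hy, h⟩ := mem_iUnion.1 hz
  exact ⟨i, y, hy, h⟩

/-- A continuous function on the gasket is determined by its values at the vertices. -/
theorem eqOn_gasket_of_vertices {u v : Plane → ℝ} (hu : ContinuousOn u gasket)
    (hv : ContinuousOn v gasket) (h : ∀ w k, u (Fword w (q k)) = v (Fword w (q k))) :
    EqOn u v gasket := by
  refine EqOn.of_subset_closure (s := vertices) ?_ hu hv subset_closure subset_rfl
  rintro _ ⟨w, k, rfl⟩
  exact h w k

open Classical in
/-- The function which is `φ i ∘ (F i)⁻¹` on the cell `F i '' gasket`. -/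
noncomputable def glue (φ : Fin 6 → Plane → ℝ) (z : Plane) : ℝ :=
  if h : ∃ i, ∃ y ∈ gasket, F i y = z then φ h.choose h.choose_spec.choose else 0

/-- Functions on the cells which agree at the shared corners are glued without conflict. -/
theorem glue_F {φ : Fin 6 → Plane → ℝ}
    (hφ : ∀ i j k l, F i (q k) = F j (q l) → φ i (q k) = φ j (q l)) (i : Fin 6) {z : Plane}
    (hz : z ∈ gasket) : glue φ (F i z) = φ i z := by
  have h : ∃ j, ∃ y ∈ gasket, F j y = F i z := ⟨i, z, hz, rfl⟩
  have key : ∀ j y, y ∈ gasket → F j y = F i z → φ j y = φ i z := by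
    intro j y hy e
    by_cases hij : j = i
    · subst hij
      rw [F_injective j e]
    · obtain ⟨⟨k, rfl⟩, l, rfl⟩ := corner_of_F_eq hij hy hz e
      exact hφ _ _ _ _ e
  rw [glue, dif_pos h]
  exact key _ _ h.choose_spec.choose_spec.1 h.choose_spec.choose_spec.2

theorem glue_continuousOn {φ : Fin 6 → Plane → ℝ} (hc : ∀ i, ContinuousOn (φ i) gasket)
    (hφ : ∀ i j k l, F i (q k) = F j (q l) → φ i (q k) = φ j (q l)) :
    ContinuousOn (glue φ) gasket := by
  rw [gasket_eq]
  refine (locallyFinite_of_finite _).continuousOn_iUnion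
    (fun i => (gasket_isCompact.image (F_continuous i)).isClosed) fun i => ?_
  have hinv : ∀ z, (3 : ℝ) • (F i z) - shift i = z := by
    intro z
    simp only [F, smul_add, smul_smul]
    norm_num
  have h1 : ContinuousOn (fun y : Plane => φ i ((3 : ℝ) • y - shift i)) (F i '' gasket) := by
    refine (hc i).comp (by fun_prop) ?_
    rintro _ ⟨z, hz, rfl⟩
    simpa only [hinv] using hz
  refine h1.congr ?_
  rintro _ ⟨z, hz, rfl⟩
  simp only [glue_F hφ i hz, hinv]

/-! ### Graph energies and the harmonic extension -/

/-- The energy form of a triangle, as a form in the values at its three corners. -/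
def tri (a b : Fin 3 → ℝ) : ℝ :=
  (a 0 - a 1) * (b 0 - b 1) + (a 1 - a 2) * (b 1 - b 2) + (a 2 - a 0) * (b 2 - b 0)

theorem tri_self_nonneg (a : Fin 3 → ℝ) : 0 ≤ tri a a := by
  unfold tri
  nlinarith [mul_self_nonneg (a 0 - a 1), mul_self_nonneg (a 1 - a 2), mul_self_nonneg (a 2 - a 0)]

theorem graphEnergy_zero (u v : Plane → ℝ) :
    graphEnergy 0 u v = tri (fun k => u (q k)) (fun k => v (q k)) := by
  simp [graphEnergy, triangleEnergy, tri, Fword]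

/-- Self-similarity of the graph energies. -/
theorem graphEnergy_succ (m : ℕ) (u v : Plane → ℝ) :
    graphEnergy (m + 1) u v = 15 / 7 * ∑ i, graphEnergy m (u ∘ F i) (v ∘ F i) := by
  have h : ∑ w : Fin (m + 1) → Fin 6,
      triangleEnergy (u ∘ Fword (List.ofFn w)) (v ∘ Fword (List.ofFn w)) =
      ∑ i, ∑ w : Fin m → Fin 6,
        triangleEnergy ((u ∘ F i) ∘ Fword (List.ofFn w)) ((v ∘ F i) ∘ Fword (List.ofFn w)) := by
    rw [← Fintype.sum_prod_type', ← (Fin.consEquiv fun _ => Fin 6).sum_comp]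
    refine Finset.sum_congr rfl fun x _ => ?_
    simp only [Fin.consEquiv, Equiv.coe_fn_mk, List.ofFn_cons, Fword]
    rfl
  unfold graphEnergy
  rw [h, ← Finset.mul_sum, pow_succ]
  ring

theorem graphEnergy_eq_of_corners (m : ℕ) {u u' v v' : Plane → ℝ}
    (h : ∀ w : List (Fin 6), w.length = m →
      tri (fun k => u (Fword w (q k))) (fun k => v (Fword w (q k))) =
        tri (fun k => u' (Fword w (q k))) (fun k => v' (Fword w (q k)))) :
    graphEnergy m u v = graphEnergy m u' v' := by
  unfold graphEnergy
  congr 1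
  exact Finset.sum_congr rfl fun w _ => h _ (List.length_ofFn)

theorem graphEnergy_mono_of_corners (m : ℕ) {u u' v v' : Plane → ℝ}
    (h : ∀ w : List (Fin 6), w.length = m →
      tri (fun k => u (Fword w (q k))) (fun k => v (Fword w (q k))) ≤
        tri (fun k => u' (Fword w (q k))) (fun k => v' (Fword w (q k)))) :
    graphEnergy m u v ≤ graphEnergy m u' v' := by
  unfold graphEnergy
  gcongr
  exact h _ (List.length_ofFn)

theorem graphEnergy_congr (m : ℕ) {u u' v v' : Plane → ℝ} (hu : EqOn u u' gasket)
    (hv : EqOn v v' gasket) : graphEnergy m u v = graphEnergy m u' v' := by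
  refine graphEnergy_eq_of_corners m fun w _ => ?_
  have h : ∀ k, Fword w (q k) ∈ gasket := fun k => Fword_mem_gasket w (q_mem_gasket k)
  simp only [hu (h _), hv (h _)]

theorem graphEnergy_eq_zero (m : ℕ) {u v : Plane → ℝ}
    (h : ∀ w : List (Fin 6), w.length = m → ∀ k, v (Fword w (q k)) = 0) :
    graphEnergy m u v = 0 := by
  rw [graphEnergy_eq_of_corners m (u' := 0) (v' := 0) fun w hw => by simp [tri, h w hw]]
  simp [graphEnergy, triangleEnergy]

theorem graphEnergy_sub_left (m : ℕ) (u u' v : Plane → ℝ) :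
    graphEnergy m (u - u') v = graphEnergy m u v - graphEnergy m u' v := by
  unfold graphEnergy
  rw [← mul_sub, ← Finset.sum_sub_distrib]
  congr 1
  refine Finset.sum_congr rfl fun w _ => ?_
  simp only [triangleEnergy, Function.comp, Pi.sub_apply]
  ring

theorem graphEnergy_self_nonneg (m : ℕ) (u : Plane → ℝ) : 0 ≤ graphEnergy m u u := by
  unfold graphEnergy
  exact mul_nonneg (by positivity) (Finset.sum_nonneg fun w _ =>
    tri_self_nonneg fun k => u (Fword (List.ofFn w) (q k)))

theorem graphEnergy_sub_le (m : ℕ) (u v : Plane → ℝ) :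
    graphEnergy m (u - v) (u - v) ≤ 2 * graphEnergy m u u + 2 * graphEnergy m v v := by
  unfold graphEnergy
  rw [mul_left_comm, mul_left_comm 2, ← mul_add, ← mul_add, ← Finset.sum_add_distrib,
    Finset.mul_sum _ _ (2 : ℝ)]
  gcongr with w
  simp only [triangleEnergy, Function.comp, Pi.sub_apply]
  generalize Fword (List.ofFn w) = φ
  nlinarith [sq_nonneg (u (φ (q 0)) - u (φ (q 1)) + (v (φ (q 0)) - v (φ (q 1)))),
    sq_nonneg (u (φ (q 1)) - u (φ (q 2)) + (v (φ (q 1)) - v (φ (q 2)))),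
    sq_nonneg (u (φ (q 2)) - u (φ (q 0)) + (v (φ (q 2)) - v (φ (q 0))))]

/-- The harmonic extension rule: the values at the ten vertices of the first subdivision of the
harmonic function with values `a` at the corners. -/
noncomputable def harmExt (a : Fin 3 → ℝ) : Fin 10 → ℝ :=
  ![a 0, a 1, a 2, (8 * a 0 + 4 * a 1 + 3 * a 2) / 15, (8 * a 0 + 3 * a 1 + 4 * a 2) / 15,
    (4 * a 0 + 8 * a 1 + 3 * a 2) / 15, (4 * a 0 + 3 * a 1 + 8 * a 2) / 15,
    (3 * a 0 + 8 * a 1 + 4 * a 2) / 15, (3 * a 0 + 4 * a 1 + 8 * a 2) / 15,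
    (a 0 + a 1 + a 2) / 3]

/-- The harmonic extension is orthogonal to the functions vanishing at the corners, and its energy
renormalizes with the factor `7 / 15`. -/
theorem sum_tri_harmExt (a : Fin 3 → ℝ) (b : Fin 10 → ℝ) :
    15 / 7 * ∑ i, tri (harmExt a ∘ node i) (b ∘ node i) = tri a ![b 0, b 1, b 2] := by
  simp [Fin.sum_univ_succ, tri, harmExt, node]
  ring

/-- The harmonic extension minimizes the energy among all extensions. -/
theorem tri_le_sum_tri (b : Fin 10 → ℝ) :
    tri ![b 0, b 1, b 2] ![b 0, b 1, b 2] ≤ 15 / 7 * ∑ i, tri (b ∘ node i) (b ∘ node i) := by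
  set a : Fin 3 → ℝ := ![b 0, b 1, b 2] with ha
  have h1 := sum_tri_harmExt a b
  have h2 := sum_tri_harmExt a (harmExt a)
  have h3 : ![harmExt a 0, harmExt a 1, harmExt a 2] = a := by
    ext k; fin_cases k <;> simp [harmExt]
  rw [h3] at h2
  rw [← ha] at h1
  -- expand the energy of the difference of `b` and its harmonic extension
  have h4 : 0 ≤ ∑ i, (tri (b ∘ node i) (b ∘ node i) - 2 * tri (harmExt a ∘ node i) (b ∘ node i)
      + tri (harmExt a ∘ node i) (harmExt a ∘ node i)) := by
    refine Finset.sum_nonneg fun i _ => ?_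
    have := tri_self_nonneg fun k => b (node i k) - harmExt a (node i k)
    unfold tri at this ⊢
    simp only [Function.comp] at this ⊢
    linarith
  rw [Finset.sum_add_distrib, Finset.sum_sub_distrib, ← Finset.mul_sum] at h4
  linarith

theorem corners_eq_pt (u : Plane → ℝ) : (fun k => u (q k)) = ![u (pt 0), u (pt 1), u (pt 2)] := by
  ext k
  rw [← pt_corner k]
  fin_cases k <;> rfl

theorem graphEnergy_self_le_succ (m : ℕ) (v : Plane → ℝ) :
    graphEnergy m v v ≤ graphEnergy (m + 1) v v := by
  induction m generalizing v with
  | zero =>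
    rw [graphEnergy_succ]
    simp only [graphEnergy_zero, Function.comp, F_q_eq_pt]
    rw [corners_eq_pt]
    exact tri_le_sum_tri fun n => v (pt n)
  | succ m ih =>
    rw [graphEnergy_succ, graphEnergy_succ (m + 1)]
    gcongr
    exact ih _

theorem graphEnergy_self_monotone (v : Plane → ℝ) : Monotone fun m => graphEnergy m v v :=
  monotone_nat_of_le_succ fun m => graphEnergy_self_le_succ m v

theorem bddAbove_graphEnergy_of_comp_F {v : Plane → ℝ}
    (h : ∀ i, BddAbove (range fun m => graphEnergy m (v ∘ F i) (v ∘ F i))) :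
    BddAbove (range fun m => graphEnergy m v v) := by
  choose C hC using h
  refine ⟨15 / 7 * ∑ i, C i, ?_⟩
  rintro _ ⟨m, rfl⟩
  refine (graphEnergy_self_le_succ m v).trans ?_
  rw [graphEnergy_succ]
  gcongr with i
  exact hC i ⟨m, rfl⟩

theorem bddAbove_graphEnergy_of_comp_Fword (n : ℕ) {v : Plane → ℝ}
    (h : ∀ w : List (Fin 6), w.length = n →
      BddAbove (range fun m => graphEnergy m (v ∘ Fword w) (v ∘ Fword w))) :
    BddAbove (range fun m => graphEnergy m v v) := by
  induction n generalizing v with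
  | zero => exact h [] rfl
  | succ n ih =>
    refine bddAbove_graphEnergy_of_comp_F fun i => ih fun w hw => ?_
    exact h (i :: w) (by simp [hw])

/-- A function of zero energy is constant on the vertices. -/
theorem eq_of_graphEnergy_eq_zero {v : Plane → ℝ} (h : ∀ m, graphEnergy m v v = 0)
    (w : List (Fin 6)) (k : Fin 3) : v (Fword w (q k)) = v (q 1) := by
  have h0 : ∀ {v : Plane → ℝ}, (∀ m, graphEnergy m v v = 0) → ∀ k, v (q k) = v (q 1) := by
    intro v h
    have := h 0
    rw [graphEnergy_zero] at this
    unfold tri at this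
    have e1 := mul_self_nonneg (v (q 0) - v (q 1))
    have e2 := mul_self_nonneg (v (q 1) - v (q 2))
    have e3 := mul_self_nonneg (v (q 2) - v (q 0))
    have e1' : v (q 0) - v (q 1) = 0 := mul_self_eq_zero.1 (by linarith)
    have e2' : v (q 1) - v (q 2) = 0 := mul_self_eq_zero.1 (by linarith)
    intro k
    fin_cases k <;> simp <;> linarith
  have hF : ∀ {v : Plane → ℝ}, (∀ m, graphEnergy m v v = 0) →
      ∀ i m, graphEnergy m (v ∘ F i) (v ∘ F i) = 0 := by
    intro v h i m
    have := h (m + 1)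
    rw [graphEnergy_succ] at this
    have hs : ∑ i, graphEnergy m (v ∘ F i) (v ∘ F i) = 0 := by linarith
    exact (Finset.sum_eq_zero_iff_of_nonneg fun i _ => graphEnergy_self_nonneg m _).1 hs i
      (Finset.mem_univ i)
  induction w generalizing v k with
  | nil => exact h0 h k
  | cons i w ih =>
    have e := ih (hF h i) k
    simp only [Function.comp] at e
    rw [Fword, Function.comp, e]
    -- the level-one triangles are connected through shared corners
    have hn : ∀ i k, v (pt (node i k)) = v (pt (node i 1)) := by
      intro i k
      have := h0 (hF h i) k
      simpa only [Function.comp, F_q_eq_pt] using this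
    rw [F_q_eq_pt, show q 1 = pt 1 from (pt_corner 1).symm]
    have a1 := hn 1 0
    have a2 := hn 1 2
    have a3 := hn 3 2
    have a4 := hn 5 0
    have a5 := hn 4 0
    have a6 := hn 5 2
    have a7 := hn 2 0
    have a8 := hn 3 0
    have a9 := hn 0 0
    have a10 := hn 0 2
    simp [node] at a1 a2 a3 a4 a5 a6 a7 a8 a9 a10
    fin_cases i <;> simp [node] <;> linarith

/-! ### Uniqueness for the Dirichlet problem -/

theorem mem_upperDomain {lam : ℝ} (h1 : lam ≤ 1) {z : Plane} :
    z ∈ upperDomain lam ↔ z ∈ gasket ∧ z ≠ q 0 ∧ 1 - lam < z.2 := by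
  refine ⟨fun h => ⟨h.1, fun e => h.2.1 ⟨0, e.symm⟩, h.2.2⟩, fun h => ⟨h.1, ?_, h.2.2⟩⟩
  rintro ⟨k, rfl⟩
  have h2 := h.2.2
  rw [q_snd] at h2
  split_ifs at h2 with hk
  · exact h.2.1 (by rw [hk])
  · linarith

theorem mem_closedDomain {lam : ℝ} (h0 : 0 < lam) (h1 : lam ≤ 1) {z : Plane} :
    z ∈ closedDomain lam ↔ z ∈ gasket ∧ 1 - lam ≤ z.2 := by
  constructor
  · rintro (h | rfl | h)
    · exact ⟨h.1, h.2.2.le⟩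
    · exact ⟨q_mem_gasket 0, by simp only [q_snd, if_pos]; linarith⟩
    · exact ⟨h.1, h.2.ge⟩
  · rintro ⟨hz, h⟩
    by_cases e : z = q 0
    · exact Or.inr (Or.inl e)
    rcases h.eq_or_lt with h | h
    · exact Or.inr (Or.inr ⟨hz, h.symm⟩)
    · exact Or.inl ((mem_upperDomain h1).2 ⟨hz, e, h⟩)

theorem closedDomain_subset {lam : ℝ} (h0 : 0 < lam) (h1 : lam ≤ 1) :
    closedDomain lam ⊆ gasket := fun _ hz => ((mem_closedDomain h0 h1).1 hz).1

theorem isClosed_closedDomain {lam : ℝ} (h0 : 0 < lam) (h1 : lam ≤ 1) :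
    IsClosed (closedDomain lam) := by
  have : closedDomain lam = gasket ∩ {z | 1 - lam ≤ z.2} := by
    ext z; exact mem_closedDomain h0 h1
  rw [this]
  exact gasket_isClosed.inter (isClosed_le continuous_const continuous_snd)

theorem q_zero_notMem_cut {lam : ℝ} (h0 : 0 < lam) : q 0 ∉ cut lam := by
  rintro ⟨-, h⟩
  simp only [q_snd, if_pos] at h
  linarith

/-- Small cells meeting a compact subset of the domain are contained in the domain. -/
theorem exists_level {lam : ℝ} (h1 : lam ≤ 1) {K : Set Plane} (hK : IsCompact K)
    (hKU : K ⊆ upperDomain lam) : ∃ n, ∀ m, n ≤ m → ∀ w : List (Fin 6), w.length = m →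
      (∃ y ∈ gasket, Fword w y ∈ K) → Fword w '' gasket ⊆ upperDomain lam := by
  have hcl : IsClosed (gasket ∩ ({z | z.2 ≤ 1 - lam} ∪ {q 0})) :=
    gasket_isClosed.inter ((isClosed_le continuous_snd continuous_const).union isClosed_singleton)
  obtain ⟨δ, hδ, hd⟩ := hK.exists_thickening_subset_open hcl.isOpen_compl (by
    intro z hz hz'
    obtain ⟨-, h2, h3⟩ := (mem_upperDomain h1).1 (hKU hz)
    rcases hz'.2 with h | h
    · exact absurd h (not_le.2 h3)
    · exact h2 h)
  obtain ⟨n, hn⟩ := exists_pow_lt_of_lt_one (show 0 < δ / 2 by positivity)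
    (by norm_num : (1 / 3 : ℝ) < 1)
  refine ⟨n, fun m hm w hw ⟨y, hy, hyK⟩ => ?_⟩
  rintro _ ⟨z, hz, rfl⟩
  have hz' : Fword w z ∈ Metric.thickening δ K := by
    refine Metric.mem_thickening_iff.2 ⟨_, hyK, ?_⟩
    rw [dist_Fword, hw]
    have e1 : (1 / 3 : ℝ) ^ m ≤ (1 / 3) ^ n :=
      pow_le_pow_of_le_one (by norm_num) (by norm_num) hm
    have e2 := dist_gasket_le hz hy
    have e3 : dist z y / 3 ^ m = dist z y * (1 / 3) ^ m := by
      rw [one_div, inv_pow]; rfl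
    rw [e3]
    calc dist z y * (1 / 3) ^ m ≤ 2 * (1 / 3) ^ n := by gcongr
      _ < δ := by linarith
  have hg := Fword_mem_gasket w hz
  by_contra hc
  refine hd hz' ⟨hg, ?_⟩
  rw [mem_upperDomain h1] at hc
  by_cases e : Fword w z = q 0
  · exact Or.inr e
  · exact Or.inl (not_lt.1 fun h => hc ⟨hg, e, h⟩)

theorem sq_posPart_sub_le (x y ε : ℝ) :
    (max (x - ε) 0 - max (y - ε) 0) * (max (x - ε) 0 - max (y - ε) 0) ≤
      (x - y) * (max (x - ε) 0 - max (y - ε) 0) := by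
  rcases le_total (x - ε) 0 with hx | hx <;> rcases le_total (y - ε) 0 with hy | hy <;>
    simp only [max_eq_left, max_eq_right, hx, hy] <;> nlinarith

/-- The Markov property, in the form needed for truncations. -/
theorem tri_posPart_le (a : Fin 3 → ℝ) (ε : ℝ) :
    tri (fun k => max (a k - ε) 0) (fun k => max (a k - ε) 0) ≤
      tri a (fun k => max (a k - ε) 0) := by
  unfold tri
  have := sq_posPart_sub_le (a 0) (a 1) ε
  have := sq_posPart_sub_le (a 1) (a 2) ε
  have := sq_posPart_sub_le (a 2) (a 0) ε
  linarith

theorem tri_posPart_le_self (a : Fin 3 → ℝ) (ε : ℝ) :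
    tri (fun k => max (a k - ε) 0) (fun k => max (a k - ε) 0) ≤ tri a a := by
  have h := tri_posPart_le a ε
  have h' := tri_self_nonneg fun k => a k - max (a k - ε) 0
  unfold tri at *
  linarith

/-- The difference of two solutions with the same data is nonpositive. Otherwise its truncation
`v = (u₁ - u₂ - ε)⁺` is an admissible test function, so that `E_m(v, v) ≤ E_m(u₁ - u₂, v) → 0`;
since `E_m(v, v)` is nondecreasing in `m`, it vanishes and `v` is constant. -/
theorem IsDirichletSolution.le {lam : ℝ} (h0 : 0 < lam) (h1 : lam ≤ 1) {f u₁ u₂ : Plane → ℝ}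
    (hu₁ : IsDirichletSolution lam f u₁) (hu₂ : IsDirichletSolution lam f u₂) {z : Plane}
    (hz : z ∈ closedDomain lam) : u₁ z ≤ u₂ z := by
  classical
  refine le_of_forall_pos_le_add fun ε hε => ?_
  set d : Plane → ℝ := u₁ - u₂ with hd
  have hdc : ContinuousOn d (closedDomain lam) := hu₁.1.sub hu₂.1
  have hdb : ∀ x ∈ bdry lam, d x = 0 := fun x hx => by
    simp only [hd, Pi.sub_apply, hu₁.2.2 hx, hu₂.2.2 hx, sub_self]
  have hcl := isClosed_closedDomain h0 h1
  set v : Plane → ℝ := fun x => if x ∈ closedDomain lam then max (d x - ε) 0 else 0 with hv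
  have hvb : ∀ x, x.2 ≤ 1 - lam → v x = 0 := by
    intro x hx
    by_cases h : x ∈ closedDomain lam
    · have h2 := (mem_closedDomain h0 h1).1 h
      have : d x = 0 := hdb x (Or.inr ⟨h2.1, le_antisymm hx h2.2⟩)
      simp only [hv, if_pos h, this]
      exact max_eq_right (by linarith)
    · simp only [hv, if_neg h]
  have hvc : ContinuousOn v gasket := by
    have e : gasket ⊆ closedDomain lam ∪ {x : Plane | x.2 ≤ 1 - lam} := by
      intro x hx
      rcases le_total (1 - lam) x.2 with h | h
      · exact Or.inl ((mem_closedDomain h0 h1).2 ⟨hx, h⟩)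
      · exact Or.inr h
    refine ContinuousOn.mono (ContinuousOn.union_of_isClosed ?_ ?_ hcl
      (isClosed_le continuous_snd continuous_const)) e
    · refine ContinuousOn.congr (f := fun x => max (d x - ε) 0)
        ((hdc.sub continuousOn_const).sup continuousOn_const) fun x hx => ?_
      simp only [hv, if_pos hx]
    · exact ContinuousOn.congr (f := fun _ => 0) continuousOn_const fun x hx => hvb x hx
  set K : Set Plane := closedDomain lam ∩ {x | ε ≤ d x} with hKdef
  have hKc : IsCompact K := by
    refine gasket_isCompact.of_isClosed_subset ?_
      (inter_subset_left.trans (closedDomain_subset h0 h1))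
    exact hdc.preimage_isClosed_of_isClosed hcl isClosed_Ici
  have hKU : K ⊆ upperDomain lam := by
    rintro x ⟨hx | hx, hx'⟩
    · exact hx
    · rw [mem_ofPred_eq, hdb x hx] at hx'
      linarith
  have hvK : ∀ x, x ∉ K → v x = 0 := by
    intro x hx
    by_cases h : x ∈ closedDomain lam
    · have : d x < ε := not_le.1 fun h' => hx ⟨h, h'⟩
      simp only [hv, if_pos h]
      exact max_eq_right (by linarith)
    · simp only [hv, if_neg h]
  obtain ⟨n, hn⟩ := exists_level h1 hKc hKU
  -- a small cell is either contained in the domain, or `v` vanishes on it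
  have hcase : ∀ m, n ≤ m → ∀ w : List (Fin 6), w.length = m →
      (Fword w '' gasket ⊆ upperDomain lam ∧
        ∀ y ∈ gasket, v (Fword w y) = max (d (Fword w y) - ε) 0) ∨
      ∀ y ∈ gasket, v (Fword w y) = 0 := by
    intro m hm w hw
    by_cases h : ∃ y ∈ gasket, Fword w y ∈ K
    · have hs := hn m hm w hw h
      refine Or.inl ⟨hs, fun y hy => ?_⟩
      have : Fword w y ∈ closedDomain lam := Or.inl (hs ⟨y, hy, rfl⟩)
      simp only [hv, if_pos this]
    · push Not at h
      exact Or.inr fun y hy => hvK _ (h y hy)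
  have hbdd : BddAbove (range fun m => graphEnergy m v v) := by
    refine bddAbove_graphEnergy_of_comp_Fword n fun w hw => ?_
    rcases hcase n le_rfl w hw with ⟨hs, hvw⟩ | hvw
    · obtain ⟨C₁, hC₁⟩ := (hu₁.2.1.1 w hs).2
      obtain ⟨C₂, hC₂⟩ := (hu₂.2.1.1 w hs).2
      refine ⟨2 * C₁ + 2 * C₂, ?_⟩
      rintro _ ⟨m, rfl⟩
      have e1 : graphEnergy m (v ∘ Fword w) (v ∘ Fword w) ≤
          graphEnergy m (u₁ ∘ Fword w - u₂ ∘ Fword w) (u₁ ∘ Fword w - u₂ ∘ Fword w) := by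
        refine graphEnergy_mono_of_corners m fun w' _ => ?_
        have hy : ∀ k, Fword w' (q k) ∈ gasket := fun k => Fword_mem_gasket w' (q_mem_gasket k)
        simp only [Function.comp, hvw _ (hy _)]
        exact tri_posPart_le_self (fun k => d (Fword w (Fword w' (q k)))) ε
      have e2 := graphEnergy_sub_le m (u₁ ∘ Fword w) (u₂ ∘ Fword w)
      have e3 := hC₁ ⟨m, rfl⟩
      have e4 := hC₂ ⟨m, rfl⟩
      dsimp only at e3 e4 ⊢
      linarith
    · refine ⟨0, ?_⟩
      rintro _ ⟨m, rfl⟩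
      exact (graphEnergy_eq_zero m fun w' _ k =>
        hvw _ (Fword_mem_gasket w' (q_mem_gasket k))).le
  have hvdom : InDomEnergy v := ⟨hvc, hbdd⟩
  have hlim : Tendsto (fun m => graphEnergy m d v) atTop (𝓝 0) := by
    have e := (hu₁.2.1.2 v hvdom ⟨K, hKc, hKU, fun x _ hx => hvK x hx⟩).sub
      (hu₂.2.1.2 v hvdom ⟨K, hKc, hKU, fun x _ hx => hvK x hx⟩)
    rw [sub_zero] at e
    exact e.congr fun m => (graphEnergy_sub_left m u₁ u₂ v).symm
  have hle : ∀ m, n ≤ m → graphEnergy m v v ≤ graphEnergy m d v := by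
    intro m hm
    refine graphEnergy_mono_of_corners m fun w hw => ?_
    rcases hcase m hm w hw with ⟨-, hvw⟩ | hvw
    · simp only [hvw _ (q_mem_gasket _)]
      exact tri_posPart_le (fun k => d (Fword w (q k))) ε
    · simp only [hvw _ (q_mem_gasket _)]
      simp [tri]
  have hzero : ∀ m, graphEnergy m v v = 0 := by
    intro m
    refine le_antisymm (ge_of_tendsto hlim ?_) (graphEnergy_self_nonneg m v)
    filter_upwards [eventually_ge_atTop (max n m)] with k hk
    exact (graphEnergy_self_monotone v (le_trans (le_max_right _ _) hk)).trans
      (hle k (le_trans (le_max_left _ _) hk))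
  have hq1 : v (q 1) = 0 := hvb _ (by simp [q_snd]; linarith)
  have hvz : v z = 0 := by
    refine eqOn_gasket_of_vertices (v := fun _ => 0) hvc continuousOn_const (fun w k => ?_)
      (closedDomain_subset h0 h1 hz)
    rw [eq_of_graphEnergy_eq_zero hzero w k, hq1]
  simp only [hv, if_pos hz] at hvz
  have := le_max_left (d z - ε) 0
  rw [hvz] at this
  simp only [hd, Pi.sub_apply] at this
  linarith

theorem IsDirichletSolution.eqOn {lam : ℝ} (h0 : 0 < lam) (h1 : lam ≤ 1) {f u₁ u₂ : Plane → ℝ}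
    (hu₁ : IsDirichletSolution lam f u₁) (hu₂ : IsDirichletSolution lam f u₂) :
    EqOn u₁ u₂ (closedDomain lam) := fun _ hz =>
  le_antisymm (hu₁.le h0 h1 hu₂ hz) (hu₂.le h0 h1 hu₁ hz)

/-! ### The first digit of the expansion -/

theorem mOne_eq_one {lam : ℝ} (h : 1 / 3 < lam) (h1 : lam ≤ 1) : mOne lam = 1 := by
  refine le_antisymm (Nat.sInf_le ?_) (mOne_pos (by linarith) h1)
  rw [mem_ofPred_eq]
  norm_num at h ⊢
  exact h

theorem mOne_of_le {lam : ℝ} (h0 : 0 < lam) (h : lam ≤ 1 / 3) :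
    mOne lam = mOne (3 * lam) + 1 := by
  have h3 : (0 : ℝ) < 3 * lam := by positivity
  refine le_antisymm (Nat.sInf_le ?_) ?_
  · have : ((3 : ℝ) ^ mOne (3 * lam))⁻¹ < 3 * lam := Nat.sInf_mem (exists_mOne h3)
    rw [mem_ofPred_eq, pow_succ, mul_inv]
    linarith
  · have hm : ((3 : ℝ) ^ mOne lam)⁻¹ < lam := Nat.sInf_mem (exists_mOne h0)
    obtain ⟨k, hk⟩ : ∃ k, mOne lam = k + 1 :=
      Nat.exists_eq_succ_of_ne_zero (mOne_pos h0 (by linarith)).ne'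
    rw [hk, pow_succ, mul_inv] at hm
    rw [hk]
    refine Nat.succ_le_succ (Nat.sInf_le ?_)
    rw [mem_ofPred_eq]
    linarith

theorem iotaOne_of_le {lam : ℝ} (h0 : 0 < lam) (h : lam ≤ 1 / 3) :
    iotaOne lam = iotaOne (3 * lam) := by
  unfold iotaOne
  rw [mOne_of_le h0 h, pow_succ, mul_assoc]

theorem R_of_le {lam : ℝ} (h0 : 0 < lam) (h : lam ≤ 1 / 3) : R lam = R (3 * lam) := by
  unfold R
  rw [iotaOne_of_le h0 h, mOne_of_le h0 h, pow_succ, mul_assoc]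

theorem letters_of_le {lam : ℝ} (h0 : 0 < lam) (h : lam ≤ 1 / 3) :
    letters lam = letters (3 * lam) := by
  unfold letters
  rw [iotaOne_of_le h0 h]

theorem iotaOne_eq_one {lam : ℝ} (h : 1 / 3 < lam) (h' : lam ≤ 2 / 3) : iotaOne lam = 1 := by
  rw [iotaOne, mOne_eq_one h (by linarith), if_pos (by linarith)]

theorem iotaOne_eq_two {lam : ℝ} (h : 2 / 3 < lam) (h' : lam ≤ 1) : iotaOne lam = 2 := by
  rw [iotaOne, mOne_eq_one (by linarith) h', if_neg (by linarith)]

theorem R_of_mid {lam : ℝ} (h : 1 / 3 < lam) (h' : lam ≤ 2 / 3) : R lam = 3 * lam - 1 := by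
  rw [R, iotaOne_eq_one h h', mOne_eq_one h (by linarith)]
  norm_num

theorem R_of_high {lam : ℝ} (h : 2 / 3 < lam) (h' : lam ≤ 1) : R lam = 3 * lam - 2 := by
  rw [R, iotaOne_eq_two h h', mOne_eq_one (by linarith) h']
  norm_num

theorem iotaOne_eq_one_or_two (lam : ℝ) : iotaOne lam = 1 ∨ iotaOne lam = 2 := by
  unfold iotaOne
  split_ifs <;> simp

/-- Induction on the first exponent: multiplying `lam` by `3` lowers it by one, until it is `1`. -/
theorem mOne_induction {P : ℝ → Prop} (hlow : ∀ lam, 0 < lam → lam ≤ 1 / 3 → P (3 * lam) → P lam)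
    (hhigh : ∀ lam, 1 / 3 < lam → lam ≤ 1 → P lam) {lam : ℝ} (h0 : 0 < lam) (h1 : lam ≤ 1) :
    P lam := by
  induction hm : mOne lam generalizing lam with
  | zero => exact absurd hm (mOne_pos h0 h1).ne'
  | succ m ih =>
    rcases le_or_gt lam (1 / 3) with h | h
    · refine hlow lam h0 h (ih (by linarith) (by linarith) ?_)
      have := mOne_of_le h0 h
      omega
    · exact hhigh lam h h1

/-! ### The effective conductance between the top and the cut -/

/-- Renormalization of the conductance when the first digit is `1`. -/
noncomputable def phiOne (e : ℝ) : ℝ := 2 * e / (1 + e)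

/-- Renormalization of the conductance when the first digit is `2`. -/
noncomputable def phiTwo (e : ℝ) : ℝ := (18 * e + 4 * e ^ 2) / (6 + 15 * e + 3 * e ^ 2)

theorem phiOne_mono {x y : ℝ} (hx : 0 < x) (hxy : x ≤ y) : phiOne x ≤ phiOne y := by
  unfold phiOne
  have hy : 0 < y := by linarith
  rw [div_le_div_iff₀ (by positivity) (by positivity)]
  nlinarith

theorem phiTwo_mono {x y : ℝ} (hx : 0 < x) (hxy : x ≤ y) : phiTwo x ≤ phiTwo y := by
  unfold phiTwo
  have hy : 0 < y := by linarith
  rw [div_le_div_iff₀ (by positivity) (by positivity)]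
  have : 0 ≤ (y - x) * (6 * x * y + 24 * (x + y) + 108) :=
    mul_nonneg (by linarith) (by positivity)
  nlinarith

theorem phiOne_le {x : ℝ} (hx : 0 < x) : phiOne x ≤ 2 := by
  rw [phiOne, div_le_iff₀ (by positivity)]
  linarith

theorem phiTwo_le {x : ℝ} (hx : 0 < x) : phiTwo x ≤ 2 := by
  rw [phiTwo, div_le_iff₀ (by positivity)]
  nlinarith

/-- Approximate conductances: the `n`-fold renormalization of the constant `1`. They increase with
`n`, because the constant `1` is smaller than its renormalization. -/
noncomputable def conductanceApprox : ℕ → ℝ → ℝ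
  | 0, _ => 1
  | n + 1, lam => 15 / 7 * if lam ≤ 1 / 3 then conductanceApprox n (3 * lam)
      else if lam ≤ 2 / 3 then phiOne (conductanceApprox n (3 * lam - 1))
      else phiTwo (conductanceApprox n (3 * lam - 2))

theorem one_le_conductanceApprox (n : ℕ) (lam : ℝ) : 1 ≤ conductanceApprox n lam := by
  induction n generalizing lam with
  | zero => exact le_rfl
  | succ n ih =>
    rw [conductanceApprox]
    split_ifs
    · linarith [ih (3 * lam)]
    · have := phiOne_mono one_pos (ih (3 * lam - 1))
      norm_num [phiOne] at this ⊢
      linarith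
    · have := phiTwo_mono one_pos (ih (3 * lam - 2))
      norm_num [phiTwo] at this ⊢
      linarith

theorem conductanceApprox_le_succ (n : ℕ) (lam : ℝ) :
    conductanceApprox n lam ≤ conductanceApprox (n + 1) lam := by
  induction n generalizing lam with
  | zero => exact one_le_conductanceApprox 1 lam
  | succ n ih =>
    have hpos : ∀ x, 0 < conductanceApprox n x := fun x =>
      one_pos.trans_le (one_le_conductanceApprox n x)
    rw [conductanceApprox, conductanceApprox]
    gcongr
    split_ifs
    · exact ih _
    · exact phiOne_mono (hpos _) (ih _)
    · exact phiTwo_mono (hpos _) (ih _)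

/-- The bound `5 / lam` is preserved by the renormalization: both `15 / 7 * phiOne` and
`15 / 7 * phiTwo` are at most `30 / 7`, and `15 / 7 * (5 / (3 * lam)) ≤ 5 / lam`. -/
theorem conductanceApprox_le (n : ℕ) {lam : ℝ} (h0 : 0 < lam) (h1 : lam ≤ 1) :
    conductanceApprox n lam ≤ 5 / lam := by
  have h5 : 5 ≤ 5 / lam := by
    rw [le_div_iff₀ h0]
    linarith
  induction n generalizing lam with
  | zero => rw [conductanceApprox]; linarith
  | succ n ih =>
    rw [conductanceApprox]
    split_ifs with h h'
    · have h3 : 5 ≤ 5 / (3 * lam) := by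
        rw [le_div_iff₀ (by positivity)]
        linarith
      have := ih (lam := 3 * lam) (by linarith) (by linarith) h3
      have e : 5 / (3 * lam) = 5 / lam / 3 := by field_simp
      rw [e] at this
      linarith
    · have := phiOne_le (one_pos.trans_le (one_le_conductanceApprox n (3 * lam - 1)))
      linarith
    · have := phiTwo_le (one_pos.trans_le (one_le_conductanceApprox n (3 * lam - 2)))
      linarith

/-- The effective conductance between `q 0` and the cut `X_lam`, as the limit of its approximate
values. It turns out to be `eta lam`. -/
noncomputable def conductance (lam : ℝ) : ℝ := ⨆ n, conductanceApprox n lam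

theorem tendsto_conductanceApprox {lam : ℝ} (h0 : 0 < lam) (h1 : lam ≤ 1) :
    Tendsto (fun n => conductanceApprox n lam) atTop (𝓝 (conductance lam)) :=
  tendsto_atTop_ciSup (monotone_nat_of_le_succ fun n => conductanceApprox_le_succ n lam)
    ⟨5 / lam, by rintro _ ⟨n, rfl⟩; exact conductanceApprox_le n h0 h1⟩

theorem one_le_conductance {lam : ℝ} (h0 : 0 < lam) (h1 : lam ≤ 1) : 1 ≤ conductance lam :=
  ge_of_tendsto' (tendsto_conductanceApprox h0 h1) fun n => one_le_conductanceApprox n lam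

theorem conductance_pos {lam : ℝ} (h0 : 0 < lam) (h1 : lam ≤ 1) : 0 < conductance lam :=
  one_pos.trans_le (one_le_conductance h0 h1)

theorem conductance_of_le {lam : ℝ} (h0 : 0 < lam) (h : lam ≤ 1 / 3) :
    conductance lam = 15 / 7 * conductance (3 * lam) := by
  have e1 := (tendsto_conductanceApprox h0 (by linarith)).comp (tendsto_add_atTop_nat 1)
  have e2 := (tendsto_conductanceApprox (lam := 3 * lam) (by linarith) (by linarith)).const_mul
    (15 / 7)
  refine tendsto_nhds_unique e1 (e2.congr fun n => ?_)
  simp only [Function.comp, conductanceApprox, if_pos h]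

theorem conductance_of_mid {lam : ℝ} (h : 1 / 3 < lam) (h' : lam ≤ 2 / 3) :
    conductance lam = 15 / 7 * phiOne (conductance (3 * lam - 1)) := by
  have e1 := (tendsto_conductanceApprox (lam := lam) (by linarith) (by linarith)).comp
    (tendsto_add_atTop_nat 1)
  have e0 := tendsto_conductanceApprox (lam := 3 * lam - 1) (by linarith) (by linarith)
  have hp := conductance_pos (lam := 3 * lam - 1) (by linarith) (by linarith)
  have e2 := ((e0.const_mul 2).div (e0.const_add 1) (by positivity)).const_mul (15 / 7)
  refine tendsto_nhds_unique e1 (e2.congr fun n => ?_)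
  simp only [Function.comp, conductanceApprox, if_neg (not_le.2 h), if_pos h', phiOne,
    Pi.div_apply]

theorem conductance_of_high {lam : ℝ} (h : 2 / 3 < lam) (h' : lam ≤ 1) :
    conductance lam = 15 / 7 * phiTwo (conductance (3 * lam - 2)) := by
  have e1 := (tendsto_conductanceApprox (lam := lam) (by linarith) (by linarith)).comp
    (tendsto_add_atTop_nat 1)
  have e0 := tendsto_conductanceApprox (lam := 3 * lam - 2) (by linarith) (by linarith)
  have hp := conductance_pos (lam := 3 * lam - 2) (by linarith) (by linarith)
  have e2 := (((e0.const_mul 18).add ((e0.pow 2).const_mul 4)).div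
    (((e0.const_mul 15).const_add 6).add ((e0.pow 2).const_mul 3)) (by positivity)).const_mul
    (15 / 7)
  refine tendsto_nhds_unique e1 (e2.congr fun n => ?_)
  simp only [Function.comp, conductanceApprox, if_neg (not_le.2 h),
    if_neg (show ¬ lam ≤ 1 / 3 by linarith), phiTwo, Pi.div_apply]

/-! ### The maps `F_i^lam` and the self-similarity of the cut -/

theorem Flam_cons (lam : ℝ) (i : Fin 6) (w : List (Fin 6)) (z : Plane) :
    Flam lam (i :: w) z = Flam lam [i] (Flam (R lam) w z) := rfl

theorem Flam_singleton_of_le {lam : ℝ} (h0 : 0 < lam) (h : lam ≤ 1 / 3) (i : Fin 6) (z : Plane) :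
    Flam lam [i] z = F 0 (Flam (3 * lam) [i] z) := by
  obtain ⟨k, hk⟩ : ∃ k, mOne (3 * lam) = k + 1 :=
    Nat.exists_eq_succ_of_ne_zero (mOne_pos (by linarith) (by linarith)).ne'
  simp only [Flam, mOne_of_le h0 h, hk, Nat.add_sub_cancel, Function.comp,
    Function.iterate_succ_apply', id]

theorem Flam_singleton_of_gt {lam : ℝ} (h : 1 / 3 < lam) (h1 : lam ≤ 1) (i : Fin 6) (z : Plane) :
    Flam lam [i] z = F i z := by
  simp [Flam, mOne_eq_one h h1]

theorem iterate_F_eq_Fword (n : ℕ) (z : Plane) : (F 0)^[n] z = Fword (List.replicate n 0) z := by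
  induction n with
  | zero => rfl
  | succ n ih => rw [Function.iterate_succ_apply', ih, List.replicate_succ]; rfl

theorem Flam_eq_Fword (lam : ℝ) (w : List (Fin 6)) : ∃ w', Flam lam w = Fword w' := by
  induction w generalizing lam with
  | nil => exact ⟨[], rfl⟩
  | cons i w ih =>
    obtain ⟨w', hw'⟩ := ih (R lam)
    refine ⟨List.replicate (mOne lam - 1) 0 ++ i :: w', funext fun z => ?_⟩
    rw [Fword_append, ← iterate_F_eq_Fword]
    simp only [Flam, Fword, Function.comp, hw']

theorem Flam_continuous (lam : ℝ) (w : List (Fin 6)) : Continuous (Flam lam w) := by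
  obtain ⟨w', h⟩ := Flam_eq_Fword lam w
  exact h ▸ Fword_continuous w'

theorem Flam_mem_gasket (lam : ℝ) (w : List (Fin 6)) {z : Plane} (hz : z ∈ gasket) :
    Flam lam w z ∈ gasket := by
  obtain ⟨w', h⟩ := Flam_eq_Fword lam w
  exact h ▸ Fword_mem_gasket w' hz

theorem Fword_injective (w : List (Fin 6)) : Function.Injective (Fword w) := by
  intro x y h
  have := dist_Fword w x y
  rw [h, dist_self, eq_comm, div_eq_zero_iff] at this
  exact dist_eq_zero.1 (this.resolve_right (by positivity))

theorem Flam_injective (lam : ℝ) (w : List (Fin 6)) : Function.Injective (Flam lam w) := by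
  obtain ⟨w', h⟩ := Flam_eq_Fword lam w
  exact h ▸ Fword_injective w'

theorem dist_Flam_singleton_le {lam : ℝ} (h0 : 0 < lam) (h1 : lam ≤ 1) (i : Fin 6)
    (x y : Plane) : dist (Flam lam [i] x) (Flam lam [i] y) ≤ dist x y / 3 := by
  refine mOne_induction (P := fun lam => dist (Flam lam [i] x) (Flam lam [i] y) ≤ dist x y / 3)
    (fun lam h0 h ih => ?_) (fun lam h h1 => ?_) h0 h1
  · rw [Flam_singleton_of_le h0 h, Flam_singleton_of_le h0 h, dist_F]
    have : 0 ≤ dist (Flam (3 * lam) [i] x) (Flam (3 * lam) [i] y) := dist_nonneg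
    linarith
  · rw [Flam_singleton_of_gt h h1, Flam_singleton_of_gt h h1, dist_F]

theorem dist_Flam_le {lam : ℝ} (h0 : 0 < lam) (h1 : lam ≤ 1) (w : List (Fin 6))
    (x y : Plane) : dist (Flam lam w x) (Flam lam w y) ≤ dist x y / 3 ^ w.length := by
  induction w generalizing lam with
  | nil => simp [Flam]
  | cons i w ih =>
    rw [Flam_cons lam i w x, Flam_cons lam i w y]
    refine (dist_Flam_singleton_le h0 h1 i _ _).trans ?_
    have := ih (R_mem h0 h1).1 (R_mem h0 h1).2
    rw [List.length_cons, pow_succ, ← div_div]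
    linarith

theorem letters_of_mid {lam : ℝ} (h : 1 / 3 < lam) (h' : lam ≤ 2 / 3) :
    letters lam = {4, 5} := by
  rw [letters, iotaOne_eq_one h h', if_pos rfl]

theorem letters_of_high {lam : ℝ} (h : 2 / 3 < lam) (h' : lam ≤ 1) :
    letters lam = {1, 2, 3} := by
  rw [letters, iotaOne_eq_two h h', if_neg (by norm_num)]

theorem height_of_mem_letters {lam : ℝ} (h : 1 / 3 < lam) (h1 : lam ≤ 1) {i : Fin 6}
    (hi : i ∈ letters lam) : height i = 2 - 3 * lam + R lam := by
  rcases le_or_gt lam (2 / 3) with h' | h'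
  · rw [letters_of_mid h h'] at hi
    rw [R_of_mid h h']
    fin_cases hi <;> simp [height] <;> ring
  · rw [letters_of_high h' h1] at hi
    rw [R_of_high h' h1]
    fin_cases hi <;> simp [height]

/-- `F_i^lam` maps heights above the cut `X_{R lam}` to heights above the cut `X_lam`. -/
theorem Flam_singleton_snd {lam : ℝ} (h0 : 0 < lam) (h1 : lam ≤ 1) {i : Fin 6}
    (hi : i ∈ letters lam) (z : Plane) :
    (Flam lam [i] z).2 - (1 - lam) = (z.2 - (1 - R lam)) / 3 ^ mOne lam := by
  revert hi
  refine mOne_induction (P := fun lam => i ∈ letters lam →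
    (Flam lam [i] z).2 - (1 - lam) = (z.2 - (1 - R lam)) / 3 ^ mOne lam)
    (fun lam h0 h ih hi => ?_) (fun lam h h1 hi => ?_) h0 h1
  · rw [letters_of_le h0 h] at hi
    have := ih hi
    rw [Flam_singleton_of_le h0 h, F_snd, R_of_le h0 h, mOne_of_le h0 h, pow_succ, ← div_div,
      ← this]
    simp [height]
    ring
  · rw [Flam_singleton_of_gt h h1, F_snd, mOne_eq_one h h1, height_of_mem_letters h h1 hi]
    ring

theorem Flam_singleton_mem_cut {lam : ℝ} (h0 : 0 < lam) (h1 : lam ≤ 1) {i : Fin 6}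
    (hi : i ∈ letters lam) {z : Plane} (hz : z ∈ gasket) :
    Flam lam [i] z ∈ cut lam ↔ z ∈ cut (R lam) := by
  have h := Flam_singleton_snd h0 h1 hi z
  have h3 : (0 : ℝ) < 3 ^ mOne lam := by positivity
  constructor
  · rintro ⟨-, h'⟩
    rw [h', sub_self, eq_comm, div_eq_zero_iff] at h
    exact ⟨hz, sub_eq_zero.1 (h.resolve_right h3.ne')⟩
  · rintro ⟨-, h'⟩
    rw [h', sub_self, zero_div] at h
    exact ⟨Flam_mem_gasket _ _ hz, sub_eq_zero.1 h⟩

/-- The top cell is the part of the gasket of height at least `2 / 3`. -/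
theorem mem_top_cell {z : Plane} (hz : z ∈ gasket) (h : 2 / 3 ≤ z.2) :
    ∃ y ∈ gasket, F 0 y = z := by
  obtain ⟨i, y, hy, rfl⟩ := exists_F_of_mem_gasket hz
  have h1 := snd_le_one hy
  rw [F_snd] at h
  have hq : 1 ≤ y.2 → y = q 0 := fun h => eq_q_of_bary hy 0 (by simpa [bary] using h)
  fin_cases i <;> simp [height] at h
  · exact ⟨y, hy, rfl⟩
  any_goals linarith
  · refine ⟨q 2, q_mem_gasket 2, ?_⟩
    rw [hq (by linarith), F_q_eq_pt, F_q_eq_pt]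
    rfl
  · refine ⟨q 1, q_mem_gasket 1, ?_⟩
    rw [hq (by linarith), F_q_eq_pt, F_q_eq_pt]
    rfl

theorem exists_mem_cut_of_mid {lam : ℝ} (h : 1 / 3 < lam) (h' : lam ≤ 2 / 3) {z : Plane}
    (hz : z ∈ cut lam) : ∃ i ∈ letters lam, ∃ y ∈ gasket, F i y = z := by
  rw [letters_of_mid h h']
  obtain ⟨hz, hz2⟩ := hz
  obtain ⟨i, y, hy, rfl⟩ := exists_F_of_mem_gasket hz
  have h1 := snd_le_one hy
  have h0 := snd_nonneg hy
  rw [F_snd] at hz2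
  have hq : 1 ≤ y.2 → y = q 0 := fun h => eq_q_of_bary hy 0 (by simpa [bary] using h)
  fin_cases i <;> simp [height] at hz2
  · linarith
  · refine ⟨5, by simp, q 1, q_mem_gasket 1, ?_⟩
    rw [hq (by linarith), F_q_eq_pt, F_q_eq_pt]
    rfl
  · refine ⟨4, by simp, q 2, q_mem_gasket 2, ?_⟩
    rw [hq (by linarith), F_q_eq_pt, F_q_eq_pt]
    rfl
  · refine ⟨4, by simp, q 1, q_mem_gasket 1, ?_⟩
    rw [hq (by linarith), F_q_eq_pt, F_q_eq_pt]
    rfl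
  · exact ⟨4, by simp, y, hy, rfl⟩
  · exact ⟨5, by simp, y, hy, rfl⟩

theorem exists_mem_cut_of_high {lam : ℝ} (h : 2 / 3 < lam) (h' : lam ≤ 1) {z : Plane}
    (hz : z ∈ cut lam) : ∃ i ∈ letters lam, ∃ y ∈ gasket, F i y = z := by
  rw [letters_of_high h h']
  obtain ⟨hz, hz2⟩ := hz
  obtain ⟨i, y, hy, rfl⟩ := exists_F_of_mem_gasket hz
  have h0 := snd_nonneg hy
  rw [F_snd] at hz2
  have hi : i ∈ ({1, 2, 3} : Finset (Fin 6)) := by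
    fin_cases i <;> simp [height] at hz2 ⊢ <;> linarith
  exact ⟨i, hi, y, hy, rfl⟩

theorem exists_Flam_of_mem_cut {lam : ℝ} (h0 : 0 < lam) (h1 : lam ≤ 1) {z : Plane}
    (hz : z ∈ cut lam) : ∃ i ∈ letters lam, ∃ y ∈ cut (R lam), Flam lam [i] y = z := by
  suffices h : ∃ i ∈ letters lam, ∃ y ∈ gasket, Flam lam [i] y = z by
    obtain ⟨i, hi, y, hy, rfl⟩ := h
    exact ⟨i, hi, y, (Flam_singleton_mem_cut h0 h1 hi hy).1 hz, rfl⟩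
  revert z
  refine mOne_induction (P := fun lam => ∀ {z : Plane}, z ∈ cut lam →
    ∃ i ∈ letters lam, ∃ y ∈ gasket, Flam lam [i] y = z)
    (fun lam h0 h ih z hz => ?_) (fun lam h h1 z hz => ?_) h0 h1
  · obtain ⟨y, hy, rfl⟩ := mem_top_cell hz.1 (by rw [hz.2]; linarith)
    have h2 := hz.2
    rw [F_snd] at h2
    simp [height] at h2
    obtain ⟨i, hi, x, hx, rfl⟩ := ih (z := y) ⟨hy, by linarith⟩
    refine ⟨i, letters_of_le h0 h ▸ hi, x, hx, Flam_singleton_of_le h0 h i x⟩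
  · simp only [Flam_singleton_of_gt h h1]
    rcases le_or_gt lam (2 / 3) with h' | h'
    · exact exists_mem_cut_of_mid h h' hz
    · exact exists_mem_cut_of_high h' h1 hz

theorem corner_of_Flam_eq (lam : ℝ) {i j : Fin 6} (hij : i ≠ j) {x y : Plane}
    (hx : x ∈ gasket) (hy : y ∈ gasket) (h : Flam lam [i] x = Flam lam [j] y) :
    ∃ k, x = q k := by
  simp only [Flam, Function.comp, id] at h
  rw [iterate_F_eq_Fword, iterate_F_eq_Fword] at h
  exact (corner_of_F_eq hij hx hy (Fword_injective _ h)).1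

theorem isClosed_cut (lam : ℝ) : IsClosed (cut lam) :=
  gasket_isClosed.inter (isClosed_eq continuous_snd continuous_const)

theorem isClosed_cutCell (lam : ℝ) (w : List (Fin 6)) : IsClosed (cutCell lam w) :=
  (gasket_isCompact.image (Flam_continuous lam w)).isClosed.inter (isClosed_cut lam)

/-! ### The weights of the boundary measure -/

/-- The weights `μ^lam_i`, expressed through `conductance` in place of `eta`. -/
noncomputable def cutWeight (lam : ℝ) (i : Fin 6) : ℝ :=
  if iotaOne lam = 1 then 1 / 2
  else if i = 3 then (3 + conductance (R lam)) / (9 + 2 * conductance (R lam))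
  else (6 + conductance (R lam)) / (18 + 4 * conductance (R lam))

/-- The product of the weights along a word. -/
noncomputable def cutWordWeight : ℝ → List (Fin 6) → ℝ
  | _, [] => 1
  | lam, i :: w => cutWeight lam i * cutWordWeight (R lam) w

theorem cutWeight_of_le {lam : ℝ} (h0 : 0 < lam) (h : lam ≤ 1 / 3) (i : Fin 6) :
    cutWeight lam i = cutWeight (3 * lam) i := by
  unfold cutWeight
  rw [iotaOne_of_le h0 h, R_of_le h0 h]

theorem cutWeight_pos {lam : ℝ} (h0 : 0 < lam) (h1 : lam ≤ 1) (i : Fin 6) :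
    0 < cutWeight lam i := by
  have := conductance_pos (R_mem h0 h1).1 (R_mem h0 h1).2
  unfold cutWeight
  split_ifs <;> positivity

theorem cutWeight_lt_one {lam : ℝ} (h0 : 0 < lam) (h1 : lam ≤ 1) (i : Fin 6) :
    cutWeight lam i < 1 := by
  have := conductance_pos (R_mem h0 h1).1 (R_mem h0 h1).2
  unfold cutWeight
  split_ifs
  · norm_num
  · rw [div_lt_one (by positivity)]; linarith
  · rw [div_lt_one (by positivity)]; linarith

theorem cutWordWeight_pos {lam : ℝ} (h0 : 0 < lam) (h1 : lam ≤ 1) (w : List (Fin 6)) :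
    0 < cutWordWeight lam w := by
  induction w generalizing lam with
  | nil => exact one_pos
  | cons i w ih => exact mul_pos (cutWeight_pos h0 h1 i) (ih (R_mem h0 h1).1 (R_mem h0 h1).2)

theorem sum_cutWeight {lam : ℝ} (h0 : 0 < lam) (h1 : lam ≤ 1) :
    ∑ i ∈ letters lam, cutWeight lam i = 1 := by
  have := conductance_pos (R_mem h0 h1).1 (R_mem h0 h1).2
  unfold letters cutWeight
  rcases iotaOne_eq_one_or_two lam with h | h
  · rw [h]
    simp only [if_true]
    rw [Finset.sum_pair (by decide)]
    norm_num
  · rw [h]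
    simp
    field_simp
    ring

/-- The admissible words of length `n` index a cover of the cut, and their weights sum to `1`. -/
theorem exists_cutCell_cover (n : ℕ) {lam : ℝ} (h0 : 0 < lam) (h1 : lam ≤ 1) :
    ∃ T : Finset (List (Fin 6)), (∀ w ∈ T, IsAdmissible lam w ∧ w.length = n) ∧
      ∑ w ∈ T, cutWordWeight lam w = 1 ∧ ∀ z ∈ cut lam, ∃ w ∈ T, z ∈ cutCell lam w := by
  induction n generalizing lam with
  | zero =>
    refine ⟨{[]}, by simp [IsAdmissible], by simp [cutWordWeight], fun z hz => ?_⟩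
    exact ⟨[], by simp, ⟨z, hz.1, rfl⟩, hz⟩
  | succ n ih =>
    obtain ⟨T, hT, hsum, hcov⟩ := ih (R_mem h0 h1).1 (R_mem h0 h1).2
    have hinj : Function.Injective fun x : Fin 6 × List (Fin 6) => x.1 :: x.2 := by
      intro x y h
      simp only [List.cons.injEq] at h
      exact Prod.ext h.1 h.2
    refine ⟨(letters lam ×ˢ T).map ⟨_, hinj⟩, ?_, ?_, ?_⟩
    · intro w hw
      obtain ⟨x, hx, rfl⟩ := Finset.mem_map.1 hw
      obtain ⟨h2, h3⟩ := Finset.mem_product.1 hx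
      exact ⟨⟨h2, (hT _ h3).1⟩, by simp [(hT _ h3).2]⟩
    · rw [Finset.sum_map, Finset.sum_product]
      simp only [Function.Embedding.coeFn_mk, cutWordWeight, ← Finset.mul_sum, hsum, mul_one]
      exact sum_cutWeight h0 h1
    · intro z hz
      obtain ⟨i, hi, y, hy, rfl⟩ := exists_Flam_of_mem_cut h0 h1 hz
      obtain ⟨w, hw, ⟨x, hx, rfl⟩, -⟩ := hcov y hy
      exact ⟨i :: w, Finset.mem_map.2 ⟨(i, w), Finset.mem_product.2 ⟨hi, hw⟩, rfl⟩,
        ⟨x, hx, rfl⟩, hz⟩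

/-! ### Existence of the self-similar family of boundary measures -/

/-- `F_i^lam` as a self-map of the gasket. -/
noncomputable def gasketMap (lam : ℝ) (i : Fin 6) : C(gasket, gasket) :=
  ⟨fun z => ⟨Flam lam [i] z, Flam_mem_gasket lam [i] z.2⟩,
    ((Flam_continuous lam [i]).comp continuous_subtype_val).subtype_mk _⟩

/-- Discrete approximations of the boundary measure: one atom in each cell `X_w` of level `n`. -/
noncomputable def cutApprox : ℕ → ℝ → Measure gasket
  | 0, _ => Measure.dirac ⟨q 1, q_mem_gasket 1⟩
  | n + 1, lam => ∑ i ∈ letters lam,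
      ENNReal.ofReal (cutWeight lam i) • (cutApprox n (R lam)).map (gasketMap lam i)

instance : CompactSpace gasket := isCompact_iff_compactSpace.1 gasket_isCompact

theorem isProbabilityMeasure_cutApprox (n : ℕ) {lam : ℝ} (h0 : 0 < lam) (h1 : lam ≤ 1) :
    IsProbabilityMeasure (cutApprox n lam) := by
  induction n generalizing lam with
  | zero => rw [cutApprox]; infer_instance
  | succ n ih =>
    have := ih (R_mem h0 h1).1 (R_mem h0 h1).2
    refine ⟨?_⟩
    rw [cutApprox, Measure.finsetSum_apply]
    simp only [Measure.smul_apply, smul_eq_mul]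
    have : ∀ i, (Measure.map (gasketMap lam i) (cutApprox n (R lam))) univ = 1 := fun i => by
      rw [Measure.map_apply (gasketMap lam i).continuous.measurable MeasurableSet.univ]
      exact measure_univ
    simp only [this, mul_one]
    rw [← ENNReal.ofReal_sum_of_nonneg fun i _ => (cutWeight_pos h0 h1 i).le, sum_cutWeight h0 h1,
      ENNReal.ofReal_one]

theorem integrable_of_compactSpace (μ : Measure gasket) [IsFiniteMeasure μ] (f : C(gasket, ℝ)) :
    Integrable f μ :=
  f.continuous.integrable_of_hasCompactSupport (HasCompactSupport.of_compactSpace f)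

theorem integral_cutApprox_succ (n : ℕ) {lam : ℝ} (h0 : 0 < lam) (h1 : lam ≤ 1)
    (f : C(gasket, ℝ)) : ∫ z, f z ∂(cutApprox (n + 1) lam) =
      ∑ i ∈ letters lam, cutWeight lam i * ∫ z, f (gasketMap lam i z) ∂(cutApprox n (R lam)) := by
  have := isProbabilityMeasure_cutApprox n (R_mem h0 h1).1 (R_mem h0 h1).2
  rw [cutApprox, integral_finsetSum_measure]
  · refine Finset.sum_congr rfl fun i _ => ?_
    rw [integral_smul_measure, integral_map (gasketMap lam i).continuous.measurable.aemeasurable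
      f.continuous.aestronglyMeasurable, ENNReal.toReal_ofReal (cutWeight_pos h0 h1 i).le,
      smul_eq_mul]
  · intro i _
    refine Integrable.smul_measure ?_ ENNReal.ofReal_ne_top
    exact integrable_of_compactSpace _ f

theorem abs_integral_sub_le {μ : Measure gasket} [IsProbabilityMeasure μ] {f : C(gasket, ℝ)}
    {c ε : ℝ} (h : ∀ x, |f x - c| ≤ ε) : |∫ z, f z ∂μ - c| ≤ ε := by
  have e : ∫ z, f z ∂μ - c = ∫ z, (f z - c) ∂μ := by
    rw [integral_sub (integrable_of_compactSpace μ f) (integrable_const c)]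
    simp
  rw [e, ← Real.norm_eq_abs]
  refine (norm_integral_le_of_norm_le_const (C := ε) (Eventually.of_forall h)).trans ?_
  simp

theorem dist_gasketMap_le {lam : ℝ} (h0 : 0 < lam) (h1 : lam ≤ 1) (i : Fin 6) (x y : gasket) :
    dist (gasketMap lam i x) (gasketMap lam i y) ≤ dist x y / 3 :=
  dist_Flam_singleton_le h0 h1 i x y

theorem abs_integral_cutApprox_sub_le (n : ℕ) {lam : ℝ} (h0 : 0 < lam) (h1 : lam ≤ 1)
    (f : C(gasket, ℝ)) {ε : ℝ} (h : ∀ x y : gasket, dist x y ≤ 2 / 3 ^ n → |f x - f y| ≤ ε) :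
    |∫ z, f z ∂(cutApprox (n + 1) lam) - ∫ z, f z ∂(cutApprox n lam)| ≤ ε := by
  induction n generalizing lam f with
  | zero =>
    have := isProbabilityMeasure_cutApprox 1 h0 h1
    rw [cutApprox.eq_1 lam, integral_dirac]
    refine abs_integral_sub_le fun x => h _ _ ?_
    rw [pow_zero, div_one]
    exact dist_gasket_le x.2 (q_mem_gasket 1)
  | succ n ih =>
    rw [integral_cutApprox_succ (n + 1) h0 h1, integral_cutApprox_succ n h0 h1,
      ← Finset.sum_sub_distrib]
    refine (Finset.abs_sum_le_sum_abs _ _).trans ?_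
    have e : ε = ∑ i ∈ letters lam, cutWeight lam i * ε := by
      rw [← Finset.sum_mul, sum_cutWeight h0 h1, one_mul]
    rw [e]
    refine Finset.sum_le_sum fun i _ => ?_
    rw [← mul_sub, abs_mul, abs_of_pos (cutWeight_pos h0 h1 i)]
    refine mul_le_mul_of_nonneg_left ?_ (cutWeight_pos h0 h1 i).le
    refine ih (R_mem h0 h1).1 (R_mem h0 h1).2 (f.comp (gasketMap lam i)) fun x y hxy => h _ _ ?_
    refine (dist_gasketMap_le h0 h1 i x y).trans ?_
    rw [pow_succ, ← div_div]
    linarith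

theorem tendsto_integral_cutApprox_sub {lam : ℝ} (h0 : 0 < lam) (h1 : lam ≤ 1)
    (f : C(gasket, ℝ)) :
    Tendsto (fun n => ∫ z, f z ∂(cutApprox (n + 1) lam) - ∫ z, f z ∂(cutApprox n lam)) atTop
      (𝓝 0) := by
  rw [Metric.tendsto_atTop]
  intro ε hε
  obtain ⟨δ, hδ, hd⟩ := Metric.uniformContinuous_iff.1
    (CompactSpace.uniformContinuous_of_continuous f.continuous) (ε / 2) (by positivity)
  obtain ⟨N, hN⟩ := exists_pow_lt_of_lt_one (show 0 < δ / 2 by positivity)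
    (by norm_num : (1 / 3 : ℝ) < 1)
  refine ⟨N, fun n hn => ?_⟩
  rw [Real.dist_eq, sub_zero]
  refine (abs_integral_cutApprox_sub_le n h0 h1 f (ε := ε / 2) fun x y hxy => ?_).trans_lt
    (by linarith)
  refine (hd (hxy.trans_lt ?_)).le
  have e1 : (1 / 3 : ℝ) ^ n ≤ (1 / 3) ^ N :=
    pow_le_pow_of_le_one (by norm_num) (by norm_num) hn
  have e2 : (2 : ℝ) / 3 ^ n = 2 * (1 / 3) ^ n := by rw [one_div, inv_pow]; rfl
  rw [e2]
  linarith

/-- The boundary measures exist, as weak limits of their discrete approximations; they are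
stated through the self-similar identity for integrals of continuous functions. -/
theorem exists_cutFamily : ∃ ν : ℝ → Measure Plane, ∀ lam, 0 < lam → lam ≤ 1 →
    IsProbabilityMeasure (ν lam) ∧ ν lam gasketᶜ = 0 ∧
      ∀ f : Plane → ℝ, Continuous f → ∫ z, f z ∂(ν lam) =
        ∑ i ∈ letters lam, cutWeight lam i * ∫ z, f (Flam lam [i] z) ∂(ν (R lam)) := by
  have hlim : ∀ lam : ℝ, ∃ P : ProbabilityMeasure gasket, 0 < lam → lam ≤ 1 →
      ∀ f : C(gasket, ℝ), Tendsto (fun n => ∫ z, f z ∂(cutApprox n lam)) (hyperfilter ℕ)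
        (𝓝 (∫ z, f z ∂(P : Measure gasket))) := by
    intro lam
    by_cases h : 0 < lam ∧ lam ≤ 1
    -- A limit along an ultrafilter exists by compactness of the space of probability measures.
    · set s : ℕ → ProbabilityMeasure gasket := fun n =>
        ⟨cutApprox n lam, isProbabilityMeasure_cutApprox n h.1 h.2⟩ with hs
      refine ⟨((hyperfilter ℕ).map s).lim, fun _ _ f => ?_⟩
      have hl : Tendsto s (hyperfilter ℕ) (𝓝 ((hyperfilter ℕ).map s).lim) :=
        ((hyperfilter ℕ).map s).le_nhds_lim
      exact ProbabilityMeasure.tendsto_iff_forall_integral_tendsto.1 hl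
        (BoundedContinuousFunction.mkOfCompact f)
    · have hz : IsProbabilityMeasure (Measure.dirac (⟨q 1, q_mem_gasket 1⟩ : gasket)) :=
        inferInstance
      exact ⟨⟨_, hz⟩, fun h0 h1 => absurd ⟨h0, h1⟩ h⟩
  choose P hP using hlim
  have hself : ∀ lam, 0 < lam → lam ≤ 1 → ∀ f : C(gasket, ℝ),
      ∫ z, f z ∂(P lam : Measure gasket) = ∑ i ∈ letters lam,
        cutWeight lam i * ∫ z, f (gasketMap lam i z) ∂(P (R lam) : Measure gasket) := by
    intro lam h0 h1 f
    have e1 := hP lam h0 h1 f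
    have e2 : Tendsto (fun n => ∫ z, f z ∂(cutApprox (n + 1) lam) - ∫ z, f z ∂(cutApprox n lam))
        (hyperfilter ℕ) (𝓝 0) :=
      (tendsto_integral_cutApprox_sub h0 h1 f).mono_left (Nat.hyperfilter_le_atTop)
    have e3 := e1.add e2
    rw [add_zero] at e3
    have e4 : Tendsto (fun n => ∑ i ∈ letters lam,
        cutWeight lam i * ∫ z, f (gasketMap lam i z) ∂(cutApprox n (R lam))) (hyperfilter ℕ)
        (𝓝 (∑ i ∈ letters lam,
          cutWeight lam i * ∫ z, f (gasketMap lam i z) ∂(P (R lam) : Measure gasket))) :=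
      tendsto_finsetSum _ fun i _ =>
        (hP (R lam) (R_mem h0 h1).1 (R_mem h0 h1).2 (f.comp (gasketMap lam i))).const_mul _
    refine tendsto_nhds_unique e3 (e4.congr fun n => ?_)
    rw [← integral_cutApprox_succ n h0 h1]
    ring
  have hmap : ∀ lam (f : Plane → ℝ), Continuous f →
      ∫ z, f z ∂((P lam : Measure gasket).map Subtype.val) =
        ∫ z, f (z : gasket) ∂(P lam : Measure gasket) := fun lam f hf =>
    integral_map measurable_subtype_coe.aemeasurable hf.aestronglyMeasurable
  refine ⟨fun lam => (P lam : Measure gasket).map Subtype.val, fun lam h0 h1 => ⟨?_, ?_, ?_⟩⟩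
  · exact Measure.isProbabilityMeasure_map measurable_subtype_coe.aemeasurable
  · rw [Measure.map_apply measurable_subtype_coe gasket_isClosed.measurableSet.compl]
    simp
  · intro f hf
    rw [hmap lam f hf]
    refine (hself lam h0 h1 ⟨_, hf.comp continuous_subtype_val⟩).trans ?_
    refine Finset.sum_congr rfl fun i _ => ?_
    exact congrArg _ (hmap (R lam) _ (hf.comp (Flam_continuous lam [i]))).symm

/-- The self-similar family of boundary measures; for `0 < lam ≤ 1`, the measure `cutFamily lam`
turns out to be the measure `μ^lam`. -/
noncomputable def cutFamily : ℝ → Measure Plane := exists_cutFamily.choose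

section

variable {lam : ℝ}

theorem isProbabilityMeasure_cutFamily (h0 : 0 < lam) (h1 : lam ≤ 1) :
    IsProbabilityMeasure (cutFamily lam) := (exists_cutFamily.choose_spec lam h0 h1).1

theorem cutFamily_compl_gasket (h0 : 0 < lam) (h1 : lam ≤ 1) : cutFamily lam gasketᶜ = 0 :=
  (exists_cutFamily.choose_spec lam h0 h1).2.1

theorem integral_cutFamily (h0 : 0 < lam) (h1 : lam ≤ 1) {f : Plane → ℝ} (hf : Continuous f) :
    ∫ z, f z ∂(cutFamily lam) =
      ∑ i ∈ letters lam, cutWeight lam i * ∫ z, f (Flam lam [i] z) ∂(cutFamily (R lam)) :=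
  (exists_cutFamily.choose_spec lam h0 h1).2.2 f hf

theorem cutFamily_eq_sum (h0 : 0 < lam) (h1 : lam ≤ 1) :
    cutFamily lam = ∑ i ∈ letters lam,
      ENNReal.ofReal (cutWeight lam i) • (cutFamily (R lam)).map (Flam lam [i]) := by
  have := isProbabilityMeasure_cutFamily h0 h1
  have := isProbabilityMeasure_cutFamily (R_mem h0 h1).1 (R_mem h0 h1).2
  have hfin : ∀ i, IsFiniteMeasure
      (ENNReal.ofReal (cutWeight lam i) • (cutFamily (R lam)).map (Flam lam [i])) := fun i =>
    (Measure.map (Flam lam [i]) (cutFamily (R lam))).smul_finite ENNReal.ofReal_ne_top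
  refine ext_of_forall_integral_eq_of_IsFiniteMeasure fun f => ?_
  rw [integral_cutFamily h0 h1 f.continuous, integral_finsetSum_measure]
  · refine Finset.sum_congr rfl fun i _ => ?_
    rw [integral_smul_measure, integral_map (Flam_continuous lam [i]).measurable.aemeasurable
      f.continuous.aestronglyMeasurable, ENNReal.toReal_ofReal (cutWeight_pos h0 h1 i).le,
      smul_eq_mul]
  · exact fun i _ => f.integrable _

theorem cutFamily_apply (h0 : 0 < lam) (h1 : lam ≤ 1) {s : Set Plane} (hs : MeasurableSet s) :
    cutFamily lam s = ∑ i ∈ letters lam,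
      ENNReal.ofReal (cutWeight lam i) * cutFamily (R lam) (Flam lam [i] ⁻¹' s) := by
  conv_lhs => rw [cutFamily_eq_sum h0 h1]
  rw [Measure.finsetSum_apply]
  refine Finset.sum_congr rfl fun i _ => ?_
  rw [Measure.smul_apply, smul_eq_mul,
    Measure.map_apply (Flam_continuous lam [i]).measurable hs]

/-- There is no mass at distance more than `3 ^ (-n)` from the height of the cut, since `F_i^lam`
contracts the distance to the cut at least by `3`. -/
theorem cutFamily_far (n : ℕ) (h0 : 0 < lam) (h1 : lam ≤ 1) :
    cutFamily lam {z | (1 / 3 : ℝ) ^ n < |z.2 - (1 - lam)|} = 0 := by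
  induction n generalizing lam with
  | zero =>
    refine measure_mono_null ?_ (cutFamily_compl_gasket h0 h1)
    intro z hz hz'
    rw [mem_ofPred_eq, pow_zero] at hz
    have := snd_nonneg hz'
    have := snd_le_one hz'
    exact absurd hz (not_lt.2 (abs_le.2 ⟨by linarith, by linarith⟩))
  | succ n ih =>
    rw [cutFamily_apply h0 h1 (measurableSet_lt measurable_const (by fun_prop))]
    refine Finset.sum_eq_zero fun i hi => mul_eq_zero_of_right _ ?_
    refine measure_mono_null (fun z hz => ?_) (ih (R_mem h0 h1).1 (R_mem h0 h1).2)
    rw [mem_preimage, mem_ofPred_eq, Flam_singleton_snd h0 h1 hi, abs_div,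
      abs_of_pos (show (0 : ℝ) < 3 ^ mOne lam by positivity),
      lt_div_iff₀ (show (0 : ℝ) < 3 ^ mOne lam by positivity)] at hz
    rw [mem_ofPred_eq]
    refine lt_of_le_of_lt ?_ hz
    have h3 : (3 : ℝ) ^ 1 ≤ 3 ^ mOne lam :=
      pow_le_pow_right₀ (by norm_num) (mOne_pos h0 h1)
    have hp : (0 : ℝ) < (1 / 3) ^ n := by positivity
    rw [pow_succ]
    nlinarith

theorem cutFamily_compl_cut (h0 : 0 < lam) (h1 : lam ≤ 1) : cutFamily lam (cut lam)ᶜ = 0 := by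
  have hsub : (cut lam)ᶜ ⊆ gasketᶜ ∪ ⋃ n : ℕ, {z | (1 / 3 : ℝ) ^ n < |z.2 - (1 - lam)|} := by
    intro z hz
    by_cases hg : z ∈ gasket
    · have hpos : 0 < |z.2 - (1 - lam)| :=
        abs_pos.2 fun h => hz ⟨hg, sub_eq_zero.1 h⟩
      obtain ⟨n, hn⟩ := exists_pow_lt_of_lt_one hpos (by norm_num : (1 / 3 : ℝ) < 1)
      exact Or.inr (mem_iUnion.2 ⟨n, hn⟩)
    · exact Or.inl hg
  refine measure_mono_null hsub (measure_union_null (cutFamily_compl_gasket h0 h1) ?_)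
  exact measure_iUnion_null fun n => cutFamily_far n h0 h1

/-- The boundary measures do not charge the corners of the gasket. -/
theorem cutFamily_corner (h0 : 0 < lam) (h1 : lam ≤ 1) (k : Fin 3) :
    cutFamily lam {q k} = 0 := by
  by_cases hk : q k ∈ cut lam
  swap
  · exact measure_mono_null (singleton_subset_iff.2 hk) (cutFamily_compl_cut h0 h1)
  have hk0 : k ≠ 0 := by
    rintro rfl
    exact q_zero_notMem_cut h0 hk
  have h2 := hk.2
  rw [q_snd, if_neg hk0] at h2
  obtain rfl : lam = 1 := by linarith
  have hR : R 1 = 1 := by rw [R_of_high (by norm_num) le_rfl]; norm_num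
  have hp := isProbabilityMeasure_cutFamily h0 h1
  -- the mass of the corner is multiplied by a weight less than one
  have hle : cutFamily 1 {q k} ≤
      ENNReal.ofReal (cutWeight 1 (k.castLE (by norm_num))) * cutFamily 1 {q k} := by
    conv_lhs => rw [cutFamily_apply h0 h1 (measurableSet_singleton _), hR]
    have hz : ∀ i ∈ letters 1, i ≠ k.castLE (by norm_num) →
        ENNReal.ofReal (cutWeight 1 i) * cutFamily 1 (Flam 1 [i] ⁻¹' {q k}) = 0 := by
      intro i hi hik
      refine mul_eq_zero_of_right _ (measure_mono_null (t := gasketᶜ) (fun z hz hg => ?_)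
        (cutFamily_compl_gasket h0 h1))
      rw [mem_preimage, mem_singleton_iff, Flam_singleton_of_gt (by norm_num) h1] at hz
      have e := bary_F i z k
      rw [hz, bary_q, if_pos rfl] at e
      have n0 := bary_nonneg hg 0
      have n1 := bary_nonneg hg 1
      have n2 := bary_nonneg hg 2
      have ns := bary_sum z
      fin_cases k <;> fin_cases i <;> simp [baryShift] at hk0 hik e <;> linarith
    have hmem : k.castLE (by norm_num) ∈ letters 1 := by
      rw [letters_of_high (by norm_num) h1]
      fin_cases k <;> simp at hk0 ⊢
    rw [Finset.sum_eq_single_of_mem _ hmem hz]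
    gcongr
    intro z hz
    rw [mem_preimage, mem_singleton_iff, Flam_singleton_of_gt (by norm_num) h1] at hz
    exact F_injective _ (hz.trans (F_q k).symm)
  by_contra hne
  have hlt : ENNReal.ofReal (cutWeight 1 (k.castLE (by norm_num))) < 1 := by
    rw [ENNReal.ofReal_lt_one]
    exact cutWeight_lt_one h0 h1 _
  have := ENNReal.mul_lt_mul_left hne (measure_ne_top _ _) hlt
  rw [one_mul] at this
  exact absurd hle (not_le.2 this)

theorem ae_mem_gasket (h0 : 0 < lam) (h1 : lam ≤ 1) : ∀ᵐ z ∂(cutFamily lam), z ∈ gasket := by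
  rw [ae_iff]
  exact cutFamily_compl_gasket h0 h1

theorem cutFamily_cutCell (h0 : 0 < lam) (h1 : lam ≤ 1) (w : List (Fin 6))
    (hw : IsAdmissible lam w) :
    cutFamily lam (cutCell lam w) = ENNReal.ofReal (cutWordWeight lam w) := by
  induction w generalizing lam with
  | nil =>
    have := isProbabilityMeasure_cutFamily h0 h1
    have e : cutCell lam [] = cut lam := by
      simp only [cutCell, Flam, image_id]
      exact inter_eq_right.2 fun z hz => hz.1
    rw [e, cutWordWeight, ENNReal.ofReal_one]
    exact (prob_compl_eq_zero_iff (isClosed_cut lam).measurableSet).1 (cutFamily_compl_cut h0 h1)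
  | cons i w ih =>
    have hR := R_mem h0 h1
    have e1 : cutFamily (R lam) (Flam lam [i] ⁻¹' cutCell lam (i :: w)) =
        cutFamily (R lam) (cutCell (R lam) w) := by
      refine measure_congr ?_
      filter_upwards [ae_mem_gasket hR.1 hR.2] with z hz
      refine propext ⟨?_, ?_⟩
      · rintro ⟨⟨y, hy, hyz⟩, hc⟩
        exact ⟨⟨y, hy, Flam_injective lam [i] hyz⟩,
          (Flam_singleton_mem_cut h0 h1 hw.1 hz).1 hc⟩
      · rintro ⟨⟨y, hy, rfl⟩, hc⟩
        exact ⟨⟨y, hy, rfl⟩, (Flam_singleton_mem_cut h0 h1 hw.1 hz).2 hc⟩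
    have e2 : ∀ j ∈ letters lam, j ≠ i → ENNReal.ofReal (cutWeight lam j) *
        cutFamily (R lam) (Flam lam [j] ⁻¹' cutCell lam (i :: w)) = 0 := by
      intro j _ hji
      refine mul_eq_zero_of_right _ (measure_mono_null (t := gasketᶜ ∪ ⋃ k, {q k}) ?_ ?_)
      · rintro z ⟨⟨y, hy, hyz⟩, -⟩
        by_cases hz : z ∈ gasket
        · obtain ⟨k, hk⟩ := corner_of_Flam_eq lam hji hz (Flam_mem_gasket (R lam) w hy) hyz.symm
          exact Or.inr (mem_iUnion.2 ⟨k, hk⟩)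
        · exact Or.inl hz
      · exact measure_union_null (cutFamily_compl_gasket hR.1 hR.2)
          (measure_iUnion_null fun k => cutFamily_corner hR.1 hR.2 k)
    rw [cutFamily_apply h0 h1 (isClosed_cutCell _ _).measurableSet,
      Finset.sum_eq_single_of_mem i hw.1 e2, e1, ih hR.1 hR.2 hw.2, cutWordWeight,
      ENNReal.ofReal_mul (cutWeight_pos h0 h1 i).le]

/-- Integrals of continuous functions are approximated by the weights of the cells `X_w`: the cells
of one level cover the cut, and their masses sum to `1`, so they overlap in null sets only. -/
theorem abs_integral_sub_sum_le (h0 : 0 < lam) (h1 : lam ≤ 1) {μ : Measure Plane}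
    [IsProbabilityMeasure μ] (hμ : μ (cut lam)ᶜ = 0)
    (hcell : ∀ w, IsAdmissible lam w →
      μ (cutCell lam w) = ENNReal.ofReal (cutWordWeight lam w))
    {T : Finset (List (Fin 6))} (hT : ∀ w ∈ T, IsAdmissible lam w)
    (hsum : ∑ w ∈ T, cutWordWeight lam w = 1) (hcov : ∀ z ∈ cut lam, ∃ w ∈ T, z ∈ cutCell lam w)
    {f : Plane → ℝ} (hf : Integrable f μ) {ε : ℝ}
    (hε : ∀ w ∈ T, ∀ z ∈ gasket, |f (Flam lam w z) - f (Flam lam w (q 1))| ≤ ε) :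
    |∫ z, f z ∂μ - ∑ w ∈ T, cutWordWeight lam w * f (Flam lam w (q 1))| ≤ ε := by
  have hms : ∀ w, MeasurableSet (cutCell lam w) := fun w => (isClosed_cutCell lam w).measurableSet
  have hreal : ∀ w ∈ T, μ.real (cutCell lam w) = cutWordWeight lam w := fun w hw => by
    rw [Measure.real, hcell w (hT w hw), ENNReal.toReal_ofReal (cutWordWeight_pos h0 h1 w).le]
  have hind : ∀ w, Integrable ((cutCell lam w).indicator fun _ => (1 : ℝ)) μ := fun w =>
    (integrable_const 1).indicator (hms w)
  have hcut : ∀ᵐ z ∂μ, z ∈ cut lam := by rw [ae_iff]; exact hμ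
  have hone : ∀ᵐ z ∂μ, ∑ w ∈ T, (cutCell lam w).indicator (fun _ => (1 : ℝ)) z - 1 = 0 := by
    refine (integral_eq_zero_iff_of_nonneg_ae ?_
      ((integrable_finsetSum T fun w _ => hind w).sub (integrable_const 1))).1 ?_
    · filter_upwards [hcut] with z hz
      obtain ⟨w, hw, hzw⟩ := hcov z hz
      have := Finset.single_le_sum
        (f := fun w => (cutCell lam w).indicator (fun _ => (1 : ℝ)) z)
        (fun w _ => indicator_nonneg (fun _ _ => zero_le_one) z) hw
      simp only [indicator_of_mem hzw] at this
      simpa using this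
    · simp only [Pi.sub_apply]
      rw [integral_sub (integrable_finsetSum T fun w _ => hind w) (integrable_const 1),
        integral_finsetSum T fun w _ => hind w]
      simp only [integral_indicator (hms _), integral_const, smul_eq_mul, mul_one]
      simp only [measureReal_restrict_apply MeasurableSet.univ, univ_inter]
      rw [Finset.sum_congr rfl hreal, hsum]
      simp
  have e : ∫ z, f z ∂μ = ∑ w ∈ T, ∫ z in cutCell lam w, f z ∂μ := by
    simp only [← integral_indicator (hms _)]
    rw [← integral_finsetSum T fun w _ => hf.indicator (hms w)]
    refine integral_congr_ae ?_
    filter_upwards [hone] with z hz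
    have : ∀ w, (cutCell lam w).indicator f z =
        (cutCell lam w).indicator (fun _ => (1 : ℝ)) z * f z := fun w => by
      by_cases h : z ∈ cutCell lam w <;> simp [h]
    simp only [this]
    rw [← Finset.sum_mul, sub_eq_zero.1 hz, one_mul]
  rw [e, ← Finset.sum_sub_distrib]
  refine (Finset.abs_sum_le_sum_abs _ _).trans ?_
  have e' : ε = ∑ w ∈ T, cutWordWeight lam w * ε := by rw [← Finset.sum_mul, hsum, one_mul]
  rw [e']
  refine Finset.sum_le_sum fun w hw => ?_
  have e2 : ∫ z in cutCell lam w, f z ∂μ - cutWordWeight lam w * f (Flam lam w (q 1)) =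
      ∫ z in cutCell lam w, (f z - f (Flam lam w (q 1))) ∂μ := by
    rw [integral_sub hf.integrableOn (integrable_const _), setIntegral_const, hreal w hw,
      smul_eq_mul]
  rw [e2, ← hreal w hw, mul_comm, ← Real.norm_eq_abs]
  refine norm_setIntegral_le_of_norm_le_const (measure_lt_top _ _) ?_
  rintro _ ⟨⟨z, hz, rfl⟩, -⟩
  exact hε w hw z hz

/-- A measure on the cut is determined by the masses of the cells `X_w`. -/
theorem eq_cutFamily (h0 : 0 < lam) (h1 : lam ≤ 1) {μ : Measure Plane}
    [IsProbabilityMeasure μ] (hμ : μ (cut lam)ᶜ = 0)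
    (hcell : ∀ w, IsAdmissible lam w →
      μ (cutCell lam w) = ENNReal.ofReal (cutWordWeight lam w)) : μ = cutFamily lam := by
  have := isProbabilityMeasure_cutFamily h0 h1
  refine ext_of_forall_integral_eq_of_IsFiniteMeasure fun f => ?_
  refine eq_of_abs_sub_le_all fun ε hε => ?_
  obtain ⟨δ, hδ, hd⟩ := Metric.uniformContinuousOn_iff.1
    (gasket_isCompact.uniformContinuousOn_of_continuous f.continuous.continuousOn) (ε / 2)
    (by positivity)
  obtain ⟨n, hn⟩ := exists_pow_lt_of_lt_one (show 0 < δ / 2 by positivity)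
    (by norm_num : (1 / 3 : ℝ) < 1)
  obtain ⟨T, hT, hsum, hcov⟩ := exists_cutCell_cover n h0 h1
  have hosc : ∀ w ∈ T, ∀ z ∈ gasket, |f (Flam lam w z) - f (Flam lam w (q 1))| ≤ ε / 2 := by
    intro w hw z hz
    refine (hd _ (Flam_mem_gasket _ _ hz) _ (Flam_mem_gasket _ _ (q_mem_gasket 1)) ?_).le
    refine (dist_Flam_le h0 h1 w _ _).trans_lt ?_
    have e1 := dist_gasket_le hz (q_mem_gasket 1)
    have e2 : dist z (q 1) / 3 ^ n = dist z (q 1) * (1 / 3) ^ n := by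
      rw [one_div, inv_pow]; rfl
    rw [(hT w hw).2, e2]
    calc dist z (q 1) * (1 / 3) ^ n ≤ 2 * (1 / 3) ^ n := by gcongr
      _ < δ := by linarith
  have a1 := abs_integral_sub_sum_le h0 h1 hμ hcell (fun w hw => (hT w hw).1) hsum hcov
    (f.integrable μ) hosc
  have a2 := abs_integral_sub_sum_le h0 h1 (cutFamily_compl_cut h0 h1) (cutFamily_cutCell h0 h1)
    (fun w hw => (hT w hw).1) hsum hcov (f.integrable (cutFamily lam)) hosc
  rw [abs_le] at *
  constructor <;> linarith [a1.1, a1.2, a2.1, a2.2]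

end

/-! ### The values at the crucial points -/

/-- The value at `p 4` when the first digit is `1`, in terms of the value `c` at the top and the
means `I`, `J` of the data over the part of the cut below `p 4` and below `p 5`. -/
noncomputable def valOne (e c I J : ℝ) : ℝ :=
  1 / (1 + e) * c + (2 * e + e ^ 2) / (3 + 4 * e + e ^ 2) * I + e / (3 + 4 * e + e ^ 2) * J

/-- The value at `p 1` when the first digit is `2`; `I`, `J`, `K` are the means of the data over
the parts of the cut below `p 1`, `p 2`, `p 3`. -/
noncomputable def valSide (e c I J K : ℝ) : ℝ :=
  1 / (54 + 165 * e + 102 * e ^ 2 + 15 * e ^ 3) *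
    ((54 + 39 * e + 5 * e ^ 2) * c + (60 * e + 76 * e ^ 2 + 15 * e ^ 3) * I
      + (30 * e + e ^ 2) * J + (36 * e + 20 * e ^ 2) * K)

/-- The value at `p 3` when the first digit is `2`. -/
noncomputable def valCenter (e c I J K : ℝ) : ℝ :=
  (6 + 2 * e) / (6 + 15 * e + 3 * e ^ 2) * c + (5 * e + 3 * e ^ 2) / (6 + 15 * e + 3 * e ^ 2) * K
    + 4 * e / (6 + 15 * e + 3 * e ^ 2) * (I + J)

/-- The value at `p 4` when the first digit is `2`. -/
noncomputable def valUpper (e c I J K : ℝ) : ℝ :=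
  1 / (54 + 165 * e + 102 * e ^ 2 + 15 * e ^ 3) *
    ((54 + 84 * e + 39 * e ^ 2 + 5 * e ^ 3) * c + (24 * e + 12 * e ^ 2 + e ^ 3) * I
      + (30 * e + 27 * e ^ 2 + 4 * e ^ 3) * J + (27 * e + 24 * e ^ 2 + 5 * e ^ 3) * K)

/-- `v` is a convex combination of `c, x, y, z` in which `c` has weight at most `2 / 3`. -/
def IsMix (v c x y z : ℝ) : Prop :=
  ∃ α β γ δ : ℝ, 0 ≤ α ∧ α ≤ 2 / 3 ∧ 0 ≤ β ∧ 0 ≤ γ ∧ 0 ≤ δ ∧ α + β + γ + δ = 1 ∧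
    v = α * c + β * x + γ * y + δ * z

theorem IsMix.mem_Icc {v c x y z a b : ℝ} (h : IsMix v c x y z) (hc : c ∈ Icc a b)
    (hx : x ∈ Icc a b) (hy : y ∈ Icc a b) (hz : z ∈ Icc a b) : v ∈ Icc a b := by
  obtain ⟨α, β, γ, δ, h1, -, h2, h3, h4, h5, rfl⟩ := h
  have ea : a = α * a + β * a + γ * a + δ * a := by
    rw [← add_mul, ← add_mul, ← add_mul, h5, one_mul]
  have eb : b = α * b + β * b + γ * b + δ * b := by
    rw [← add_mul, ← add_mul, ← add_mul, h5, one_mul]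
  constructor
  · rw [ea]
    gcongr
    exacts [hc.1, hx.1, hy.1, hz.1]
  · rw [eb]
    gcongr
    exacts [hc.2, hx.2, hy.2, hz.2]

theorem IsMix.abs_sub_le {v c x y z t M O : ℝ} (h : IsMix v c x y z) (hO : 0 ≤ O) (hM : |c - t| ≤ M)
    (hx : |x - t| ≤ O) (hy : |y - t| ≤ O) (hz : |z - t| ≤ O) : |v - t| ≤ 2 / 3 * M + O := by
  obtain ⟨α, β, γ, δ, h1, h1', h2, h3, h4, h5, rfl⟩ := h
  have e : α * c + β * x + γ * y + δ * z - t =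
      α * (c - t) + β * (x - t) + γ * (y - t) + δ * (z - t) := by
    linear_combination t * h5
  have hM0 : 0 ≤ M := (abs_nonneg _).trans hM
  have b1 : |α * (c - t)| ≤ 2 / 3 * M := by
    rw [abs_mul, abs_of_nonneg h1]; gcongr
  have b2 : |β * (x - t)| ≤ β * O := by rw [abs_mul, abs_of_nonneg h2]; gcongr
  have b3 : |γ * (y - t)| ≤ γ * O := by rw [abs_mul, abs_of_nonneg h3]; gcongr
  have b4 : |δ * (z - t)| ≤ δ * O := by rw [abs_mul, abs_of_nonneg h4]; gcongr
  have b5 : β * O + γ * O + δ * O ≤ O := by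
    rw [← add_mul, ← add_mul]
    exact mul_le_of_le_one_left hO (by linarith)
  rw [e]
  have t1 := abs_add_le (α * (c - t) + β * (x - t) + γ * (y - t)) (δ * (z - t))
  have t2 := abs_add_le (α * (c - t) + β * (x - t)) (γ * (y - t))
  have t3 := abs_add_le (α * (c - t)) (β * (x - t))
  linarith

theorem isMix_valOne {e : ℝ} (he : 1 ≤ e) (c I J : ℝ) : IsMix (valOne e c I J) c I J J := by
  refine ⟨1 / (1 + e), (2 * e + e ^ 2) / (3 + 4 * e + e ^ 2), e / (3 + 4 * e + e ^ 2), 0,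
    by positivity, ?_, by positivity, by positivity, le_rfl, ?_, by unfold valOne; ring⟩
  · rw [div_le_iff₀ (by positivity)]; linarith
  · have : 3 + 4 * e + e ^ 2 = (1 + e) * (3 + e) := by ring
    rw [this]
    field_simp
    ring

theorem isMix_valSide {e : ℝ} (he : 1 ≤ e) (c I J K : ℝ) :
    IsMix (valSide e c I J K) c I J K := by
  refine ⟨(54 + 39 * e + 5 * e ^ 2) / (54 + 165 * e + 102 * e ^ 2 + 15 * e ^ 3),
    (60 * e + 76 * e ^ 2 + 15 * e ^ 3) / (54 + 165 * e + 102 * e ^ 2 + 15 * e ^ 3),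
    (30 * e + e ^ 2) / (54 + 165 * e + 102 * e ^ 2 + 15 * e ^ 3),
    (36 * e + 20 * e ^ 2) / (54 + 165 * e + 102 * e ^ 2 + 15 * e ^ 3),
    by positivity, ?_, by positivity, by positivity, by positivity, ?_, ?_⟩
  · rw [div_le_iff₀ (by positivity)]
    nlinarith [pow_pos (one_pos.trans_le he) 3]
  · field_simp
    ring
  · unfold valSide
    field_simp

theorem isMix_valCenter {e : ℝ} (he : 1 ≤ e) (c I J K : ℝ) :
    IsMix (valCenter e c I J K) c I J K := by
  refine ⟨(6 + 2 * e) / (6 + 15 * e + 3 * e ^ 2), 4 * e / (6 + 15 * e + 3 * e ^ 2),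
    4 * e / (6 + 15 * e + 3 * e ^ 2), (5 * e + 3 * e ^ 2) / (6 + 15 * e + 3 * e ^ 2),
    by positivity, ?_, by positivity, by positivity, by positivity, ?_, ?_⟩
  · rw [div_le_iff₀ (by positivity)]
    nlinarith
  · field_simp
    ring
  · unfold valCenter
    ring

theorem isMix_valUpper {e : ℝ} (he : 1 ≤ e) (c I J K : ℝ) :
    IsMix (valUpper e c I J K) c I J K := by
  refine ⟨(54 + 84 * e + 39 * e ^ 2 + 5 * e ^ 3) / (54 + 165 * e + 102 * e ^ 2 + 15 * e ^ 3),
    (24 * e + 12 * e ^ 2 + e ^ 3) / (54 + 165 * e + 102 * e ^ 2 + 15 * e ^ 3),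
    (30 * e + 27 * e ^ 2 + 4 * e ^ 3) / (54 + 165 * e + 102 * e ^ 2 + 15 * e ^ 3),
    (27 * e + 24 * e ^ 2 + 5 * e ^ 3) / (54 + 165 * e + 102 * e ^ 2 + 15 * e ^ 3),
    by positivity, ?_, by positivity, by positivity, by positivity, ?_, ?_⟩
  · rw [div_le_iff₀ (by positivity)]
    nlinarith [pow_pos (one_pos.trans_le he) 3]
  · field_simp
    ring
  · unfold valUpper
    field_simp

/-! ### Cellwise prescription of functions on the gasket -/

/-- `F i` as a bundled continuous map. -/
noncomputable def FMap (i : Fin 6) : C(Plane, Plane) := ⟨F i, F_continuous i⟩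

/-- The mean of `f` over the cut `X_lam`. -/
noncomputable def cutMean (lam : ℝ) (f : C(Plane, ℝ)) : ℝ := ∫ z, f z ∂(cutFamily lam)

/-- Prescriptions of a function on the gasket: the harmonic function with given corner values, a
given continuous function, or the function which solves the Dirichlet problem on `Ω_lam` with value
`c` at `q 0` and data `f` on the cut, and agrees with `f` below the cut. -/
inductive Prescription
  | harm (a : Fin 3 → ℝ)
  | fn (f : C(Plane, ℝ))
  | dir (lam : ℝ) (f : C(Plane, ℝ)) (c : ℝ)

namespace Prescription

/-- The prescribed values at the corners. -/
noncomputable def corner : Prescription → Fin 3 → ℝ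
  | harm a, k => a k
  | fn f, k => f (q k)
  | dir _ f c, k => if k = 0 then c else f (q k)

/-- The prescribed values at the ten vertices of the first subdivision. -/
noncomputable def val : Prescription → Fin 10 → ℝ
  | harm a => harmExt a
  | fn f => fun n => f (pt n)
  | dir lam f c =>
      if lam ≤ 1 / 3 then fun n => if n = 0 then c else f (pt n)
      else if lam ≤ 2 / 3 then
        let e := conductance (3 * lam - 1)
        let I := fun i => cutMean (3 * lam - 1) (f.comp (FMap i))
        ![c, f (pt 1), f (pt 2), valOne e c (I 5) (I 4), valOne e c (I 4) (I 5),
          f (pt 5), f (pt 6), f (pt 7), f (pt 8), f (pt 9)]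
      else
        let e := conductance (3 * lam - 2)
        let I := fun i => cutMean (3 * lam - 2) (f.comp (FMap i))
        ![c, f (pt 1), f (pt 2), valUpper e c (I 2) (I 1) (I 3), valUpper e c (I 1) (I 2) (I 3),
          valSide e c (I 1) (I 2) (I 3), valSide e c (I 2) (I 1) (I 3), f (pt 7), f (pt 8),
          valCenter e c (I 1) (I 2) (I 3)]

/-- The prescription for `u ∘ F i`, given the prescription for `u`. -/
noncomputable def child : Prescription → Fin 6 → Prescription
  | harm a, i => harm (harmExt a ∘ node i)
  | fn f, i => fn (f.comp (FMap i))
  | dir lam f c, i =>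
      if lam ≤ 1 / 3 then
        if i = 0 then dir (3 * lam) (f.comp (FMap i)) c else fn (f.comp (FMap i))
      else if lam ≤ 2 / 3 then
        if i = 0 then harm (val (dir lam f c) ∘ node i)
        else if i = 4 ∨ i = 5 then
          dir (3 * lam - 1) (f.comp (FMap i)) (val (dir lam f c) (node i 0))
        else fn (f.comp (FMap i))
      else if i = 1 ∨ i = 2 ∨ i = 3 then
        dir (3 * lam - 2) (f.comp (FMap i)) (val (dir lam f c) (node i 0))
      else harm (val (dir lam f c) ∘ node i)

/-- The parameter of a Dirichlet problem has to lie in `(0, 1]`. -/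
def Valid : Prescription → Prop
  | dir lam _ _ => 0 < lam ∧ lam ≤ 1
  | _ => True

/-- All prescribed data lie in `[a, b]`. -/
def InRange (a b : ℝ) : Prescription → Prop
  | harm v => ∀ k, v k ∈ Icc a b
  | fn f => ∀ z ∈ gasket, f z ∈ Icc a b
  | dir _ f c => c ∈ Icc a b ∧ ∀ z ∈ gasket, f z ∈ Icc a b

theorem corner_child (s : Prescription) (i : Fin 6) (k : Fin 3) :
    (s.child i).corner k = s.val (node i k) := by
  cases s with
  | harm a => rfl
  | fn f => simp only [child, corner, val, ← F_q_eq_pt]; rfl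
  | dir lam f c =>
    have hf : f (F i (q k)) = f (pt (node i k)) := by rw [F_q_eq_pt]
    rcases le_or_gt lam (1 / 3) with h | h
    · simp only [child, val, if_pos h]
      fin_cases i <;> fin_cases k <;> first | rfl | exact hf
    rcases le_or_gt lam (2 / 3) with h' | h'
    · simp only [child, val, if_neg (not_le.2 h), if_pos h']
      fin_cases i <;> fin_cases k <;> first | rfl | exact hf
    · simp only [child, val, if_neg (not_le.2 h), if_neg (not_le.2 h')]
      fin_cases i <;> fin_cases k <;> first | rfl | exact hf

theorem val_corner (s : Prescription) (k : Fin 3) :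
    s.val (k.castLE (by norm_num)) = s.corner k := by
  cases s with
  | harm a => fin_cases k <;> rfl
  | fn f => simp only [corner, val, pt_corner]
  | dir lam f c =>
    have hf : f (pt (k.castLE (by norm_num))) = f (q k) := by rw [pt_corner]
    rcases le_or_gt lam (1 / 3) with h | h
    · simp only [val, if_pos h]
      fin_cases k <;> first | rfl | exact hf
    rcases le_or_gt lam (2 / 3) with h' | h'
    · simp only [val, if_neg (not_le.2 h), if_pos h']
      fin_cases k <;> first | rfl | exact hf
    · simp only [val, if_neg (not_le.2 h), if_neg (not_le.2 h')]
      fin_cases k <;> first | rfl | exact hf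

theorem corner_child_self (s : Prescription) (k : Fin 3) :
    (s.child (k.castLE (by norm_num))).corner k = s.corner k := by
  rw [corner_child, ← val_corner]
  congr 1
  fin_cases k <;> rfl

theorem Valid.child {s : Prescription} (hs : s.Valid) (i : Fin 6) : (s.child i).Valid := by
  cases s with
  | harm a => trivial
  | fn f => trivial
  | dir lam f c =>
    obtain ⟨h0, h1⟩ := hs
    simp only [Prescription.child]
    split_ifs <;> first | trivial | (constructor <;> linarith)

/-- `x` lies between any two bounds of `f` on the gasket. -/
def IsIntermediate (f : C(Plane, ℝ)) (x : ℝ) : Prop :=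
  ∀ a b, (∀ z ∈ gasket, f z ∈ Icc a b) → x ∈ Icc a b

theorem isIntermediate_cutMean {lam : ℝ} (h0 : 0 < lam) (h1 : lam ≤ 1) (f : C(Plane, ℝ))
    (i : Fin 6) : IsIntermediate f (cutMean lam (f.comp (FMap i))) := by
  intro a b h
  have := isProbabilityMeasure_cutFamily h0 h1
  have hae : ∀ᵐ z ∂(cutFamily lam), f (F i z) ∈ Icc a b := by
    filter_upwards [ae_mem_gasket h0 h1] with z hz using h _ (F_mem_gasket i hz)
  have hint : Integrable (fun z => f (F i z)) (cutFamily lam) := by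
    refine Integrable.of_bound
      (f.continuous.comp (F_continuous i)).aestronglyMeasurable (max |a| |b|) ?_
    filter_upwards [hae] with z hz
    exact abs_le_max_abs_abs hz.1 hz.2
  have ha := integral_mono_ae (integrable_const a) hint (hae.mono fun z hz => hz.1)
  have hb := integral_mono_ae hint (integrable_const b) (hae.mono fun z hz => hz.2)
  simp only [integral_const, probReal_univ, one_smul] at ha hb
  exact ⟨ha, hb⟩

/-- The values prescribed by a Dirichlet problem with first exponent `1`. -/
theorem val_dir_cases {lam : ℝ} (h : 1 / 3 < lam) (h1 : lam ≤ 1) (f : C(Plane, ℝ)) (c : ℝ)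
    (n : Fin 10) : (dir lam f c).val n = c ∨ (dir lam f c).val n = f (pt n) ∨
      ∃ x y z, IsIntermediate f x ∧ IsIntermediate f y ∧ IsIntermediate f z ∧
        IsMix ((dir lam f c).val n) c x y z := by
  rcases le_or_gt lam (2 / 3) with h' | h'
  · have he := one_le_conductance (lam := 3 * lam - 1) (by linarith) (by linarith)
    have hI := isIntermediate_cutMean (lam := 3 * lam - 1) (by linarith) (by linarith) f
    fin_cases n <;> simp only [val, if_neg (not_le.2 h), if_pos h'] <;>
      first
      | exact Or.inl rfl
      | exact Or.inr (Or.inl rfl)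
      | exact Or.inr (Or.inr ⟨_, _, _, hI _, hI _, hI _, isMix_valOne he _ _ _⟩)
  · have he := one_le_conductance (lam := 3 * lam - 2) (by linarith) (by linarith)
    have hI := isIntermediate_cutMean (lam := 3 * lam - 2) (by linarith) (by linarith) f
    fin_cases n <;> simp only [val, if_neg (not_le.2 h), if_neg (not_le.2 h')] <;>
      first
      | exact Or.inl rfl
      | exact Or.inr (Or.inl rfl)
      | exact Or.inr (Or.inr ⟨_, _, _, hI _, hI _, hI _, isMix_valSide he _ _ _ _⟩)
      | exact Or.inr (Or.inr ⟨_, _, _, hI _, hI _, hI _, isMix_valCenter he _ _ _ _⟩)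
      | exact Or.inr (Or.inr ⟨_, _, _, hI _, hI _, hI _, isMix_valUpper he _ _ _ _⟩)

theorem pt_mem_gasket (n : Fin 10) : pt n ∈ gasket := by
  have : ∃ i k, node i k = n := by revert n; decide
  obtain ⟨i, k, rfl⟩ := this
  rw [← F_q_eq_pt]
  exact F_mem_gasket i (q_mem_gasket k)

theorem InRange.val {s : Prescription} (hs : s.Valid) {a b : ℝ} (h : s.InRange a b)
    (n : Fin 10) : s.val n ∈ Icc a b := by
  cases s with
  | harm v =>
    have h0 := h 0
    have h1 := h 1
    have h2 := h 2
    rw [mem_Icc] at h0 h1 h2 ⊢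
    fin_cases n <;> simp [Prescription.val, harmExt] <;> constructor <;> linarith
  | fn f => exact h _ (pt_mem_gasket n)
  | dir lam f c =>
    rcases le_or_gt lam (1 / 3) with h' | h'
    · simp only [Prescription.val, if_pos h']
      split_ifs
      · exact h.1
      · exact h.2 _ (pt_mem_gasket n)
    · rcases val_dir_cases h' hs.2 f c n with e | e | ⟨x, y, z, hx, hy, hz, e⟩
      · rw [e]; exact h.1
      · rw [e]; exact h.2 _ (pt_mem_gasket n)
      · exact e.mem_Icc h.1 (hx a b h.2) (hy a b h.2) (hz a b h.2)

theorem InRange.child {s : Prescription} (hs : s.Valid) {a b : ℝ} (h : s.InRange a b)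
    (i : Fin 6) : (s.child i).InRange a b := by
  have hv := h.val hs
  cases s with
  | harm v => exact fun k => hv _
  | fn f => exact fun z hz => h _ (F_mem_gasket i hz)
  | dir lam f c =>
    have hf : ∀ z ∈ gasket, (f.comp (FMap i)) z ∈ Icc a b := fun z hz => h.2 _ (F_mem_gasket i hz)
    simp only [Prescription.child]
    split_ifs
    exacts [⟨h.1, hf⟩, hf, fun k => hv _, ⟨hv _, hf⟩, hf, ⟨hv _, hf⟩, fun k => hv _]

theorem InRange.corner {s : Prescription} (hs : s.Valid) {a b : ℝ} (h : s.InRange a b)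
    (k : Fin 3) : s.corner k ∈ Icc a b := by
  rw [← val_corner]
  exact h.val hs _

/-! ### Realization of a prescription as a uniform limit -/

/-- The approximation of depth `n`: affine on the cells of level `n`. -/
noncomputable def approx : ℕ → Prescription → Plane → ℝ
  | 0, s => fun z => ∑ k, s.corner k * bary z k
  | n + 1, s => glue fun i => approx n (s.child i)

/-- The approximations attain the prescribed corner values; hence the functions on neighbouring
cells agree at shared corners, and the gluing in `approx` is consistent. -/
theorem approx_corner (n : ℕ) (s : Prescription) (k : Fin 3) :
    approx n s (q k) = s.corner k ∧
      ∀ i j k l, F i (q k) = F j (q l) →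
        approx n (s.child i) (q k) = approx n (s.child j) (q l) := by
  suffices h : ∀ s k, approx n s (q k) = s.corner k from
    ⟨h s k, fun i j k l e => by rw [h, h, corner_child, corner_child, node_eq_of_F_eq e]⟩
  induction n with
  | zero => intro s k; simp [approx, bary_q]
  | succ n ih =>
    intro s k
    have := glue_F (φ := fun i => approx n (s.child i))
      (fun i j k l e => by rw [ih, ih, corner_child, corner_child, node_eq_of_F_eq e])
      (k.castLE (by norm_num)) (q_mem_gasket k)
    rw [F_q, ih, corner_child_self] at this
    exact this

theorem approx_succ_F (n : ℕ) (s : Prescription) (i : Fin 6) {z : Plane} (hz : z ∈ gasket) :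
    approx (n + 1) s (F i z) = approx n (s.child i) z :=
  glue_F (φ := fun i => approx n (s.child i)) (approx_corner n s 0).2 i hz

theorem approx_continuousOn (n : ℕ) (s : Prescription) : ContinuousOn (approx n s) gasket := by
  induction n generalizing s with
  | zero =>
    exact (continuous_finsetSum _ fun k _ =>
      continuous_const.mul (bary_continuous k)).continuousOn
  | succ n ih => exact glue_continuousOn (fun i => ih _) (approx_corner n s 0).2

theorem approx_mem_Icc (n : ℕ) {s : Prescription} (hs : s.Valid) {a b : ℝ} (h : s.InRange a b)
    {z : Plane} (hz : z ∈ gasket) : approx n s z ∈ Icc a b := by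
  induction n generalizing s z with
  | zero =>
    have hc := fun k => h.corner hs k
    have hn := bary_nonneg hz
    have hsum := bary_sum z
    simp only [approx, Fin.sum_univ_three]
    have ea : a = a * bary z 0 + a * bary z 1 + a * bary z 2 := by
      rw [← mul_add, ← mul_add, hsum, mul_one]
    have eb : b = b * bary z 0 + b * bary z 1 + b * bary z 2 := by
      rw [← mul_add, ← mul_add, hsum, mul_one]
    constructor
    · rw [ea]
      gcongr
      exacts [hn 0, (hc 0).1, hn 1, (hc 1).1, hn 2, (hc 2).1]
    · rw [eb]
      gcongr
      exacts [hn 0, (hc 0).2, hn 1, (hc 1).2, hn 2, (hc 2).2]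
  | succ n ih =>
    obtain ⟨i, y, hy, rfl⟩ := exists_F_of_mem_gasket hz
    rw [approx_succ_F n s i hy]
    exact ih (hs.child i) (h.child hs i) hy

/-- The prescription for `u ∘ F_w`, given the prescription for `u`. -/
noncomputable def descendant : Prescription → List (Fin 6) → Prescription
  | s, [] => s
  | s, i :: w => descendant (s.child i) w

theorem Valid.descendant {s : Prescription} (hs : s.Valid) (w : List (Fin 6)) :
    (s.descendant w).Valid := by
  induction w generalizing s with
  | nil => exact hs
  | cons i w ih => exact ih (hs.child i)

theorem InRange.descendant {s : Prescription} (hs : s.Valid) {a b : ℝ} (h : s.InRange a b)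
    (w : List (Fin 6)) : (s.descendant w).InRange a b := by
  induction w generalizing s with
  | nil => exact h
  | cons i w ih => exact ih (hs.child i) (h.child hs i)

theorem descendant_append (s : Prescription) (w w' : List (Fin 6)) :
    s.descendant (w ++ w') = (s.descendant w).descendant w' := by
  induction w generalizing s with
  | nil => rfl
  | cons i w ih => exact ih _

/-- The data prescribed on each of the cells of level `N` have oscillation at most `ε`. -/
def SmallAt (ε : ℝ) (N : ℕ) (s : Prescription) : Prop :=
  ∀ w : List (Fin 6), w.length = N → ∃ a b, b - a ≤ ε ∧ (s.descendant w).InRange a b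

/-- The data prescribed on sufficiently small cells have oscillation at most `ε`. -/
def Shrinks (ε : ℝ) (s : Prescription) : Prop := ∃ N, SmallAt ε N s

theorem SmallAt.mono {ε : ℝ} {N M : ℕ} (hNM : N ≤ M) {s : Prescription} (hs : s.Valid)
    (h : SmallAt ε N s) : SmallAt ε M s := by
  intro w hw
  obtain ⟨a, b, hab, hr⟩ := h (w.take N) (by simp [hw, hNM])
  refine ⟨a, b, hab, ?_⟩
  rw [← List.take_append_drop N w, descendant_append]
  exact hr.descendant (hs.descendant _) _

theorem Shrinks.of_child {ε : ℝ} {s : Prescription} (hs : s.Valid)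
    (h : ∀ i, Shrinks ε (s.child i)) : Shrinks ε s := by
  choose N hN using h
  refine ⟨Finset.univ.sup N + 1, fun w hw => ?_⟩
  cases w with
  | nil => simp at hw
  | cons i w =>
    exact (hN i).mono (Finset.le_sup (Finset.mem_univ i)) (hs.child i) w (by simpa using hw)

theorem shrinks_of_inRange {ε : ℝ} {s : Prescription} {a b : ℝ} (h : s.InRange a b)
    (hab : b - a ≤ ε) : Shrinks ε s := by
  refine ⟨0, fun w hw => ?_⟩
  rw [List.length_eq_zero_iff.1 hw]
  exact ⟨a, b, hab, h⟩

/-- On each cell, the range of a harmonic function shrinks by the factor `7 / 15`. -/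
theorem harm_child_inRange {v : Fin 3 → ℝ} {a b : ℝ} (h : (harm v).InRange a b) (i : Fin 6) :
    ∃ a' b', b' - a' ≤ 7 / 15 * (b - a) ∧ ((harm v).child i).InRange a' b' := by
  have h0 := h 0
  have h1 := h 1
  have h2 := h 2
  rw [mem_Icc] at h0 h1 h2
  -- on each cell the extension rule has a common part, of total weight at least `8 / 15`
  have key : ∃ t, ∀ k, harmExt v (node i k) ∈ Icc (t + 7 / 15 * a) (t + 7 / 15 * b) := by
    fin_cases i
    · refine ⟨8 / 15 * v 0, fun k => ?_⟩
      fin_cases k <;> simp [harmExt, node] <;> constructor <;> linarith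
    · refine ⟨8 / 15 * v 1, fun k => ?_⟩
      fin_cases k <;> simp [harmExt, node] <;> constructor <;> linarith
    · refine ⟨8 / 15 * v 2, fun k => ?_⟩
      fin_cases k <;> simp [harmExt, node] <;> constructor <;> linarith
    · refine ⟨(2 * v 0 + 3 * v 1 + 3 * v 2) / 15, fun k => ?_⟩
      fin_cases k <;> simp [harmExt, node] <;> constructor <;> linarith
    · refine ⟨(3 * v 0 + 2 * v 1 + 3 * v 2) / 15, fun k => ?_⟩
      fin_cases k <;> simp [harmExt, node] <;> constructor <;> linarith
    · refine ⟨(3 * v 0 + 3 * v 1 + 2 * v 2) / 15, fun k => ?_⟩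
      fin_cases k <;> simp [harmExt, node] <;> constructor <;> linarith
  obtain ⟨t, ht⟩ := key
  exact ⟨_, _, by linarith, ht⟩

theorem shrinks_harm {ε : ℝ} (hε : 0 < ε) (v : Fin 3 → ℝ) : Shrinks ε (harm v) := by
  have key : ∀ (N : ℕ) (v : Fin 3 → ℝ) (a b : ℝ), (harm v).InRange a b →
      (7 / 15) ^ N * (b - a) ≤ ε → Shrinks ε (harm v) := by
    intro N
    induction N with
    | zero => exact fun v a b h hN => shrinks_of_inRange h (by simpa using hN)
    | succ N ih =>
      intro v a b h hN
      refine Shrinks.of_child trivial fun i => ?_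
      obtain ⟨a', b', hab, h'⟩ := harm_child_inRange h i
      refine ih _ a' b' h' (le_trans ?_ hN)
      rw [pow_succ, mul_assoc]
      gcongr
  have hr : (harm v).InRange (min (v 0) (min (v 1) (v 2))) (max (v 0) (max (v 1) (v 2))) := by
    intro k
    fin_cases k <;> simp
  have ht := (tendsto_pow_atTop_nhds_zero_of_lt_one (by norm_num : (0 : ℝ) ≤ 7 / 15)
    (by norm_num)).mul_const (max (v 0) (max (v 1) (v 2)) - min (v 0) (min (v 1) (v 2)))
  rw [zero_mul] at ht
  obtain ⟨N, hN⟩ := (ht.eventually (gt_mem_nhds hε)).exists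
  exact key N v _ _ hr hN.le

/-- The oscillation of `f` over each of the cells of level `N` is at most `δ`. -/
def OscAt (δ : ℝ) (N : ℕ) (f : C(Plane, ℝ)) : Prop :=
  ∀ w : List (Fin 6), w.length = N → ∀ x ∈ gasket, ∀ y ∈ gasket,
    |f (Fword w x) - f (Fword w y)| ≤ δ

theorem exists_oscAt {δ : ℝ} (hδ : 0 < δ) (f : C(Plane, ℝ)) : ∃ N, OscAt δ N f := by
  obtain ⟨r, hr, hd⟩ := Metric.uniformContinuousOn_iff.1
    (gasket_isCompact.uniformContinuousOn_of_continuous f.continuous.continuousOn) δ hδ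
  obtain ⟨n, hn⟩ := exists_pow_lt_of_lt_one (show 0 < r / 2 by positivity)
    (by norm_num : (1 / 3 : ℝ) < 1)
  refine ⟨n, fun w hw x hx y hy =>
    (hd _ (Fword_mem_gasket w hx) _ (Fword_mem_gasket w hy) ?_).le⟩
  have e1 := dist_gasket_le hx hy
  have e2 : dist x y / 3 ^ n = dist x y * (1 / 3) ^ n := by
    rw [one_div, inv_pow]; rfl
  rw [dist_Fword, hw, e2]
  calc dist x y * (1 / 3) ^ n ≤ 2 * (1 / 3) ^ n := by gcongr
    _ < r := by linarith

theorem OscAt.comp {δ : ℝ} {N : ℕ} {f : C(Plane, ℝ)} (h : OscAt δ (N + 1) f) (i : Fin 6) :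
    OscAt δ N (f.comp (FMap i)) := fun w hw x hx y hy => h (i :: w) (by simp [hw]) x hx y hy

theorem OscAt.comp_zero {δ : ℝ} {f : C(Plane, ℝ)} (h : OscAt δ 0 f) (i : Fin 6) :
    OscAt δ 0 (f.comp (FMap i)) := by
  intro w hw x hx y hy
  rw [List.length_eq_zero_iff.1 hw]
  exact h [] rfl _ (F_mem_gasket i hx) _ (F_mem_gasket i hy)

theorem OscAt.abs_sub_le {δ : ℝ} {f : C(Plane, ℝ)} (h : OscAt δ 0 f) {x : ℝ}
    (hx : IsIntermediate f x) {z : Plane} (hz : z ∈ gasket) : |x - f z| ≤ δ := by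
  have := hx (f z - δ) (f z + δ) fun y hy => by
    have := abs_le.1 (h [] rfl y hy z hz)
    exact ⟨by simp only [Fword, id] at this; linarith, by simp only [Fword, id] at this; linarith⟩
  exact abs_le.2 ⟨by linarith [this.1], by linarith [this.2]⟩

theorem shrinks_fn {ε : ℝ} (hε : 0 < ε) (f : C(Plane, ℝ)) : Shrinks ε (fn f) := by
  obtain ⟨N, hN⟩ := exists_oscAt (half_pos hε) f
  induction N generalizing f with
  | zero =>
    refine shrinks_of_inRange (a := f (q 0) - ε / 2) (b := f (q 0) + ε / 2) ?_ (by linarith)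
    intro z hz
    have := abs_le.1 (hN [] rfl z hz (q 0) (q_mem_gasket 0))
    simp only [Fword, id] at this
    exact ⟨by linarith, by linarith⟩
  | succ N ih => exact Shrinks.of_child trivial fun i => ih _ (hN.comp i)

/-- The subproblems of a Dirichlet problem; if the first exponent is `1`, the value at the top is
replaced by a convex combination with the data. -/
theorem child_dir_cases {lam : ℝ} (h1 : lam ≤ 1) (f : C(Plane, ℝ)) (c : ℝ)
    (i : Fin 6) : (dir lam f c).child i = fn (f.comp (FMap i)) ∨
      (∃ v, (dir lam f c).child i = harm v) ∨
      (lam ≤ 1 / 3 ∧ (dir lam f c).child i = dir (3 * lam) (f.comp (FMap i)) c) ∨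
      ∃ lam' c' x y z, 0 < lam' ∧ lam' ≤ 1 ∧
        (dir lam f c).child i = dir lam' (f.comp (FMap i)) c' ∧
        IsIntermediate f x ∧ IsIntermediate f y ∧ IsIntermediate f z ∧ IsMix c' c x y z := by
  rcases le_or_gt lam (1 / 3) with h | h
  · by_cases hi : i = 0
    · exact Or.inr (Or.inr (Or.inl ⟨h, by simp only [child, if_pos h, if_pos hi]⟩))
    · exact Or.inl (by simp only [child, if_pos h, if_neg hi])
  rcases le_or_gt lam (2 / 3) with h' | h'
  · have he := one_le_conductance (lam := 3 * lam - 1) (by linarith) (by linarith)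
    have hI := isIntermediate_cutMean (lam := 3 * lam - 1) (by linarith) (by linarith) f
    simp only [child, val, if_neg (not_le.2 h), if_pos h']
    fin_cases i
    · exact Or.inr (Or.inl ⟨_, rfl⟩)
    · exact Or.inl rfl
    · exact Or.inl rfl
    · exact Or.inl rfl
    · exact Or.inr (Or.inr (Or.inr ⟨_, _, _, _, _, by linarith, by linarith, rfl,
        hI 4, hI 5, hI 5, isMix_valOne he _ _ _⟩))
    · exact Or.inr (Or.inr (Or.inr ⟨_, _, _, _, _, by linarith, by linarith, rfl,
        hI 5, hI 4, hI 4, isMix_valOne he _ _ _⟩))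
  · have he := one_le_conductance (lam := 3 * lam - 2) (by linarith) (by linarith)
    have hI := isIntermediate_cutMean (lam := 3 * lam - 2) (by linarith) (by linarith) f
    simp only [child, val, if_neg (not_le.2 h), if_neg (not_le.2 h')]
    fin_cases i
    · exact Or.inr (Or.inl ⟨_, rfl⟩)
    · exact Or.inr (Or.inr (Or.inr ⟨_, _, _, _, _, by linarith, by linarith, rfl,
        hI 1, hI 2, hI 3, isMix_valSide he _ _ _ _⟩))
    · exact Or.inr (Or.inr (Or.inr ⟨_, _, _, _, _, by linarith, by linarith, rfl,
        hI 2, hI 1, hI 3, isMix_valSide he _ _ _ _⟩))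
    · exact Or.inr (Or.inr (Or.inr ⟨_, _, _, _, _, by linarith, by linarith, rfl,
        hI 1, hI 2, hI 3, isMix_valCenter he _ _ _ _⟩))
    · exact Or.inr (Or.inl ⟨_, rfl⟩)
    · exact Or.inr (Or.inl ⟨_, rfl⟩)

/-- If the data `f` oscillate by at most `O`, then the distance `M` of `f` from the value at the top
satisfies `M ↦ 2 / 3 * M + O` along the subproblems, hence becomes as small as `3 * O`. -/
theorem shrinks_dir_of_osc {ε O : ℝ} (hε : 0 < ε) (hO : 0 ≤ O) (j : ℕ) {lam : ℝ} (h0 : 0 < lam)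
    (h1 : lam ≤ 1) (f : C(Plane, ℝ)) (c M : ℝ) (hf : OscAt O 0 f)
    (hM : ∀ z ∈ gasket, |c - f z| ≤ M) (hj : (2 / 3) ^ j * (M - 3 * O) + 3 * O ≤ ε / 2) :
    Shrinks ε (dir lam f c) := by
  induction j generalizing lam f c M with
  | zero =>
    rw [pow_zero, one_mul] at hj
    have hM0 : 0 ≤ M := (abs_nonneg _).trans (hM (q 0) (q_mem_gasket 0))
    refine shrinks_of_inRange (a := c - M) (b := c + M) ⟨?_, fun z hz => ?_⟩ (by linarith)
    · exact ⟨by linarith, by linarith⟩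
    · have := abs_le.1 (hM z hz)
      exact ⟨by linarith, by linarith⟩
  | succ j ih =>
    have hM' : ∀ i, ∀ z ∈ gasket, |c - (f.comp (FMap i)) z| ≤ M := fun i z hz =>
      hM _ (F_mem_gasket i hz)
    -- the cases where the first exponent decreases or the distance `M` is contracted
    have step : ∀ (lam : ℝ) (f : C(Plane, ℝ)), 0 < lam → lam ≤ 1 → OscAt O 0 f →
        (∀ z ∈ gasket, |c - f z| ≤ M) →
        (lam ≤ 1 / 3 → ∀ i, Shrinks ε (dir (3 * lam) (f.comp (FMap i)) c)) →
        Shrinks ε (dir lam f c) := by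
      intro lam f h0 h1 hf hM hlow
      refine Shrinks.of_child ⟨h0, h1⟩ fun i => ?_
      rcases child_dir_cases h1 f c i with e | ⟨v, e⟩ | ⟨h, e⟩ |
        ⟨lam', c', x, y, z, h0', h1', e, hx, hy, hz, hmix⟩
      · rw [e]; exact shrinks_fn hε _
      · rw [e]; exact shrinks_harm hε _
      · rw [e]; exact hlow h i
      · rw [e]
        refine ih h0' h1' _ c' (2 / 3 * M + O) (hf.comp_zero i) (fun t ht => ?_) ?_
        · have ht' := F_mem_gasket i ht
          exact hmix.abs_sub_le hO (hM _ ht') (hf.abs_sub_le hx ht') (hf.abs_sub_le hy ht')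
            (hf.abs_sub_le hz ht')
        · rw [pow_succ] at hj
          linarith
    refine mOne_induction (P := fun lam => ∀ f : C(Plane, ℝ), OscAt O 0 f →
      (∀ z ∈ gasket, |c - f z| ≤ M) → Shrinks ε (dir lam f c))
      (fun lam h0 h ihl f hf hM => ?_) (fun lam h h1 f hf hM => ?_) h0 h1 f hf hM
    · exact step lam f h0 (by linarith) hf hM fun _ i =>
        ihl _ (hf.comp_zero i) fun z hz => hM _ (F_mem_gasket i hz)
    · exact step lam f (by linarith) h1 hf hM fun h' => absurd h' (not_le.2 h)

theorem shrinks_dir {ε : ℝ} (hε : 0 < ε) {lam : ℝ} (h0 : 0 < lam) (h1 : lam ≤ 1)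
    (f : C(Plane, ℝ)) (c : ℝ) : Shrinks ε (dir lam f c) := by
  obtain ⟨N, hN⟩ := exists_oscAt (show 0 < ε / 12 by positivity) f
  induction N generalizing lam f c with
  | zero =>
    obtain ⟨C, hC⟩ := gasket_isCompact.exists_bound_of_continuousOn
      (f := fun z => c - f z) (continuous_const.sub f.continuous).continuousOn
    have ht := (tendsto_pow_atTop_nhds_zero_of_lt_one (by norm_num : (0 : ℝ) ≤ 2 / 3)
      (by norm_num)).mul_const (C - 3 * (ε / 12))
    rw [zero_mul] at ht
    obtain ⟨j, hj⟩ := (ht.eventually (gt_mem_nhds (show 0 < ε / 4 by positivity))).exists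
    exact shrinks_dir_of_osc hε (by positivity) j h0 h1 f c C hN hC (by linarith)
  | succ N ih =>
    refine Shrinks.of_child ⟨h0, h1⟩ fun i => ?_
    rcases child_dir_cases h1 f c i with e | ⟨v, e⟩ | ⟨h, e⟩ |
      ⟨lam', c', x, y, z, h0', h1', e, -⟩
    · rw [e]; exact shrinks_fn hε _
    · rw [e]; exact shrinks_harm hε _
    · rw [e]; exact ih (by linarith) (by linarith) _ _ (hN.comp i)
    · rw [e]; exact ih h0' h1' _ _ (hN.comp i)

theorem shrinks {ε : ℝ} (hε : 0 < ε) {s : Prescription} (hs : s.Valid) : Shrinks ε s := by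
  cases s with
  | harm v => exact shrinks_harm hε v
  | fn f => exact shrinks_fn hε f
  | dir lam f c => exact shrinks_dir hε hs.1 hs.2 f c

theorem abs_approx_sub_le {ε : ℝ} (N : ℕ) {s : Prescription} (hs : s.Valid) (h : SmallAt ε N s)
    {m n : ℕ} (hm : N ≤ m) (hn : N ≤ n) {z : Plane} (hz : z ∈ gasket) :
    |approx m s z - approx n s z| ≤ ε := by
  induction N generalizing s m n z with
  | zero =>
    obtain ⟨a, b, hab, hr⟩ := h [] rfl
    have e1 := approx_mem_Icc m hs hr hz
    have e2 := approx_mem_Icc n hs hr hz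
    rw [mem_Icc] at e1 e2
    exact abs_le.2 ⟨by linarith, by linarith⟩
  | succ N ih =>
    obtain ⟨m, rfl⟩ := Nat.exists_eq_add_of_le hm
    obtain ⟨n, rfl⟩ := Nat.exists_eq_add_of_le hn
    obtain ⟨i, y, hy, rfl⟩ := exists_F_of_mem_gasket hz
    rw [show N + 1 + m = (N + m) + 1 by ring, show N + 1 + n = (N + n) + 1 by ring,
      approx_succ_F _ s i hy, approx_succ_F _ s i hy]
    exact ih (hs.child i) (fun w hw => h (i :: w) (by simp [hw])) (Nat.le_add_right _ _)
      (Nat.le_add_right _ _) hy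

/-- The function described by a prescription. For valid prescriptions the limit exists, uniformly on
the gasket. -/
noncomputable def eval (s : Prescription) (z : Plane) : ℝ := limUnder atTop fun n => approx n s z

variable {s : Prescription}

theorem uniformCauchySeqOn_approx (hs : s.Valid) :
    UniformCauchySeqOn (fun n => approx n s) atTop gasket := by
  rw [Metric.uniformCauchySeqOn_iff]
  intro ε hε
  obtain ⟨N, hN⟩ := shrinks (half_pos hε) hs
  refine ⟨N, fun m hm n hn z hz => ?_⟩
  rw [Real.dist_eq]
  exact (abs_approx_sub_le N hs hN hm hn hz).trans_lt (by linarith)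

theorem tendsto_approx (hs : s.Valid) {z : Plane} (hz : z ∈ gasket) :
    Tendsto (fun n => approx n s z) atTop (𝓝 (s.eval z)) :=
  CauchySeq.tendsto_limUnder ((uniformCauchySeqOn_approx hs).cauchySeq hz)

theorem eval_continuousOn (hs : s.Valid) : ContinuousOn s.eval gasket :=
  ((uniformCauchySeqOn_approx hs).tendstoUniformlyOn_of_tendsto
    fun _ hz => tendsto_approx hs hz).continuousOn
    (Frequently.of_forall fun n => approx_continuousOn n s)

theorem eval_F (hs : s.Valid) (i : Fin 6) {z : Plane} (hz : z ∈ gasket) :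
    s.eval (F i z) = (s.child i).eval z := by
  have e1 := (tendsto_approx hs (F_mem_gasket i hz)).comp (tendsto_add_atTop_nat 1)
  refine tendsto_nhds_unique e1 ((tendsto_approx (hs.child i) hz).congr fun n => ?_)
  exact (approx_succ_F n s i hz).symm

theorem eval_q (hs : s.Valid) (k : Fin 3) : s.eval (q k) = s.corner k := by
  refine tendsto_nhds_unique (tendsto_approx hs (q_mem_gasket k)) ?_
  simp only [fun n => (approx_corner n s k).1]
  exact tendsto_const_nhds

theorem eval_pt (hs : s.Valid) (n : Fin 10) : s.eval (pt n) = s.val n := by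
  have : ∃ i k, node i k = n := by revert n; decide
  obtain ⟨i, k, rfl⟩ := this
  rw [← F_q_eq_pt, eval_F hs i (q_mem_gasket k), eval_q (hs.child i), corner_child]

theorem eval_Fword (hs : s.Valid) (w : List (Fin 6)) {z : Plane} (hz : z ∈ gasket) :
    s.eval (Fword w z) = (s.descendant w).eval z := by
  induction w generalizing s with
  | nil => rfl
  | cons i w ih =>
    rw [Fword, Function.comp, eval_F hs i (Fword_mem_gasket w hz)]
    exact ih (hs.child i)

theorem eval_fn (f : C(Plane, ℝ)) : EqOn (fn f).eval f gasket := by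
  have hv : ∀ f, (fn f).Valid := fun _ => trivial
  refine eqOn_gasket_of_vertices (eval_continuousOn (hv f)) f.continuous.continuousOn
    fun w k => ?_
  rw [eval_Fword (hv f) w (q_mem_gasket k)]
  induction w generalizing f with
  | nil => exact eval_q (hv f) k
  | cons i w ih => exact ih (f.comp (FMap i))

end Prescription

/-! ### The matching conditions at the crucial points -/

/-- The normal derivatives at `p 4` add up to zero: the cells meeting there are the top cell
and a cell with effective conductance `e` to the cut. -/
theorem valOne_matching {e : ℝ} (he : 0 < e) (c I J : ℝ) :
    2 * valOne e c I J - c - valOne e c J I + e * (valOne e c I J - I) = 0 := by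
  have : 3 + 4 * e + e ^ 2 = (1 + e) * (3 + e) := by ring
  unfold valOne
  rw [this]
  field_simp
  ring

/-- The normal derivative at `q 0` of the top cell. -/
theorem valOne_flux {e : ℝ} (he : 0 < e) (c I J : ℝ) :
    2 * c - valOne e c I J - valOne e c J I = phiOne e * (c - (1 / 2 * I + 1 / 2 * J)) := by
  have : 3 + 4 * e + e ^ 2 = (1 + e) * (3 + e) := by ring
  unfold valOne phiOne
  rw [this]
  field_simp
  ring

theorem denominator_factor (e : ℝ) :
    54 + 165 * e + 102 * e ^ 2 + 15 * e ^ 3 = (6 + 15 * e + 3 * e ^ 2) * (9 + 5 * e) := by ring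

/-- The normal derivatives at `p 4` add up to zero: the cells `F 0` and `F 4` meet there. -/
theorem valUpper_matching {e : ℝ} (he : 0 < e) (c I J K : ℝ) :
    2 * valUpper e c I J K - c - valUpper e c J I K
      + (2 * valUpper e c I J K - valCenter e c I J K - valSide e c J I K) = 0 := by
  have h1 : 0 < 6 + 15 * e + 3 * e ^ 2 := by positivity
  have h2 : 0 < 9 + 5 * e := by positivity
  unfold valUpper valCenter valSide
  rw [denominator_factor]
  field_simp
  ring

/-- The normal derivatives at `p 1` add up to zero: the cells `F 5` and `F 1` meet there, the latter
with effective conductance `e` to the cut. -/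
theorem valSide_matching {e : ℝ} (he : 0 < e) (c I J K : ℝ) :
    2 * valSide e c I J K - valUpper e c J I K - valCenter e c I J K
      + e * (valSide e c I J K - I) = 0 := by
  have h1 : 0 < 6 + 15 * e + 3 * e ^ 2 := by positivity
  have h2 : 0 < 9 + 5 * e := by positivity
  unfold valUpper valCenter valSide
  rw [denominator_factor]
  field_simp
  ring

/-- The normal derivatives at `p 3` add up to zero: the cells `F 4`, `F 5` and `F 3` meet there. -/
theorem valCenter_matching {e : ℝ} (he : 0 < e) (c I J K : ℝ) :
    2 * valCenter e c I J K - valUpper e c I J K - valSide e c J I K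
      + (2 * valCenter e c I J K - valUpper e c J I K - valSide e c I J K)
      + e * (valCenter e c I J K - K) = 0 := by
  have h1 : 0 < 6 + 15 * e + 3 * e ^ 2 := by positivity
  have h2 : 0 < 9 + 5 * e := by positivity
  unfold valUpper valCenter valSide
  rw [denominator_factor]
  field_simp
  ring

/-- The normal derivative at `q 0` of the top cell. In the sum of the two values the factor
`9 + 5 * e` cancels from the cubic denominator. -/
theorem valUpper_flux {e : ℝ} (he : 0 < e) (c I J K : ℝ) :
    2 * c - valUpper e c I J K - valUpper e c J I K =
      phiTwo e * (c - ((6 + e) / (18 + 4 * e) * I + (6 + e) / (18 + 4 * e) * J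
        + (3 + e) / (9 + 2 * e) * K)) := by
  have h1 : 0 < 6 + 15 * e + 3 * e ^ 2 := by positivity
  have h2 : 0 < 9 + 5 * e := by positivity
  have h3 : 0 < 9 + 2 * e := by positivity
  have h4 : 18 + 4 * e = 2 * (9 + 2 * e) := by ring
  have h5 : phiTwo e = 2 * e * (9 + 2 * e) / (6 + 15 * e + 3 * e ^ 2) := by
    unfold phiTwo
    congr 1
    ring
  rw [h4, h5]
  unfold valUpper
  rw [denominator_factor]
  field_simp
  ring

theorem valCenter_comm (e c I J K : ℝ) :
    valCenter e c I J K = valCenter e c J I K := by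
  unfold valCenter
  ring

/-! ### The means over the cut -/

theorem cutMean_of_le {lam : ℝ} (h0 : 0 < lam) (h : lam ≤ 1 / 3) (f : C(Plane, ℝ)) :
    cutMean lam f = cutMean (3 * lam) (f.comp (FMap 0)) := by
  unfold cutMean
  rw [integral_cutFamily h0 (by linarith) f.continuous,
    integral_cutFamily (by linarith) (by linarith) (f.comp (FMap 0)).continuous, letters_of_le h0 h]
  refine Finset.sum_congr rfl fun i _ => ?_
  simp only [cutWeight_of_le h0 h, R_of_le h0 h, Flam_singleton_of_le h0 h]
  rfl

theorem cutMean_of_mid {lam : ℝ} (h : 1 / 3 < lam) (h' : lam ≤ 2 / 3) (f : C(Plane, ℝ)) :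
    cutMean lam f = 1 / 2 * cutMean (3 * lam - 1) (f.comp (FMap 4))
      + 1 / 2 * cutMean (3 * lam - 1) (f.comp (FMap 5)) := by
  unfold cutMean
  rw [integral_cutFamily (by linarith) (by linarith) f.continuous, letters_of_mid h h',
    Finset.sum_pair (by decide)]
  simp only [cutWeight, iotaOne_eq_one h h', if_true, R_of_mid h h',
    Flam_singleton_of_gt h (show lam ≤ 1 by linarith)]
  rfl

theorem cutMean_of_high {lam : ℝ} (h : 2 / 3 < lam) (h' : lam ≤ 1) (f : C(Plane, ℝ)) :
    cutMean lam f = (6 + conductance (3 * lam - 2)) / (18 + 4 * conductance (3 * lam - 2)) *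
        cutMean (3 * lam - 2) (f.comp (FMap 1))
      + (6 + conductance (3 * lam - 2)) / (18 + 4 * conductance (3 * lam - 2)) *
        cutMean (3 * lam - 2) (f.comp (FMap 2))
      + (3 + conductance (3 * lam - 2)) / (9 + 2 * conductance (3 * lam - 2)) *
        cutMean (3 * lam - 2) (f.comp (FMap 3)) := by
  unfold cutMean
  rw [integral_cutFamily (by linarith) h' f.continuous, letters_of_high h h',
    Finset.sum_insert (by decide), Finset.sum_pair (by decide), ← add_assoc]
  simp only [cutWeight, iotaOne_eq_two h h', R_of_high h h',
    Flam_singleton_of_gt (show 1 / 3 < lam by linarith) h']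
  rfl

/-! ### The energy of the solution against test functions -/

/-- `v` vanishes at the corners of the cells of level `m` which reach down to the cut `X_lam`. -/
def VanishesBelow (m : ℕ) (lam : ℝ) (v : Plane → ℝ) : Prop :=
  ∀ w : List (Fin 6), w.length = m → (Fword w (q 1)).2 ≤ 1 - lam → ∀ k, v (Fword w (q k)) = 0

theorem VanishesBelow.comp {m : ℕ} {lam lam' : ℝ} {v : Plane → ℝ}
    (h : VanishesBelow (m + 1) lam v) (i : Fin 6) (hl : lam' = 3 * lam - 2 + height i) :
    VanishesBelow m lam' (v ∘ F i) := by
  intro w hw hle k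
  refine h (i :: w) (by simp [hw]) ?_ k
  rw [Fword, Function.comp, F_snd]
  linarith

theorem VanishesBelow.comp_eq_zero {m : ℕ} {lam : ℝ} {v : Plane → ℝ}
    (h : VanishesBelow (m + 1) lam v) (i : Fin 6) (hi : 1 + height i ≤ 3 - 3 * lam)
    (u : Plane → ℝ) : graphEnergy m u (v ∘ F i) = 0 := by
  refine graphEnergy_eq_zero m fun w hw k => h (i :: w) (by simp [hw]) ?_ k
  rw [Fword, Function.comp, F_snd]
  have := snd_le_one (Fword_mem_gasket w (q_mem_gasket 1))
  linarith

namespace Prescription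

theorem graphEnergy_eval_succ (m : ℕ) {s : Prescription} (hs : s.Valid) (v : Plane → ℝ) :
    graphEnergy (m + 1) s.eval v = 15 / 7 * ∑ i, graphEnergy m (s.child i).eval (v ∘ F i) := by
  rw [graphEnergy_succ]
  congr 1
  exact Finset.sum_congr rfl fun i _ =>
    graphEnergy_congr m (fun z hz => eval_F hs i hz) fun _ _ => rfl

/-- The energies of a harmonic function against any function are those of the corner values. -/
theorem graphEnergy_eval_harm (m : ℕ) (a : Fin 3 → ℝ) (v : Plane → ℝ) :
    graphEnergy m (harm a).eval v = tri a fun k => v (q k) := by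
  have hv : ∀ a, (harm a).Valid := fun _ => trivial
  induction m generalizing a v with
  | zero =>
    rw [graphEnergy_zero]
    simp only [eval_q (hv a)]
    rfl
  | succ m ih =>
    rw [graphEnergy_eval_succ m (hv a), corners_eq_pt, ← sum_tri_harmExt a fun n => v (pt n)]
    simp only [child, ih, Function.comp, F_q_eq_pt]
    rfl

theorem inDomEnergy_eval_harm (a : Fin 3 → ℝ) : InDomEnergy (harm a).eval := by
  refine ⟨eval_continuousOn trivial, tri a a, ?_⟩
  rintro _ ⟨m, rfl⟩
  have hv : (harm a).Valid := trivial
  dsimp only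
  rw [graphEnergy_eval_harm]
  simp only [eval_q hv]
  exact le_rfl

/-- The flux identity: the solution is harmonic off the top and the cut, and its normal derivative
at the top is the conductance times the difference of the value there and the mean over the
cut. -/
theorem graphEnergy_eval_dir (m : ℕ) {lam : ℝ} (h0 : 0 < lam) (h1 : lam ≤ 1) (f : C(Plane, ℝ))
    (c : ℝ) {v : Plane → ℝ} (hv : VanishesBelow m lam v) :
    graphEnergy m (dir lam f c).eval v = conductance lam * (c - cutMean lam f) * v (q 0) := by
  induction m generalizing lam f c v with
  | zero =>
    have : ∀ k, v (q k) = 0 := hv [] rfl (by simp [Fword, q_snd, h1])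
    rw [graphEnergy_zero]
    simp [this, tri]
  | succ m ih =>
    have hval : (dir lam f c).Valid := ⟨h0, h1⟩
    have vF : ∀ i k, v (F i (q k)) = v (pt (node i k)) := fun i k => by rw [F_q_eq_pt]
    have v0 : v (q 0) = v (pt 0) := by rw [← pt_corner 0]; rfl
    rw [graphEnergy_eval_succ m hval, Fin.sum_univ_six]
    rcases le_or_gt lam (1 / 3) with h | h
    · rw [hv.comp_eq_zero 1 (by simp [height]; linarith), hv.comp_eq_zero 2
        (by simp [height]; linarith), hv.comp_eq_zero 3 (by simp [height]; linarith),
        hv.comp_eq_zero 4 (by simp [height]; linarith),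
        hv.comp_eq_zero 5 (by simp [height]; linarith)]
      have e := ih (lam := 3 * lam) (by linarith) (by linarith) (f.comp (FMap 0)) c
        (hv.comp 0 (by simp [height]))
      simp only [child, if_pos h, if_true]
      rw [e, conductance_of_le h0 h, cutMean_of_le h0 h, Function.comp, vF, v0]
      simp only [node]
      norm_num
      ring
    rcases le_or_gt lam (2 / 3) with h' | h'
    · rw [hv.comp_eq_zero 1 (by simp [height]; linarith), hv.comp_eq_zero 2
        (by simp [height]; linarith), hv.comp_eq_zero 3 (by simp [height]; linarith)]
      have he := conductance_pos (lam := 3 * lam - 1) (by linarith) (by linarith)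
      have c0 : (dir lam f c).child 0 = harm ((dir lam f c).val ∘ node 0) := by
        simp only [child, if_neg (not_le.2 h), if_pos h', if_true]
      have c4 : (dir lam f c).child 4 =
          dir (3 * lam - 1) (f.comp (FMap 4)) ((dir lam f c).val 4) := by
        simp only [child, if_neg (not_le.2 h), if_pos h']; rfl
      have c5 : (dir lam f c).child 5 =
          dir (3 * lam - 1) (f.comp (FMap 5)) ((dir lam f c).val 3) := by
        simp only [child, if_neg (not_le.2 h), if_pos h']; rfl
      rw [c0, c4, c5, graphEnergy_eval_harm,
        ih (by linarith) (by linarith) _ _ (hv.comp 4 (by simp [height]; ring)),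
        ih (by linarith) (by linarith) _ _ (hv.comp 5 (by simp [height]; ring)),
        conductance_of_mid h h', cutMean_of_mid h h']
      simp only [Function.comp, vF, v0]
      simp only [val, if_neg (not_le.2 h), if_pos h']
      set e := conductance (3 * lam - 1)
      set I4 := cutMean (3 * lam - 1) (f.comp (FMap 4))
      set I5 := cutMean (3 * lam - 1) (f.comp (FMap 5))
      have k4 := valOne_matching he c I4 I5
      have k5 := valOne_matching he c I5 I4
      have k0 := valOne_flux he c I4 I5
      -- The coefficient of `v` at a vertex is the sum of the normal derivatives there.
      simp [tri, node]
      linear_combination 15 / 7 * v (pt 4) * k4 + 15 / 7 * v (pt 3) * k5 + 15 / 7 * v (pt 0) * k0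
    · have he := conductance_pos (lam := 3 * lam - 2) (by linarith) (by linarith)
      have c0 : (dir lam f c).child 0 = harm ((dir lam f c).val ∘ node 0) := by
        simp only [child, if_neg (not_le.2 h), if_neg (not_le.2 h')]; rfl
      have c4 : (dir lam f c).child 4 = harm ((dir lam f c).val ∘ node 4) := by
        simp only [child, if_neg (not_le.2 h), if_neg (not_le.2 h')]; rfl
      have c5 : (dir lam f c).child 5 = harm ((dir lam f c).val ∘ node 5) := by
        simp only [child, if_neg (not_le.2 h), if_neg (not_le.2 h')]; rfl
      have c1 : (dir lam f c).child 1 =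
          dir (3 * lam - 2) (f.comp (FMap 1)) ((dir lam f c).val 5) := by
        simp only [child, if_neg (not_le.2 h), if_neg (not_le.2 h')]; rfl
      have c2 : (dir lam f c).child 2 =
          dir (3 * lam - 2) (f.comp (FMap 2)) ((dir lam f c).val 6) := by
        simp only [child, if_neg (not_le.2 h), if_neg (not_le.2 h')]; rfl
      have c3 : (dir lam f c).child 3 =
          dir (3 * lam - 2) (f.comp (FMap 3)) ((dir lam f c).val 9) := by
        simp only [child, if_neg (not_le.2 h), if_neg (not_le.2 h')]; rfl
      rw [c0, c1, c2, c3, c4, c5, graphEnergy_eval_harm, graphEnergy_eval_harm,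
        graphEnergy_eval_harm,
        ih (by linarith) (by linarith) _ _ (hv.comp 1 (by simp [height])),
        ih (by linarith) (by linarith) _ _ (hv.comp 2 (by simp [height])),
        ih (by linarith) (by linarith) _ _ (hv.comp 3 (by simp [height])),
        conductance_of_high h' h1, cutMean_of_high h' h1]
      simp only [Function.comp, vF, v0]
      simp only [val, if_neg (not_le.2 h), if_neg (not_le.2 h')]
      set e := conductance (3 * lam - 2)
      set I1 := cutMean (3 * lam - 2) (f.comp (FMap 1))
      set I2 := cutMean (3 * lam - 2) (f.comp (FMap 2))
      set I3 := cutMean (3 * lam - 2) (f.comp (FMap 3))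
      have k1 := valSide_matching he c I1 I2 I3
      have k2 := valSide_matching he c I2 I1 I3
      have k3 := valCenter_matching he c I1 I2 I3
      have k4 := valUpper_matching he c I1 I2 I3
      have k5 := valUpper_matching he c I2 I1 I3
      have k0 := valUpper_flux he c I1 I2 I3
      rw [valCenter_comm e c I2 I1 I3] at k2 k5
      -- The coefficient of `v` at a vertex is the sum of the normal derivatives there.
      simp [tri, node]
      linear_combination 15 / 7 * v (pt 5) * k1 + 15 / 7 * v (pt 6) * k2 + 15 / 7 * v (pt 9) * k3
        + 15 / 7 * v (pt 4) * k4 + 15 / 7 * v (pt 3) * k5 + 15 / 7 * v (pt 0) * k0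

/-! ### Existence for the Dirichlet problem -/

/-- The subproblems of a Dirichlet problem: cells below the cut carry the given function, cells
above the cut a harmonic function, and cells meeting the cut a Dirichlet problem. -/
theorem child_dir_shape {lam : ℝ} (h0 : 0 < lam) (h1 : lam ≤ 1) (f : C(Plane, ℝ)) (c : ℝ)
    (i : Fin 6) :
    (1 + height i ≤ 3 - 3 * lam ∧ (dir lam f c).child i = fn (f.comp (FMap i))) ∨
      (3 - 3 * lam < height i ∧ ∃ a, (dir lam f c).child i = harm a) ∨
      ∃ lam' c', 0 < lam' ∧ lam' ≤ 1 ∧ lam' = 3 * lam - 2 + height i ∧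
        (dir lam f c).child i = dir lam' (f.comp (FMap i)) c' := by
  rcases le_or_gt lam (1 / 3) with h | h
  · simp only [child, if_pos h]
    by_cases hi : i = 0
    · subst hi
      exact Or.inr (Or.inr ⟨_, _, by linarith, by linarith, by simp [height], rfl⟩)
    · rw [if_neg hi]
      refine Or.inl ⟨?_, rfl⟩
      fin_cases i <;> simp [height] at hi ⊢ <;> linarith
  rcases le_or_gt lam (2 / 3) with h' | h'
  · simp only [child, if_neg (not_le.2 h), if_pos h']
    fin_cases i
    · exact Or.inr (Or.inl ⟨by simp [height]; linarith, _, rfl⟩)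
    · exact Or.inl ⟨by simp [height]; linarith, rfl⟩
    · exact Or.inl ⟨by simp [height]; linarith, rfl⟩
    · exact Or.inl ⟨by simp [height]; linarith, rfl⟩
    · exact Or.inr (Or.inr ⟨_, _, by linarith, by linarith, by simp [height]; ring, rfl⟩)
    · exact Or.inr (Or.inr ⟨_, _, by linarith, by linarith, by simp [height]; ring, rfl⟩)
  · simp only [child, if_neg (not_le.2 h), if_neg (not_le.2 h')]
    fin_cases i
    · exact Or.inr (Or.inl ⟨by simp [height]; linarith, _, rfl⟩)
    · exact Or.inr (Or.inr ⟨_, _, by linarith, by linarith, by simp [height], rfl⟩)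
    · exact Or.inr (Or.inr ⟨_, _, by linarith, by linarith, by simp [height], rfl⟩)
    · exact Or.inr (Or.inr ⟨_, _, by linarith, by linarith, by simp [height], rfl⟩)
    · exact Or.inr (Or.inl ⟨by simp [height]; linarith, _, rfl⟩)
    · exact Or.inr (Or.inl ⟨by simp [height]; linarith, _, rfl⟩)

theorem eval_mem_Icc {s : Prescription} (hs : s.Valid) {a b : ℝ} (h : s.InRange a b) {z : Plane}
    (hz : z ∈ gasket) : s.eval z ∈ Icc a b :=
  isClosed_Icc.mem_of_tendsto (tendsto_approx hs hz)
    (Eventually.of_forall fun n => approx_mem_Icc n hs h hz)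

variable {lam : ℝ}

/-- The solution attains its data on the cut, and continues them below it: small cells which touch
the cut carry data and values in a common short interval. -/
theorem eval_dir_of_snd_le (h0 : 0 < lam) (h1 : lam ≤ 1) (f : C(Plane, ℝ)) (c : ℝ) {z : Plane}
    (hz : z ∈ gasket) (hz2 : z.2 ≤ 1 - lam) : (dir lam f c).eval z = f z := by
  refine eq_of_abs_sub_le_all fun ε hε => ?_
  obtain ⟨N, hN⟩ := shrinks_dir hε h0 h1 f c
  induction N generalizing lam f c z with
  | zero =>
    obtain ⟨a, b, hab, hr⟩ := hN [] rfl
    have hv : (dir lam f c).Valid := ⟨h0, h1⟩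
    have e1 := eval_mem_Icc (s := dir lam f c) hv hr hz
    have e2 := hr.2 z hz
    rw [mem_Icc] at e1 e2
    exact abs_le.2 ⟨by linarith, by linarith⟩
  | succ N ih =>
    have hv : (dir lam f c).Valid := ⟨h0, h1⟩
    obtain ⟨i, y, hy, rfl⟩ := exists_F_of_mem_gasket hz
    have hN' : SmallAt ε N ((dir lam f c).child i) := fun w hw => hN (i :: w) (by simp [hw])
    rw [F_snd] at hz2
    rw [eval_F hv i hy]
    rcases child_dir_shape h0 h1 f c i with ⟨-, e⟩ | ⟨hi, -⟩ | ⟨lam', c', h0', h1', hl, e⟩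
    · rw [e, eval_fn _ hy]
      simpa [FMap] using hε.le
    · have := snd_nonneg hy
      linarith
    · rw [e] at hN' ⊢
      exact ih h0' h1' _ c' hy (by linarith) hN'

theorem descendant_harm (a : Fin 3 → ℝ) (w : List (Fin 6)) :
    ∃ a', (harm a).descendant w = harm a' := by
  induction w generalizing a with
  | nil => exact ⟨a, rfl⟩
  | cons i w ih => exact ih _

/-- On cells inside the upper domain, the solution is an ordinary harmonic function. -/
theorem descendant_dir (h0 : 0 < lam) (h1 : lam ≤ 1) (f : C(Plane, ℝ)) (c : ℝ)
    (w : List (Fin 6)) (hw : 1 - lam < (Fword w (q 1)).2) :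
    ∃ a, (dir lam f c).descendant w = harm a := by
  induction w generalizing lam f c with
  | nil =>
    simp [Fword, q_snd] at hw
    linarith
  | cons i w ih =>
    rw [Fword, Function.comp, F_snd] at hw
    rcases child_dir_shape h0 h1 f c i with ⟨hi, -⟩ | ⟨-, a, e⟩ | ⟨lam', c', h0', h1', hl, e⟩
    · have := snd_le_one (Fword_mem_gasket w (q_mem_gasket 1))
      linarith
    · rw [descendant, e]
      exact descendant_harm a w
    · rw [descendant, e]
      exact ih h0' h1' _ c' (by linarith)

theorem isHarmonicOn_eval_dir (h0 : 0 < lam) (h1 : lam ≤ 1) (f : C(Plane, ℝ)) (c : ℝ) :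
    IsHarmonicOn (upperDomain lam) (dir lam f c).eval := by
  have hv : (dir lam f c).Valid := ⟨h0, h1⟩
  constructor
  · intro w hw
    obtain ⟨a, ha⟩ := descendant_dir h0 h1 f c w (hw ⟨_, q_mem_gasket 1, rfl⟩).2.2
    have he : EqOn ((dir lam f c).eval ∘ Fword w) (harm a).eval gasket := fun z hz => by
      rw [Function.comp, eval_Fword hv w hz, ha]
    obtain ⟨e1, e2⟩ := inDomEnergy_eval_harm a
    refine ⟨e1.congr he, ?_⟩
    simpa only [graphEnergy_congr _ he he] using e2
  · rintro v - ⟨K, hK, hKU, hvK⟩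
    obtain ⟨n, hn⟩ := exists_level h1 hK hKU
    refine tendsto_const_nhds.congr' ?_
    filter_upwards [eventually_ge_atTop n] with m hm
    have hbelow : VanishesBelow m lam v := by
      intro w hw hle k
      have hk := Fword_mem_gasket w (q_mem_gasket k)
      refine hvK _ hk fun hmem => ?_
      have := hn m hm w hw ⟨_, q_mem_gasket k, hmem⟩ ⟨_, q_mem_gasket 1, rfl⟩
      exact absurd hle (not_le.2 this.2.2)
    have hq : v (q 0) = 0 :=
      hvK _ (q_mem_gasket 0) fun hmem => ((mem_upperDomain h1).1 (hKU hmem)).2.1 rfl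
    rw [graphEnergy_eval_dir m h0 h1 f c hbelow, hq, mul_zero]

theorem isDirichletSolution_eval (h0 : 0 < lam) (h1 : lam ≤ 1) {g : Plane → ℝ} {f : C(Plane, ℝ)}
    (hfg : EqOn f g (cut lam)) : IsDirichletSolution lam g (dir lam f (g (q 0))).eval := by
  have hv : (dir lam f (g (q 0))).Valid := ⟨h0, h1⟩
  refine ⟨(eval_continuousOn hv).mono (closedDomain_subset h0 h1),
    isHarmonicOn_eval_dir h0 h1 f _, ?_⟩
  rintro z (rfl | hz)
  · exact eval_q hv 0
  · rw [eval_dir_of_snd_le h0 h1 f _ hz.1 hz.2.le, hfg hz]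

/-! ### The normal derivative at the top -/

theorem eval_iterate_F_zero {s : Prescription} (hs : s.Valid) (m : ℕ) {z : Plane}
    (hz : z ∈ gasket) : s.eval ((F 0)^[m + 1] z) = (s.child 0).eval ((F 0)^[m] z) := by
  rw [Function.iterate_succ_apply', eval_F hs]
  rw [iterate_F_eq_Fword]
  exact Fword_mem_gasket _ hz

/-- The difference quotients at `q 0` of a harmonic function are constant. -/
theorem normalDeriv_eval_harm (m : ℕ) (a : Fin 3 → ℝ) :
    (15 / 7 : ℝ) ^ m * (2 * a 0 - (harm a).eval ((F 0)^[m] (q 1))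
      - (harm a).eval ((F 0)^[m] (q 2))) = 2 * a 0 - a 1 - a 2 := by
  have hv : ∀ a, (harm a).Valid := fun _ => trivial
  induction m generalizing a with
  | zero =>
    simp only [Function.iterate_zero, id, eval_q (hv a), corner]
    ring
  | succ m ih =>
    have e := ih (harmExt a ∘ node 0)
    rw [eval_iterate_F_zero (hv a) m (q_mem_gasket 1),
      eval_iterate_F_zero (hv a) m (q_mem_gasket 2), pow_succ]
    simp only [child]
    simp [harmExt, node] at e
    simp [harmExt, node]
    linear_combination 15 / 7 * e

/-- The difference quotients at `q 0` of the solution are constant once `F_0^m` maps the gasket into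
the upper domain. -/
theorem normalDeriv_eval_dir (h0 : 0 < lam) (h1 : lam ≤ 1) (f : C(Plane, ℝ)) (c : ℝ) {m : ℕ}
    (hm : mOne lam ≤ m) :
    (15 / 7 : ℝ) ^ m * (2 * c - (dir lam f c).eval ((F 0)^[m] (q 1))
      - (dir lam f c).eval ((F 0)^[m] (q 2))) = conductance lam * (c - cutMean lam f) := by
  refine mOne_induction (P := fun lam => ∀ (f : C(Plane, ℝ)) (m : ℕ), mOne lam ≤ m →
    (15 / 7 : ℝ) ^ m * (2 * c - (dir lam f c).eval ((F 0)^[m] (q 1))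
      - (dir lam f c).eval ((F 0)^[m] (q 2))) = conductance lam * (c - cutMean lam f))
    (fun lam h0 h ih f m hm => ?_) (fun lam h h1 f m hm => ?_) h0 h1 f m hm
  · have hv : (dir lam f c).Valid := ⟨h0, by linarith⟩
    rw [mOne_of_le h0 h] at hm
    obtain ⟨m, rfl⟩ := Nat.exists_eq_succ_of_ne_zero (show m ≠ 0 by omega)
    have e := ih (f.comp (FMap 0)) m (by omega)
    rw [Nat.succ_eq_add_one, eval_iterate_F_zero hv m (q_mem_gasket 1),
      eval_iterate_F_zero hv m (q_mem_gasket 2), pow_succ, conductance_of_le h0 h,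
      cutMean_of_le h0 h]
    simp only [child, if_pos h, if_true]
    linear_combination 15 / 7 * e
  · have hv : (dir lam f c).Valid := ⟨by linarith, h1⟩
    rw [mOne_eq_one h h1] at hm
    obtain ⟨m, rfl⟩ := Nat.exists_eq_succ_of_ne_zero (show m ≠ 0 by omega)
    have e := normalDeriv_eval_harm m ((dir lam f c).val ∘ node 0)
    have c0 : (dir lam f c).child 0 = harm ((dir lam f c).val ∘ node 0) := by
      rcases le_or_gt lam (2 / 3) with h' | h'
      · simp only [child, if_neg (not_le.2 h), if_pos h', if_true]
      · simp only [child, if_neg (not_le.2 h), if_neg (not_le.2 h')]; rfl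
    rw [Nat.succ_eq_add_one, eval_iterate_F_zero hv m (q_mem_gasket 1),
      eval_iterate_F_zero hv m (q_mem_gasket 2), pow_succ, c0]
    rcases le_or_gt lam (2 / 3) with h' | h'
    · have he := conductance_pos (lam := 3 * lam - 1) (by linarith) (by linarith)
      have k := valOne_flux he c (cutMean (3 * lam - 1) (f.comp (FMap 4)))
        (cutMean (3 * lam - 1) (f.comp (FMap 5)))
      rw [conductance_of_mid h h', cutMean_of_mid h h']
      simp only [val, if_neg (not_le.2 h), if_pos h'] at e ⊢
      simp [node] at e
      simp [node]
      linear_combination 15 / 7 * e + 15 / 7 * k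
    · have he := conductance_pos (lam := 3 * lam - 2) (by linarith) (by linarith)
      have k := valUpper_flux he c (cutMean (3 * lam - 2) (f.comp (FMap 1)))
        (cutMean (3 * lam - 2) (f.comp (FMap 2))) (cutMean (3 * lam - 2) (f.comp (FMap 3)))
      rw [conductance_of_high h' h1, cutMean_of_high h' h1]
      simp only [val, if_neg (not_le.2 h), if_neg (not_le.2 h')] at e ⊢
      simp [node] at e
      simp [node]
      linear_combination 15 / 7 * e + 15 / 7 * k

end Prescription

open Prescription

variable {lam : ℝ}

theorem iterate_F_zero_snd (m : ℕ) (z : Plane) : ((F 0)^[m] z).2 = 1 - (1 - z.2) / 3 ^ m := by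
  induction m with
  | zero => simp
  | succ m ih =>
    rw [Function.iterate_succ_apply', F_snd, ih, pow_succ]
    simp only [height, Matrix.cons_val_zero]
    field_simp
    ring

theorem isDirichletSolution_hZero (h0 : 0 < lam) (h1 : lam ≤ 1) :
    IsDirichletSolution lam (indicator {q 0} 1) (hZero lam) := by
  refine Classical.epsilon_spec (p := fun h => IsDirichletSolution lam (indicator {q 0} 1) h)
    ⟨_, isDirichletSolution_eval h0 h1 (f := 0) fun z hz => ?_⟩
  have : z ≠ q 0 := fun e => q_zero_notMem_cut h0 (e ▸ hz)
  simp [this]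

theorem hasNormalDerivTop_hZero (h0 : 0 < lam) (h1 : lam ≤ 1) :
    HasNormalDerivTop (hZero lam) (conductance lam) := by
  have hv : (dir lam 0 1).Valid := ⟨h0, h1⟩
  have hsol : IsDirichletSolution lam (indicator {q 0} 1) (dir lam 0 1).eval := by
    have := isDirichletSolution_eval h0 h1 (g := indicator {q 0} 1) (f := 0) fun z hz => by
      have : z ≠ q 0 := fun e => q_zero_notMem_cut h0 (e ▸ hz)
      simp [this]
    simpa using this
  have heq := (isDirichletSolution_hZero h0 h1).eqOn h0 h1 hsol
  refine tendsto_const_nhds.congr' ?_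
  filter_upwards [eventually_ge_atTop (mOne lam)] with m hm
  have hmem : ∀ k, (F 0)^[m] (q k) ∈ closedDomain lam := by
    intro k
    refine (mem_closedDomain h0 h1).2 ⟨?_, ?_⟩
    · rw [iterate_F_eq_Fword]
      exact Fword_mem_gasket _ (q_mem_gasket k)
    · have e1 : ((3 : ℝ) ^ mOne lam)⁻¹ < lam := Nat.sInf_mem (exists_mOne h0)
      have e2 : ((3 : ℝ) ^ m)⁻¹ ≤ (3 ^ mOne lam)⁻¹ :=
        inv_anti₀ (by positivity) (pow_le_pow_right₀ (by norm_num) hm)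
      have e3 : (1 - (q k).2) / 3 ^ m ≤ ((3 : ℝ) ^ m)⁻¹ := by
        rw [div_eq_mul_inv]
        exact mul_le_of_le_one_left (by positivity) (by linarith [snd_nonneg (q_mem_gasket k)])
      rw [iterate_F_zero_snd]
      linarith
  have e := normalDeriv_eval_dir h0 h1 0 1 hm
  have hq : hZero lam (q 0) = 1 := by
    rw [(isDirichletSolution_hZero h0 h1).2.2 (Or.inl rfl)]
    simp
  rw [hq, heq (hmem 1), heq (hmem 2), e]
  simp [cutMean]

theorem hasNormalDerivTop_eta (h0 : 0 < lam) (h1 : lam ≤ 1) :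
    HasNormalDerivTop (hZero lam) (eta lam) :=
  Classical.epsilon_spec (p := fun d => HasNormalDerivTop (hZero lam) d)
    ⟨_, hasNormalDerivTop_hZero h0 h1⟩

theorem eta_eq_conductance (h0 : 0 < lam) (h1 : lam ≤ 1) : eta lam = conductance lam :=
  tendsto_nhds_unique (hasNormalDerivTop_eta h0 h1) (hasNormalDerivTop_hZero h0 h1)

/-! ### The boundary measure -/

/-- The weights of the boundary measure in terms of `eta` and of `conductance` agree. -/
theorem wordWeight_eq (h0 : 0 < lam) (h1 : lam ≤ 1) (w : List (Fin 6)) :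
    wordWeight lam w = cutWordWeight lam w := by
  induction w generalizing lam with
  | nil => rfl
  | cons i w ih =>
    have hR := R_mem h0 h1
    rw [wordWeight, cutWordWeight, ih hR.1 hR.2, weight, cutWeight, eta_eq_conductance hR.1 hR.2]

theorem isCutMeasure_iff (h0 : 0 < lam) (h1 : lam ≤ 1) (ν : Measure Plane) :
    IsCutMeasure lam ν ↔ ν = cutFamily lam := by
  constructor
  · rintro ⟨hp, hc, hw⟩
    exact eq_cutFamily h0 h1 hc fun w h => by rw [hw w h, wordWeight_eq h0 h1]
  · rintro rfl
    exact ⟨isProbabilityMeasure_cutFamily h0 h1, cutFamily_compl_cut h0 h1, fun w h => by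
      rw [cutFamily_cutCell h0 h1 w h, wordWeight_eq h0 h1]⟩

theorem cutMeasure_eq (h0 : 0 < lam) (h1 : lam ≤ 1) : cutMeasure lam = cutFamily lam :=
  (isCutMeasure_iff h0 h1 _).1
    (Classical.epsilon_spec (p := fun ν => IsCutMeasure lam ν)
      ⟨_, (isCutMeasure_iff h0 h1 _).2 rfl⟩)

theorem cutIntegral_eq (h0 : 0 < lam) (h1 : lam ≤ 1) {g : Plane → ℝ} {f : C(Plane, ℝ)}
    (hfg : EqOn f g (cut lam)) {i : Fin 6} (hi : i ∈ letters lam) :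
    cutIntegral lam g i = ∫ z, f (Flam lam [i] z) ∂(cutFamily (R lam)) := by
  have hR := R_mem h0 h1
  have hae : ∀ᵐ z ∂(cutFamily (R lam)), z ∈ cut (R lam) := by
    rw [ae_iff]
    exact cutFamily_compl_cut hR.1 hR.2
  rw [cutIntegral, cutMeasure_eq hR.1 hR.2, Measure.restrict_eq_self_of_ae_mem hae]
  refine integral_congr_ae ?_
  filter_upwards [hae] with z hz
  exact (hfg ((Flam_singleton_mem_cut h0 h1 hi hz.1).2 hz)).symm

/-! ### The crucial points -/

theorem p_of_le (h0 : 0 < lam) (h : lam ≤ 1 / 3) (i : Fin 6) : p lam i = F 0 (p (3 * lam) i) :=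
  Flam_singleton_of_le h0 h i (q 0)

theorem p_of_gt (h : 1 / 3 < lam) (h1 : lam ≤ 1) (i : Fin 6) : p lam i = pt (node i 0) := by
  rw [← F_q_eq_pt]
  exact Flam_singleton_of_gt h h1 i (q 0)

theorem p_mem_gasket (lam : ℝ) (i : Fin 6) : p lam i ∈ gasket :=
  Flam_mem_gasket lam [i] (q_mem_gasket 0)

/-- The values of the solution at the crucial points. -/
theorem eval_dir_p (h0 : 0 < lam) (h1 : lam ≤ 1) (f : C(Plane, ℝ)) (c e : ℝ) (I : Fin 6 → ℝ)
    (he : e = conductance (R lam))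
    (hI : ∀ i ∈ letters lam, I i = ∫ z, f (Flam lam [i] z) ∂(cutFamily (R lam))) :
    (iotaOne lam = 1 → (dir lam f c).eval (p lam 4) = valOne e c (I 4) (I 5) ∧
      (dir lam f c).eval (p lam 5) = valOne e c (I 5) (I 4)) ∧
    (iotaOne lam = 2 → (dir lam f c).eval (p lam 1) = valSide e c (I 1) (I 2) (I 3) ∧
      (dir lam f c).eval (p lam 2) = valSide e c (I 2) (I 1) (I 3) ∧
      (dir lam f c).eval (p lam 3) = valCenter e c (I 1) (I 2) (I 3) ∧
      (dir lam f c).eval (p lam 4) = valUpper e c (I 1) (I 2) (I 3) ∧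
      (dir lam f c).eval (p lam 5) = valUpper e c (I 2) (I 1) (I 3)) := by
  revert f he hI
  refine mOne_induction (P := fun lam => ∀ f : C(Plane, ℝ), e = conductance (R lam) →
    (∀ i ∈ letters lam, I i = ∫ z, f (Flam lam [i] z) ∂(cutFamily (R lam))) →
    (iotaOne lam = 1 → (dir lam f c).eval (p lam 4) = valOne e c (I 4) (I 5) ∧
      (dir lam f c).eval (p lam 5) = valOne e c (I 5) (I 4)) ∧
    (iotaOne lam = 2 → (dir lam f c).eval (p lam 1) = valSide e c (I 1) (I 2) (I 3) ∧
      (dir lam f c).eval (p lam 2) = valSide e c (I 2) (I 1) (I 3) ∧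
      (dir lam f c).eval (p lam 3) = valCenter e c (I 1) (I 2) (I 3) ∧
      (dir lam f c).eval (p lam 4) = valUpper e c (I 1) (I 2) (I 3) ∧
      (dir lam f c).eval (p lam 5) = valUpper e c (I 2) (I 1) (I 3)))
    (fun lam h0 h ih f he hI => ?_) (fun lam h h1 f he hI => ?_) h0 h1
  · have hv : (dir lam f c).Valid := ⟨h0, by linarith⟩
    rw [R_of_le h0 h] at he
    rw [letters_of_le h0 h, R_of_le h0 h] at hI
    simp only [Flam_singleton_of_le h0 h] at hI
    have := ih (f.comp (FMap 0)) he hI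
    simp only [iotaOne_of_le h0 h, p_of_le h0 h, eval_F hv 0 (p_mem_gasket _ _)]
    simpa only [child, if_pos h, if_true] using this
  · have hv : (dir lam f c).Valid := ⟨by linarith, h1⟩
    simp only [p_of_gt h h1, eval_pt hv]
    simp only [Flam_singleton_of_gt h h1] at hI
    rcases le_or_gt lam (2 / 3) with h' | h'
    · rw [R_of_mid h h'] at he hI
      rw [letters_of_mid h h'] at hI
      have h4 : I 4 = cutMean (3 * lam - 1) (f.comp (FMap 4)) := hI 4 (by simp)
      have h5 : I 5 = cutMean (3 * lam - 1) (f.comp (FMap 5)) := hI 5 (by simp)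
      rw [iotaOne_eq_one h h', he, h4, h5]
      simp [val, -one_div, not_le.2 h, h', node]
    · rw [R_of_high h' h1] at he hI
      rw [letters_of_high h' h1] at hI
      have e1 : I 1 = cutMean (3 * lam - 2) (f.comp (FMap 1)) := hI 1 (by simp)
      have e2 : I 2 = cutMean (3 * lam - 2) (f.comp (FMap 2)) := hI 2 (by simp)
      have e3 : I 3 = cutMean (3 * lam - 2) (f.comp (FMap 3)) := hI 3 (by simp)
      rw [iotaOne_eq_two h' h1, he, e1, e2, e3]
      simp [val, -one_div, not_le.2 h, not_le.2 h', node]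

theorem p_mem_closedDomain (h0 : 0 < lam) (h1 : lam ≤ 1) (i j : Fin 6) (hj : j ∈ letters lam)
    (hij : height j ≤ height i) : p lam i ∈ closedDomain lam := by
  refine (mem_closedDomain h0 h1).2 ⟨p_mem_gasket lam i, ?_⟩
  have e1 := Flam_singleton_snd h0 h1 hj (q 0)
  have e2 : ∀ i, (p lam i).2 = 1 - (1 - (1 + height i) / 3) / 3 ^ (mOne lam - 1) := fun i => by
    rw [p, iterate_F_zero_snd, F_snd, q_snd, if_pos rfl]
  have e3 : Flam lam [j] (q 0) = p lam j := rfl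
  have e4 : 0 ≤ ((q 0).2 - (1 - R lam)) / 3 ^ mOne lam := by
    rw [q_snd, if_pos rfl]
    have := (R_mem h0 h1).1
    exact div_nonneg (by linarith) (by positivity)
  have e5 : (p lam j).2 ≤ (p lam i).2 := by
    rw [e2, e2]
    gcongr
  rw [e3] at e1
  linarith

theorem isClosed_bdry (lam : ℝ) : IsClosed (bdry lam) := isClosed_singleton.union (isClosed_cut lam)

/-- Tietze extension, which allows to work with data that are continuous on the whole plane. -/
theorem exists_continuousMap_eqOn {g : Plane → ℝ} {s : Set Plane} (hs : IsClosed s)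
    (hg : ContinuousOn g s) : ∃ f : C(Plane, ℝ), EqOn f g s := by
  obtain ⟨f, hf⟩ := ContinuousMap.exists_restrict_eq hs ⟨_, hg.domRestrict⟩
  exact ⟨f, fun z hz => congrArg (fun φ : C(s, ℝ) => φ ⟨z, hz⟩) hf⟩

theorem integrableOn_comp_Flam (h0 : 0 < lam) (h1 : lam ≤ 1) {g : Plane → ℝ}
    (hg : ContinuousOn g (bdry lam)) {i : Fin 6} (hi : i ∈ letters lam) :
    IntegrableOn (fun z => g (Flam lam [i] z)) (cut (R lam)) (cutMeasure (R lam)) := by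
  have hR := R_mem h0 h1
  have := isProbabilityMeasure_cutFamily hR.1 hR.2
  rw [cutMeasure_eq hR.1 hR.2]
  have hc : IsCompact (cut (R lam)) :=
    gasket_isCompact.of_isClosed_subset (isClosed_cut _) fun z hz => hz.1
  refine ContinuousOn.integrableOn_compact hc
    (hg.comp (Flam_continuous lam [i]).continuousOn fun z hz => ?_)
  exact Or.inr ((Flam_singleton_mem_cut h0 h1 hi hz.1).2 hz)

end SG3

theorem theorem3p6 (lam : ℝ) (hlam0 : 0 < lam) (hlam1 : lam ≤ 1)
    (f : SG3.Plane → ℝ) (hf : ContinuousOn f (SG3.bdry lam)) :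
    -- existence and uniqueness of the solution
    (∃ u, SG3.IsDirichletSolution lam f u ∧
      ∀ u', SG3.IsDirichletSolution lam f u' → EqOn u' u (SG3.closedDomain lam)) ∧
    -- the objects entering the formulas are well defined
    SG3.IsDirichletSolution (SG3.R lam) (indicator {SG3.q 0} 1) (SG3.hZero (SG3.R lam)) ∧
    SG3.HasNormalDerivTop (SG3.hZero (SG3.R lam)) (SG3.eta (SG3.R lam)) ∧
    SG3.IsCutMeasure (SG3.R lam) (SG3.cutMeasure (SG3.R lam)) ∧
    (∀ ν, SG3.IsCutMeasure (SG3.R lam) ν → ν = SG3.cutMeasure (SG3.R lam)) ∧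
    (∀ i ∈ SG3.letters lam, IntegrableOn (fun z => f (SG3.Flam lam [i] z))
      (SG3.cut (SG3.R lam)) (SG3.cutMeasure (SG3.R lam))) ∧
    -- the values of the solution at the crucial points
    ∀ u, SG3.IsDirichletSolution lam f u →
      ∀ (e f0 : ℝ) (I : Fin 6 → ℝ), e = SG3.eta (SG3.R lam) → f0 = f (SG3.q 0) →
        I = SG3.cutIntegral lam f →
      (SG3.iotaOne lam = 1 →
        u (SG3.p lam 4) = 1 / (1 + e) * f0
          + (2 * e + e ^ 2) / (3 + 4 * e + e ^ 2) * I 4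
          + e / (3 + 4 * e + e ^ 2) * I 5 ∧
        u (SG3.p lam 5) = 1 / (1 + e) * f0
          + (2 * e + e ^ 2) / (3 + 4 * e + e ^ 2) * I 5
          + e / (3 + 4 * e + e ^ 2) * I 4) ∧
      (SG3.iotaOne lam = 2 →
        u (SG3.p lam 1) = 1 / (54 + 165 * e + 102 * e ^ 2 + 15 * e ^ 3) *
          ((54 + 39 * e + 5 * e ^ 2) * f0
            + (60 * e + 76 * e ^ 2 + 15 * e ^ 3) * I 1
            + (30 * e + e ^ 2) * I 2
            + (36 * e + 20 * e ^ 2) * I 3) ∧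
        u (SG3.p lam 2) = 1 / (54 + 165 * e + 102 * e ^ 2 + 15 * e ^ 3) *
          ((54 + 39 * e + 5 * e ^ 2) * f0
            + (60 * e + 76 * e ^ 2 + 15 * e ^ 3) * I 2
            + (30 * e + e ^ 2) * I 1
            + (36 * e + 20 * e ^ 2) * I 3) ∧
        u (SG3.p lam 3) = (6 + 2 * e) / (6 + 15 * e + 3 * e ^ 2) * f0
          + (5 * e + 3 * e ^ 2) / (6 + 15 * e + 3 * e ^ 2) * I 3
          + 4 * e / (6 + 15 * e + 3 * e ^ 2) * (I 1 + I 2) ∧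
        u (SG3.p lam 4) = 1 / (54 + 165 * e + 102 * e ^ 2 + 15 * e ^ 3) *
          ((54 + 84 * e + 39 * e ^ 2 + 5 * e ^ 3) * f0
            + (24 * e + 12 * e ^ 2 + e ^ 3) * I 1
            + (30 * e + 27 * e ^ 2 + 4 * e ^ 3) * I 2
            + (27 * e + 24 * e ^ 2 + 5 * e ^ 3) * I 3) ∧
        u (SG3.p lam 5) = 1 / (54 + 165 * e + 102 * e ^ 2 + 15 * e ^ 3) *
          ((54 + 84 * e + 39 * e ^ 2 + 5 * e ^ 3) * f0
            + (24 * e + 12 * e ^ 2 + e ^ 3) * I 2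
            + (30 * e + 27 * e ^ 2 + 4 * e ^ 3) * I 1
            + (27 * e + 24 * e ^ 2 + 5 * e ^ 3) * I 3)) := by
  have hR := SG3.R_mem hlam0 hlam1
  obtain ⟨g, hg⟩ := SG3.exists_continuousMap_eqOn (SG3.isClosed_bdry lam) hf
  have hfg : EqOn g f (SG3.cut lam) := fun z hz => hg (Or.inr hz)
  have hsol := SG3.Prescription.isDirichletSolution_eval hlam0 hlam1 hfg
  refine ⟨⟨_, hsol, fun u hu => hu.eqOn hlam0 hlam1 hsol⟩,
    SG3.isDirichletSolution_hZero hR.1 hR.2, SG3.hasNormalDerivTop_eta hR.1 hR.2,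
    (SG3.isCutMeasure_iff hR.1 hR.2 _).2 (SG3.cutMeasure_eq hR.1 hR.2),
    fun ν hν => ((SG3.isCutMeasure_iff hR.1 hR.2 ν).1 hν).trans
      (SG3.cutMeasure_eq hR.1 hR.2).symm,
    fun i hi => SG3.integrableOn_comp_Flam hlam0 hlam1 hf hi, ?_⟩
  intro u hu e f0 I he hf0 hI
  have heq := hu.eqOn hlam0 hlam1 hsol
  obtain ⟨k1, k2⟩ := SG3.eval_dir_p hlam0 hlam1 g (f (SG3.q 0)) e I
    (he.trans (SG3.eta_eq_conductance hR.1 hR.2))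
    (fun i hi => by rw [hI, SG3.cutIntegral_eq hlam0 hlam1 hfg hi])
  subst hf0
  refine ⟨fun h => ?_, fun h => ?_⟩
  · have hl : SG3.letters lam = {4, 5} := by simp [SG3.letters, h]
    have hp : ∀ i ∈ SG3.letters lam, SG3.p lam i ∈ SG3.closedDomain lam :=
      fun i hi => SG3.p_mem_closedDomain hlam0 hlam1 i i hi le_rfl
    obtain ⟨v4, v5⟩ := k1 h
    rw [heq (hp 4 (by simp [hl])), heq (hp 5 (by simp [hl])), v4, v5]
    exact ⟨rfl, rfl⟩
  · have hl : SG3.letters lam = {1, 2, 3} := by simp [SG3.letters, h]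
    -- The five crucial points all lie at least as high as `p_1`.
    have hp : ∀ i, SG3.p lam i ∈ SG3.closedDomain lam :=
      fun i => SG3.p_mem_closedDomain hlam0 hlam1 i 1 (by simp [hl])
        (by fin_cases i <;> simp [SG3.height])
    obtain ⟨v1, v2, v3, v4, v5⟩ := k2 h
    rw [heq (hp 1), heq (hp 2), heq (hp 3), heq (hp 4), heq (hp 5), v1, v2, v3, v4, v5]
    exact ⟨rfl, rfl, rfl, rfl, rfl⟩
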